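/- Let $\mathcal T$ be a finite combinatorial tree with $p\ge 2$ vertices and root $v_0$; let $A$ be its adjacency matrix, $D$ its degree matrix, $\hat A,\hat D$ the matrices obtained by deleting the row and column of $v_0$, and $\psi(z)=\det(-zD+A)$, $\hat\psi(z)=\det(-z\hat D+\hat A)$. Let $T$ be the metric tree of shape $\mathcal T$ with all edges of length $l>0$, directed away from $v_0$, and with real potentials $q_j\in L_2(0,l)$ on the edges. Attach at $v_0$ a lead $[0,\infty)$ with zero potential, and impose the standard conditions (continuity and Kirchhoff; Neumann at pendant vertices) at all vertices. Let $\phi_D(\lambda),\phi_N(\lambda)$ be the characteristic functions of $T$, built edge by edge from the solutions $c_j,s_j$ of $-y''+q_jy=\lambda y$ with $(c_j,c_j')(0)=(1,0)$, $(s_j,s_j')(0)=(0,1)$ and normalized by $1$ and $0$ at a pendant vertex: $\phi_D$ is the value at $v_0$, and $\phi_N$ is minus the sum of the derivatives at $v_0$ along the finite edges. Put $E(\tau)=\phi_N(\tau^2)+i\tau\phi_D(\tau^2)$ and $S=E(\tau)/E(-\tau)$, $\tau=\sqrt\lambda$. A check ($\check\phi_D,\check\phi_N,\check E,\check S$) denotes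 the same objects for zero potentials on all edges. Then: 1. For every $\tau\neq0$ the problem on the tree with the lead has a solution whose restriction to the lead is $y_0(x)=\frac1{2i\tau}\left(e^{i\tau x}E(\tau)-e^{-i\tau x}E(-\tau)\right)$; if $E(\tau),E(-\tau)$ are not both $0$, the restriction of every solution is a multiple of it. 2. For every $\delta>0$: $S=\check S\,(1+o(1))$ as $\tau\to+\infty$ along the real $\tau$ whose distance from the real zeros of $\check E$ is at least $\delta$ (and $E(-\tau),\check E(-\tau)\ne0$ for all such large $\tau$). If another such problem $T'$ (with any shape with at least two vertices, length $l'$ and potentials) has $S'=S$ for all large real $\tau$ at which both are defined, then $\check S'=\check S$ as meromorphic functions. Thus $S$ determines $\check S$. 3. For all $\tau\in\mathbb C$: $\check\phi_D(\tau^2)=(-1)^{p-1}\hat\psi(\cos\tau l)$ and $\sin(\tau l)\,\check\phi_N(\tau^2)=(-1)^p\,\tau\,\psi(\cos\tau l)$. For $-1<z<1$ with $\hat\psi(z)\ne0$, and $\tau=\arccos z/l$, $$\frac{\psi(z)}{\hat\psi(z)}=-\frac{l}{\arccos z}\sqrt{1-z^2}\;\frac{\check\phi_N(\tau^2)}{\check\phi_D(\tau^2)}=-i\sqrt{1-z^2}\;\frac{\check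 S+1}{\check S-1},$$ where $\check S$ is taken at $\tau$, $\check\phi_D(\tau^2)\ne0$, $\check E(-\tau)\neq0$ and $\check S\ne1$. Consequently, when $l$ is known, $S$ alone determines the rational function $\psi/\hat\psi$: if $T'$ has $l'=l$ and $S'=S$ for all large real $\tau$ at which both are defined, then $\psi'/\hat\psi'=\psi/\hat\psi$. 4. For $\tau>0$, $\tau^2$ is an eigenvalue (embedded in the continuous spectrum) of the zero-potential operator on the tree with the lead if and only if $\psi$ and $\hat\psi$ both vanish at $\cos\tau l$; these common zeros give the factors that cancel in $\psi/\hat\psi$. 5. Consider finite branched continued fractions $-m_0z+\sum_{k=1}^{m_0}\frac1{g_k}$ in which every branch has the form $g=mz-\sum_{i=1}^{m-1}\frac1{g_i}$ with a positive integer $m$ and branches $g_i$ (so $g=z$ for $m=1$). Each describes a rooted tree: the coefficients are the degrees of the vertices and the branches are the outgoing edges. The fraction $\psi/\hat\psi$ has an expansion of this form that describes $\mathcal T$; it has only finitely many such expansions; each of them describes a rooted tree; and fractions that agree up to the order of branches describe rooted trees that are isomorphic (by a graph isomorphism preserving roots). For $T'$ with $l'=l$ one has $\check S'=\check S$ if and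 only if its rooted tree is described by one of the expansions of $\psi/\hat\psi$. In particular, if the expansion is unique up to the order of branches, then $S$ and $l$ determine the shape: every $T'$ with $l'=l$ and $S'=S$ for all large real $\tau$ at which both are defined has a rooted tree isomorphic to $\mathcal T$. 6. The functions $\check\phi_D(\tau^2)$ and $\check\phi_N(\tau^2)/\tau$ of $\tau$ have the period $2\pi/l$. The function $\check S$ of real $\tau$ has a least positive period $P$, and $\pi/l=kP$ for some positive integer $k$. Every $T'$ with $S'=S$ for all large real $\tau$ at which both are defined has the same $P$, satisfies $\pi/l'=k'P$ with a positive integer $k'$, and has the same total length, $(p'-1)l'=(p-1)l$, where $p'$ is its number of vertices. Thus $S$ determines $l$ up to a positive integer factor, and determines it exactly once the number of vertices is known. -/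

import Mathlib

universe u w

open Filter Topology MeasureTheory Polynomial

/-! ### Rooted combinatorial trees, the two determinants, branched continued fractions -/

/-- A combinatorial tree on the vertex set `V` with a chosen root. -/
structure RootedCombTree (V : Type u) where
  graph : SimpleGraph V
  isTree : graph.IsTree
  root : V

namespace RootedCombTree

noncomputable section

open scoped Classical

variable {V : Type u} [Fintype V]

/-- The end points `w` of the edges going out of `v`, all edges being directed away from the
root. -/
def children (T : RootedCombTree V) (v : V) : Finset V :=
  Finset.univ.filter fun w =>
    T.graph.Adj v w ∧ T.graph.dist T.root w = T.graph.dist T.root v + 1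

/-- The matrix `-z D + A` (degree matrix `D`, adjacency matrix `A`), with `z` an indeterminate. -/
def pencil (T : RootedCombTree V) : Matrix V V ℚ[X] :=
  -(X : ℚ[X]) • Matrix.diagonal (fun v => (T.graph.degree v : ℚ[X])) + T.graph.adjMatrix ℚ[X]

/-- `ψ(z) = det (-z D + A)`. -/
def psi (T : RootedCombTree V) : ℚ[X] := T.pencil.det

/-- `ψ̂(z) = det (-z D̂ + Â)`: the row and the column of the root are deleted (the degrees are
still those in the whole tree). -/
def psiHat (T : RootedCombTree V) : ℚ[X] :=
  (T.pencil.submatrix (Subtype.val : {v : V // v ≠ T.root} → V) Subtype.val).det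

/-- The rational function `ψ / ψ̂`. -/
def ratio (T : RootedCombTree V) : RatFunc ℚ :=
  algebraMap ℚ[X] (RatFunc ℚ) T.psi / algebraMap ℚ[X] (RatFunc ℚ) T.psiHat

/-- Same shape: an isomorphism of graphs that maps root to root. -/
def SameShape {W : Type w} (T : RootedCombTree V) (T' : RootedCombTree W) : Prop :=
  ∃ e : T.graph ≃g T'.graph, e T.root = T'.root

end

end RootedCombTree

/-- A finite formal branched continued fraction: a coefficient `m` and `n` branches. -/
inductive BranchedCF : Type
  | node (m n : ℕ) (sub : Fin n → BranchedCF) : BranchedCF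

namespace BranchedCF

noncomputable section

/-- The value of a branch: `m z - ∑ i, 1 / (value of the i-th sub-branch)`. -/
def tailValue : BranchedCF → RatFunc ℚ
  | node m _ sub => (m : RatFunc ℚ) * RatFunc.X - ∑ i, 1 / (sub i).tailValue

/-- The value of the whole fraction: `-m z + ∑ i, 1 / (value of the i-th branch)`. -/
def value : BranchedCF → RatFunc ℚ
  | node m _ sub => -(m : RatFunc ℚ) * RatFunc.X + ∑ i, 1 / (sub i).tailValue

/-- In a branch, a coefficient `m` is followed by `m - 1` sub-branches (one edge comes in,
`m - 1` go out). -/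
def IsTreeTail : BranchedCF → Prop
  | node m n sub => m = n + 1 ∧ ∀ i, (sub i).IsTreeTail

/-- The special form: the leading coefficient `m` is followed by `m` branches, each later
coefficient `m` by `m - 1` branches. -/
def IsTreeForm : BranchedCF → Prop
  | node m n sub => m = n ∧ ∀ i, (sub i).IsTreeTail

/-- Equality up to the order of the branches. -/
def EqUpToOrder : BranchedCF → BranchedCF → Prop
  | node m n sub, node m' n' sub' =>
      m = m' ∧ ∃ e : Fin n ≃ Fin n', ∀ i, (sub i).EqUpToOrder (sub' (e i))

open scoped Classical in
/-- The part of the rooted tree `T` that hangs at the vertex `v` is the one read off from the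
continued fraction: the coefficient is the degree of `v`, and the branches correspond to the edges
going out of `v`. -/
def Describes {V : Type u} [Fintype V] (T : RootedCombTree V) : BranchedCF → V → Prop
  | node m n sub, v =>
      m = T.graph.degree v ∧
        ∃ e : Fin n ≃ {w : V // w ∈ T.children v}, ∀ i, Describes T (sub i) (e i).1

end

end BranchedCF

namespace RootedCombTree

/-- `B` is an expansion of `ψ / ψ̂` into a branched continued fraction of the special form. -/
def IsExpansion {V : Type u} [Fintype V] (T : RootedCombTree V) (B : BranchedCF) : Prop :=
  B.IsTreeForm ∧ B.value = T.ratio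

/-- The shape of the rooted tree `T` is the one read off from `B`. -/
def ReadOffFrom {V : Type u} [Fintype V] (T : RootedCombTree V) (B : BranchedCF) : Prop :=
  BranchedCF.Describes T B T.root

end RootedCombTree

/-! ### The Sturm-Liouville problem on a tree with a lead -/

/-- `Y = (y, y')` solves `-y'' + q y = lam y` on `[0, L]`, with `y` and `y'` absolutely
continuous (integrated form of the equation). -/
structure IsEdgeSolution (q : ℝ → ℝ) (L : ℝ) (lam : ℂ) (Y : ℝ → ℂ × ℂ) : Prop where
  cont : ContinuousOn Y (Set.Icc 0 L)
  integral_fst : ∀ x ∈ Set.Icc 0 L, (Y x).1 = (Y 0).1 + ∫ t in (0 : ℝ)..x, (Y t).2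
  integral_snd : ∀ x ∈ Set.Icc 0 L,
    (Y x).2 = (Y 0).2 + ∫ t in (0 : ℝ)..x, ((q t : ℂ) - lam) * (Y t).1

/-- The solution of the initial value problem `(y(0), y'(0)) = y₀` on `[0, L]`
(for integrable `q` it exists and is unique on `[0, L]`). -/
noncomputable def initialValueSolution (q : ℝ → ℝ) (L : ℝ) (lam : ℂ) (y₀ : ℂ × ℂ) :
    ℝ → ℂ × ℂ :=
  Classical.epsilon fun Y => IsEdgeSolution q L lam Y ∧ Y 0 = y₀

/-- A compact equilateral tree: a rooted tree all of whose edges have length `l`, with a real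
`L²` potential on each edge. The edge that comes into `v ≠ root` is called the edge `v`; it is
parametrized by `[0, l]` in the direction away from the root, and `q v` is its potential
(`q root` is not used). A lead `[0, ∞)` with zero potential is attached at the root. -/
structure QuantumTree (V : Type u) extends RootedCombTree V where
  l : ℝ
  l_pos : 0 < l
  q : V → ℝ → ℝ
  q_memLp : ∀ v, v ≠ root → MemLp (q v) 2 (volume.restrict (Set.Icc 0 l))

namespace QuantumTree

noncomputable section

open scoped Classical

variable {V : Type u} [Fintype V]

/-- The same tree with zero potentials on all edges. -/
def zeroPotential (T : QuantumTree V) : QuantumTree V where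
  toRootedCombTree := T.toRootedCombTree
  l := T.l
  l_pos := T.l_pos
  q := fun _ _ => 0
  q_memLp := fun _ _ => MemLp.zero'

/-- `Y v = (y, y')` on the edge `v`, and `Y₀ = (y, y')` on the lead, solve the equations on all
edges and on the lead, with the standard conditions at all vertices. -/
structure IsSolution (T : QuantumTree V) (lam : ℂ) (Y : V → ℝ → ℂ × ℂ) (Y₀ : ℝ → ℂ × ℂ) :
    Prop where
  edge : ∀ v, v ≠ T.root → IsEdgeSolution (T.q v) T.l lam (Y v)
  lead : ∀ L, 0 < L → IsEdgeSolution (fun _ => 0) L lam Y₀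
  continuity : ∀ v, v ≠ T.root → ∀ w ∈ T.children v, (Y w 0).1 = (Y v T.l).1
  kirchhoff : ∀ v, v ≠ T.root → (Y v T.l).2 = ∑ w ∈ T.children v, (Y w 0).2
  root_continuity : ∀ w ∈ T.children T.root, (Y w 0).1 = (Y₀ 0).1
  root_kirchhoff : (Y₀ 0).2 + ∑ w ∈ T.children T.root, (Y w 0).2 = 0

/-- `lam` is an eigenvalue of the operator `B` in `L²` of the tree with the lead: there is a
nonzero square integrable solution. -/
def IsEigenvalue (T : QuantumTree V) (lam : ℂ) : Prop :=
  ∃ Y Y₀, T.IsSolution lam Y Y₀ ∧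
    MemLp (fun x => (Y₀ x).1) 2 (volume.restrict (Set.Ici (0 : ℝ))) ∧
    ((∃ v, v ≠ T.root ∧ ∃ x ∈ Set.Icc 0 T.l, (Y v x).1 ≠ 0) ∨
      ∃ x, 0 ≤ x ∧ (Y₀ x).1 ≠ 0)

/-- If a solution on the edge `w` has `(y(l), y'(l)) = (P.1, P.2)`, then this is
`(y(0), y'(0))`; here `c` and `s` are the solutions on the edge with `(c, c')(0) = (1, 0)` and
`(s, s')(0) = (0, 1)`. -/
def branchPair (T : QuantumTree V) (lam : ℂ) (w : V) (P : ℂ × ℂ) : ℂ × ℂ :=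
  let c := initialValueSolution (T.q w) T.l lam (1, 0) T.l
  let s := initialValueSolution (T.q w) T.l lam (0, 1) T.l
  (P.1 * s.2 - P.2 * s.1, -P.1 * c.2 + P.2 * c.1)

/-- The characteristic functions (Dirichlet, Neumann) of the part of the tree above `v`, by
recursion over the branches at `v`: the value at `v`, and the sum of the derivatives at `v` along
the outgoing edges. The first argument bounds the depth of the recursion; any bound that exceeds
the height of the tree above `v` gives the same result, and `(1, 0)` belongs to a pendant
vertex. -/
def charPair (T : QuantumTree V) (lam : ℂ) : ℕ → V → ℂ × ℂ
  | 0, _ => (1, 0)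
  | n + 1, v =>
      (∏ w ∈ T.children v, (T.branchPair lam w (T.charPair lam n w)).1,
        ∑ w ∈ T.children v, (T.branchPair lam w (T.charPair lam n w)).2 *
          ∏ w' ∈ (T.children v).erase w, (T.branchPair lam w' (T.charPair lam n w')).1)

/-- The characteristic function `φ_D` of the problem with the Dirichlet condition at the root;
it is the value of the solution at the beginning of the lead. -/
def phiD (T : QuantumTree V) (lam : ℂ) : ℂ := (T.charPair lam (Fintype.card V) T.root).1

/-- The characteristic function `φ_N` of the problem with the standard (Neumann) condition at the
root; it is the derivative of the solution at the beginning of the lead, that is, minus the sum of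
the derivatives along the finite edges at the root. -/
def phiN (T : QuantumTree V) (lam : ℂ) : ℂ := -(T.charPair lam (Fintype.card V) T.root).2

/-- The Jost function `E(τ) = φ_N(τ²) + i τ φ_D(τ²)`, where `τ = √λ`. -/
def jost (T : QuantumTree V) (τ : ℂ) : ℂ := T.phiN (τ ^ 2) + Complex.I * τ * T.phiD (τ ^ 2)

/-- The S-function `E(τ) / E(-τ)`, where `τ = √λ`; meaningful where `E(-τ) ≠ 0`. -/
def sFunction (T : QuantumTree V) (τ : ℂ) : ℂ := T.jost τ / T.jost (-τ)

/-- The real zeros of the Jost function. -/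
def realZeros (T : QuantumTree V) : Set ℝ := {t | T.jost t = 0}

/-- `T` and `T'` have the same S-function at all sufficiently large `λ = τ²` at which both are
defined. -/
def SameS {W : Type w} [Fintype W] (T : QuantumTree V) (T' : QuantumTree W) : Prop :=
  ∀ᶠ τ : ℝ in atTop, T.jost (-τ) ≠ 0 → T'.jost (-τ) ≠ 0 → T.sFunction τ = T'.sFunction τ

/-- `T` and `T'` have the same S-function as meromorphic functions of `τ`. -/
def EqS {W : Type w} [Fintype W] (T : QuantumTree V) (T' : QuantumTree W) : Prop :=
  ∀ τ : ℂ, T.jost (-τ) ≠ 0 → T'.jost (-τ) ≠ 0 → T.sFunction τ = T'.sFunction τ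

/-- `p` is a period of the S-function as a function of real `τ`. -/
def IsPeriodOfS (T : QuantumTree V) (p : ℝ) : Prop :=
  ∀ τ : ℝ, T.jost (-τ) ≠ 0 → T.jost (-(τ + p)) ≠ 0 → T.sFunction (τ + p) = T.sFunction τ

end

end QuantumTree

/-!
On every edge, the value and the sum of the outgoing derivatives at a vertex are transported by the
fundamental solutions, and at a vertex the branches are rescaled to a common value
(`vertexPair_eq`). A cross product of these pairs with the data of any solution vanishes at every
vertex (`cross_vertexPair`); this gives the form of the solutions on the lead.

For the zero potential the transport along an edge is the rotation by the angle `θ = τ l`. Hence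
the pair at a vertex is `(A (cos θ), τ sin θ Q (cos θ))` with polynomials `A`, `Q` that satisfy a
recursion over the branches (`RootedCombTree.polyPair_eq`). The elimination of the matrix `-z D + A`
from the leaves to the root has pivots expressed by the same polynomials, so that `ψ̂ = ± A` and
`ψ = ± (1 - z²) Q` at the root (`psiHat_eq`, `psi_eq`); and the recursion for the quotients is the
branched continued fraction (`IsTreeTail.tailValue_eq`, `IsTreeForm.value_eq`). Since `A (1) = 1`
and `Q (1)` is the number of edges, the value of a fraction determines this number, which leaves
finitely many expansions. Embedded eigenfunctions vanish on the lead, and they exist exactly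
where both components of the pair at the root vanish (`IsSolution.eq_zero`,
`exists_isSolution_of_vertexPair_eq_zero`).

A potential changes the pairs by `o(1)` for large real `τ`: rotating `(y, y' / τ)` by `τ x` leaves a
right-hand side of order `1 / τ` (`initialValueSolution_asymptotics`, `jost_boundedApprox`). If two
trees have the same S-function at large `τ`, one shifts a fixed real `τ` by large multiples of
`2π / l` that are almost multiples of `2π / l'` and passes to the limit: the zero-potential
functions `φ_N / φ_D` agree (`SameS.sameFree`). Everything that the S-function determines is read
off from this identity `b a' = b' a` between entire functions, where `a = φ_D` and `b = -φ_N / τ`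
(`freeValue`, `freeDeriv`): for `l' = l` the ratio `ψ / ψ̂`
(`sameFree_iff_ratio_eq`), the total length as the derivative of `b / a` at `0`
(`SameFree.length_eq`), and the group of periods of `b / a`, which is discrete because `b` has an
isolated zero at `0` (`SameFree.freePeriods_eq`, `exists_isLeast_period`).
-/

/-! ### Products of absolutely continuous functions -/

theorem IntervalIntegrable.absolutelyContinuousOnInterval_complex_integral {f : ℝ → ℂ} {a b : ℝ}
    (hf : IntervalIntegrable f volume a b) (F₀ : ℂ) :
    AbsolutelyContinuousOnInterval (fun x => F₀ + ∫ t in a..x, f t) a b := by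
  have h := hf.norm.absolutelyContinuousOnInterval_intervalIntegral (c := a) (by simp)
  rw [absolutelyContinuousOnInterval_iff] at h ⊢
  intro ε hε
  obtain ⟨δ, hδ, h⟩ := h ε hε
  refine ⟨δ, hδ, fun E hE hE' => lt_of_le_of_lt (Finset.sum_le_sum fun i hi => ?_) (h E hE hE')⟩
  have hmem := hE.1 i hi
  have hsub : ∀ x ∈ Set.uIcc a b, IntervalIntegrable f volume a x := fun x hx =>
    hf.mono_set (Set.uIcc_subset_uIcc (by simp) hx)
  rw [dist_eq_norm, dist_eq_norm, add_sub_add_left_eq_sub,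
    intervalIntegral.integral_interval_sub_left (hsub _ hmem.1) (hsub _ hmem.2),
    intervalIntegral.integral_interval_sub_left (hsub _ hmem.1).norm (hsub _ hmem.2).norm]
  exact (intervalIntegral.norm_integral_le_abs_integral_norm).trans (le_of_eq rfl)

/-- The product rule for two primitives of integrable functions, in integrated form. -/
theorem mul_eq_add_integral {F G f g : ℝ → ℂ} {L : ℝ} (hL : 0 ≤ L)
    (hf : IntervalIntegrable f volume 0 L) (hg : IntervalIntegrable g volume 0 L)
    (hF : ∀ x ∈ Set.Icc 0 L, F x = F 0 + ∫ t in (0 : ℝ)..x, f t)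
    (hG : ∀ x ∈ Set.Icc 0 L, G x = G 0 + ∫ t in (0 : ℝ)..x, g t) :
    ∀ x ∈ Set.Icc 0 L, F x * G x = F 0 * G 0 + ∫ t in (0 : ℝ)..x, (f t * G t + F t * g t) := by
  set F₁ : ℝ → ℂ := fun x => F 0 + ∫ t in (0 : ℝ)..x, f t
  set G₁ : ℝ → ℂ := fun x => G 0 + ∫ t in (0 : ℝ)..x, g t
  have hu : Set.uIcc 0 L = Set.Icc 0 L := Set.uIcc_of_le hL
  have aF : AbsolutelyContinuousOnInterval F₁ 0 L :=
    hf.absolutelyContinuousOnInterval_complex_integral _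
  have aG : AbsolutelyContinuousOnInterval G₁ 0 L :=
    hg.absolutelyContinuousOnInterval_complex_integral _
  have hi : IntervalIntegrable (fun t => f t * G₁ t + F₁ t * g t) volume 0 L :=
    (hf.mul_continuousOn aG.continuousOn).add (hg.continuousOn_mul aF.continuousOn)
  have aH := hi.absolutelyContinuousOnInterval_complex_integral 0
  have aD := (aF.smul aG).sub aH
  obtain ⟨c, hc⟩ := aD.const_of_ae_hasDerivAt_zero (by
    filter_upwards [hf.ae_hasDerivAt_integral, hg.ae_hasDerivAt_integral,
      hi.ae_hasDerivAt_integral] with x h1 h2 h3 hx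
    have h1 := (h1 hx 0 (by simp)).const_add (F 0)
    have h2 := (h2 hx 0 (by simp)).const_add (G 0)
    have h3 := (h3 hx 0 (by simp)).const_add 0
    have := (h1.mul h2).sub h3
    convert! this using 1
    simp [F₁, G₁])
  intro x hx
  have h0 := hc 0 (by simp)
  have h1 := hc x (by rwa [hu])
  have e : ∫ t in (0 : ℝ)..x, (f t * G t + F t * g t)
      = ∫ t in (0 : ℝ)..x, (f t * G₁ t + F₁ t * g t) := by
    refine intervalIntegral.integral_congr fun t ht => ?_
    rw [Set.uIcc_of_le hx.1] at ht
    have : t ∈ Set.Icc 0 L := ⟨ht.1, ht.2.trans hx.2⟩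
    simp only [hF t this, hG t this, F₁, G₁]
  rw [e, hF x hx, hG x hx]
  have := h1.trans h0.symm
  simp only [Pi.sub_apply, Pi.mul_apply, smul_eq_mul, F₁, G₁, intervalIntegral.integral_same,
    add_zero, zero_add, sub_zero] at this
  linear_combination this

/-! ### Existence and uniqueness for the initial value problem -/

/-- An exponential weight that grows fast enough absorbs the kernel `h` of a Volterra operator,
also if `h` is only square integrable. -/
theorem exists_weight_integral_le {h : ℝ → ℝ} {L : ℝ}
    (hh : MemLp h 2 (volume.restrict (Set.Icc 0 L))) :
    ∃ M : ℝ, 0 < M ∧ ∀ x ∈ Set.Icc 0 L,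
      ∫ t in (0 : ℝ)..x, Real.exp (M * t) * h t ≤ Real.exp (M * x) / 2 := by
  have hsq : IntegrableOn (fun t => h t ^ 2) (Set.Icc 0 L) := hh.integrable_sq
  have hint : IntegrableOn h (Set.Icc 0 L) := hh.integrable (by norm_num)
  set k : ℝ := ∫ t in Set.Icc 0 L, h t ^ 2
  have hk : 0 ≤ k := integral_nonneg fun t => sq_nonneg _
  -- with this exponent each of the two terms below is at most `e^{M x} / 4`
  refine ⟨2 * (k + 1), by linarith, fun x hx => ?_⟩
  set M := 2 * (k + 1) with hM
  have hM0 : 0 < M := by linarith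
  have hsub : Set.Icc 0 x ⊆ Set.Icc 0 L := Set.Icc_subset_Icc_right hx.2
  have i1 : IntervalIntegrable (fun t => h t ^ 2) volume 0 x :=
    (intervalIntegrable_iff_integrableOn_Icc_of_le hx.1).2 (hsq.mono_set hsub)
  have i2 : IntervalIntegrable h volume 0 x :=
    (intervalIntegrable_iff_integrableOn_Icc_of_le hx.1).2 (hint.mono_set hsub)
  have i3 : IntervalIntegrable (fun t => Real.exp (M * t) * h t) volume 0 x :=
    i2.continuousOn_mul (by fun_prop)
  have i4 : IntervalIntegrable (fun t => Real.exp (2 * M * t)) volume 0 x :=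
    (by fun_prop : Continuous _).intervalIntegrable _ _
  -- the inequality `a b ≤ (k + 1) a² + b² / (4 (k + 1))` with `a = e^{M t}`, `b = e^{M x} h`
  have pt : ∀ t ∈ Set.Icc 0 x, Real.exp (M * t) * h t ≤
      (k + 1) * Real.exp (-(M * x)) * Real.exp (2 * M * t)
        + Real.exp (M * x) / (4 * (k + 1)) * h t ^ 2 := by
    intro t _
    have e1 : Real.exp (2 * M * t) = Real.exp (M * t) ^ 2 := by
      rw [← Real.exp_nat_mul]; ring_nf
    have e2 : Real.exp (-(M * x)) = (Real.exp (M * x))⁻¹ := Real.exp_neg _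
    rw [e1, e2]
    set a := Real.exp (M * t)
    have ha : 0 < Real.exp (M * x) := Real.exp_pos _
    set b := Real.exp (M * x)
    have hk1 : 0 < k + 1 := by linarith
    have : (k + 1) * b⁻¹ * a ^ 2 + b / (4 * (k + 1)) * h t ^ 2 - a * h t
        = (2 * (k + 1) * a - b * h t) ^ 2 / (4 * (k + 1) * b) := by
      field_simp; ring
    have h0 : 0 ≤ (2 * (k + 1) * a - b * h t) ^ 2 / (4 * (k + 1) * b) := by positivity
    linarith
  have := intervalIntegral.integral_mono_on hx.1 i3
    ((i4.const_mul _).add (i1.const_mul _)) pt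
  refine this.trans ?_
  rw [intervalIntegral.integral_add (i4.const_mul _) (i1.const_mul _),
    intervalIntegral.integral_const_mul, intervalIntegral.integral_const_mul]
  have j1 : ∫ t in (0 : ℝ)..x, Real.exp (2 * M * t) = (Real.exp (2 * M * x) - 1) / (2 * M) := by
    rw [intervalIntegral.integral_comp_mul_left (fun t => Real.exp t) (c := 2 * M) (by positivity)]
    simp [div_eq_inv_mul]
  have j2 : ∫ t in (0 : ℝ)..x, h t ^ 2 ≤ k := by
    rw [intervalIntegral.integral_of_le hx.1, ← integral_Icc_eq_integral_Ioc]
    exact setIntegral_mono_set hsq (Eventually.of_forall fun t => sq_nonneg _)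
      hsub.eventuallyLE
  have e1 : Real.exp (2 * M * x) = Real.exp (M * x) ^ 2 := by
    rw [← Real.exp_nat_mul]; ring_nf
  rw [j1, e1, Real.exp_neg]
  have ha : 0 < Real.exp (M * x) := Real.exp_pos _
  set b := Real.exp (M * x)
  have hk1 : 0 < k + 1 := by linarith
  have t1 : (k + 1) * b⁻¹ * ((b ^ 2 - 1) / (2 * M)) ≤ b / 4 := by
    have : b / 4 - (k + 1) * b⁻¹ * ((b ^ 2 - 1) / (2 * M)) = b⁻¹ / 4 := by
      rw [hM]; field_simp; ring
    have : 0 < b⁻¹ := by positivity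
    linarith
  have t2 : b / (4 * (k + 1)) * ∫ t in (0 : ℝ)..x, h t ^ 2 ≤ b / 4 := by
    calc _ ≤ b / (4 * (k + 1)) * (k + 1) := by gcongr; linarith
      _ = b / 4 := by field_simp
  linarith

section
variable {q : ℝ → ℝ} {L : ℝ} {lam : ℂ}

theorem MemLp.intervalIntegrable_sub (hL : 0 ≤ L)
    (hq : MemLp q 2 (volume.restrict (Set.Icc 0 L))) (lam : ℂ) :
    IntervalIntegrable (fun t => (q t : ℂ) - lam) volume 0 L := by
  have hint : IntegrableOn q (Set.Icc 0 L) := hq.integrable (by norm_num)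
  have hint' : IntegrableOn (fun t => (q t : ℂ)) (Set.Icc 0 L) := Integrable.ofReal hint
  exact ((intervalIntegrable_iff_integrableOn_Icc_of_le hL).2 hint').sub
    intervalIntegrable_const

/-- The integral operator of the initial value problem shrinks functions by the factor `1/2` in a
norm with exponential weight. -/
theorem exists_weight_integral_pair_le
    (hq : MemLp q 2 (volume.restrict (Set.Icc 0 L))) (lam : ℂ) :
    ∃ M : ℝ, 0 < M ∧ ∀ (U : ℝ → ℂ × ℂ) (d : ℝ), 0 ≤ d → ContinuousOn U (Set.Icc 0 L) →
      (∀ t ∈ Set.Icc 0 L, ‖U t‖ ≤ d * Real.exp (M * t)) → ∀ x ∈ Set.Icc 0 L,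
        ‖((∫ t in (0 : ℝ)..x, (U t).2, ∫ t in (0 : ℝ)..x, ((q t : ℂ) - lam) * (U t).1) : ℂ × ℂ)‖
          ≤ d * Real.exp (M * x) / 2 := by
  have hh : MemLp (fun t => (1 + ‖lam‖) + |q t|) 2 (volume.restrict (Set.Icc 0 L)) :=
    (memLp_const (1 + ‖lam‖)).add (f := fun _ => 1 + ‖lam‖) (g := fun t => |q t|) hq.norm
  obtain ⟨M, hM, hw⟩ := exists_weight_integral_le hh
  refine ⟨M, hM, fun U d hd hU hUd x hx => ?_⟩
  have hsub : Set.Icc 0 x ⊆ Set.Icc 0 L := Set.Icc_subset_Icc_right hx.2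
  have i0 : IntervalIntegrable (fun t => (1 + ‖lam‖) + |q t|) volume 0 x :=
    (intervalIntegrable_iff_integrableOn_Icc_of_le hx.1).2
      (IntegrableOn.mono_set (hh.integrable (by norm_num)) hsub)
  have i1 : IntervalIntegrable (fun t => Real.exp (M * t) * ((1 + ‖lam‖) + |q t|)) volume 0 x :=
    i0.continuousOn_mul (by fun_prop)
  have key : ∀ f : ℝ → ℂ, (∀ t ∈ Set.Icc 0 x, ‖f t‖ ≤ ((1 + ‖lam‖) + |q t|) * ‖U t‖) →
      ‖∫ t in (0 : ℝ)..x, f t‖ ≤ d * Real.exp (M * x) / 2 := by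
    intro f hf
    calc ‖∫ t in (0 : ℝ)..x, f t‖
        ≤ ∫ t in (0 : ℝ)..x, d * (Real.exp (M * t) * ((1 + ‖lam‖) + |q t|)) := by
          refine intervalIntegral.norm_integral_le_of_norm_le hx.1 ?_ (i1.const_mul d)
          refine Eventually.of_forall fun t ht => ?_
          have ht' : t ∈ Set.Icc 0 x := ⟨ht.1.le, ht.2⟩
          calc ‖f t‖ ≤ ((1 + ‖lam‖) + |q t|) * ‖U t‖ := hf t ht'
            _ ≤ ((1 + ‖lam‖) + |q t|) * (d * Real.exp (M * t)) := by
              gcongr; exact hUd t (hsub ht')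
            _ = _ := by ring
      _ = d * ∫ t in (0 : ℝ)..x, Real.exp (M * t) * ((1 + ‖lam‖) + |q t|) :=
          intervalIntegral.integral_const_mul _ _
      _ ≤ d * (Real.exp (M * x) / 2) := by gcongr; exact hw x hx
      _ = _ := by ring
  refine norm_prod_le_iff.2 ⟨key _ fun t _ => ?_, key _ fun t _ => ?_⟩
  · refine (norm_snd_le _).trans ?_
    nlinarith [norm_nonneg (U t), norm_nonneg lam, abs_nonneg (q t),
      mul_nonneg (norm_nonneg lam) (norm_nonneg (U t)),
      mul_nonneg (abs_nonneg (q t)) (norm_nonneg (U t))]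
  · rw [norm_mul]
    refine mul_le_mul ?_ (norm_fst_le _) (norm_nonneg _) (by positivity)
    refine (norm_sub_le _ _).trans ?_
    rw [Complex.norm_real, Real.norm_eq_abs]
    linarith

/-- Uniqueness: where the weighted difference of two solutions is largest, it is at most half of
itself. -/
theorem IsEdgeSolution.eqOn (hL : 0 ≤ L) (hq : MemLp q 2 (volume.restrict (Set.Icc 0 L)))
    {Y Z : ℝ → ℂ × ℂ} (hY : IsEdgeSolution q L lam Y) (hZ : IsEdgeSolution q L lam Z)
    (h0 : Y 0 = Z 0) : Set.EqOn Y Z (Set.Icc 0 L) := by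
  obtain ⟨M, hM, hw⟩ := exists_weight_integral_pair_le hq lam
  have hc : ContinuousOn (fun t => Real.exp (-(M * t)) * ‖Y t - Z t‖) (Set.Icc 0 L) :=
    (by fun_prop : ContinuousOn _ _).mul (hY.cont.sub hZ.cont).norm
  obtain ⟨x, hx, hmax⟩ := isCompact_Icc.exists_isMaxOn ⟨0, Set.left_mem_Icc.2 hL⟩ hc
  set d := Real.exp (-(M * x)) * ‖Y x - Z x‖ with hd
  have hb : ∀ t ∈ Set.Icc 0 L, ‖Y t - Z t‖ ≤ d * Real.exp (M * t) := by
    intro t ht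
    have := hmax ht
    simp only [Set.mem_ofPred_eq, ← hd] at this
    calc ‖Y t - Z t‖ = (Real.exp (-(M * t)) * ‖Y t - Z t‖) * Real.exp (M * t) := by
          rw [mul_right_comm, ← Real.exp_add]; simp
      _ ≤ _ := by gcongr
  have hs := hw (fun t => Y t - Z t) d (by positivity) (hY.cont.sub hZ.cont) hb x hx
  have hcx : ∀ W : ℝ → ℂ × ℂ, ContinuousOn W (Set.Icc 0 L) →
      ContinuousOn W (Set.uIcc 0 x) := fun W hW => hW.mono (by
    rw [Set.uIcc_of_le hx.1]; exact Set.Icc_subset_Icc_right hx.2)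
  have iq : IntervalIntegrable (fun t => (q t : ℂ) - lam) volume 0 x :=
    (MemLp.intervalIntegrable_sub hL hq lam).mono_set (by
      rw [Set.uIcc_of_le hx.1, Set.uIcc_of_le hL]; exact Set.Icc_subset_Icc_right hx.2)
  have e : Y x - Z x = (∫ t in (0 : ℝ)..x, (Y t - Z t).2,
      ∫ t in (0 : ℝ)..x, ((q t : ℂ) - lam) * (Y t - Z t).1) := by
    ext1
    · simp only [Prod.fst_sub, Prod.snd_sub]
      rw [intervalIntegral.integral_sub (hcx _ hY.cont).snd.intervalIntegrable
        (hcx _ hZ.cont).snd.intervalIntegrable, hY.integral_fst x hx, hZ.integral_fst x hx, h0]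
      ring
    · simp only [Prod.snd_sub, Prod.fst_sub, mul_sub]
      rw [intervalIntegral.integral_sub (iq.mul_continuousOn (hcx _ hY.cont).fst)
        (iq.mul_continuousOn (hcx _ hZ.cont).fst), hY.integral_snd x hx, hZ.integral_snd x hx, h0]
      ring
  rw [← e] at hs
  have hd0 : d ≤ 0 := by
    have : ‖Y x - Z x‖ = d * Real.exp (M * x) := by
      rw [hd, mul_right_comm, ← Real.exp_add]; simp
    rw [this] at hs
    have := Real.exp_pos (M * x)
    by_contra hcon
    push Not at hcon
    have := mul_pos hcon this
    linarith
  intro t ht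
  have := hb t ht
  have h2 : d * Real.exp (M * t) ≤ 0 := mul_nonpos_of_nonpos_of_nonneg hd0 (Real.exp_pos _).le
  exact sub_eq_zero.1 (norm_le_zero_iff.1 (this.trans h2))

/-- Existence: the solution is `e^{M t}` times the fixed point of a contraction of the continuous
functions on `[0, L]`. -/
theorem exists_isEdgeSolution (hL : 0 ≤ L) (hq : MemLp q 2 (volume.restrict (Set.Icc 0 L)))
    (lam : ℂ) (y₀ : ℂ × ℂ) : ∃ Y, IsEdgeSolution q L lam Y ∧ Y 0 = y₀ := by
  obtain ⟨M, hM, hw⟩ := exists_weight_integral_pair_le hq lam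
  have iq := MemLp.intervalIntegrable_sub hL hq lam
  have hu : Set.uIcc 0 L = Set.Icc 0 L := Set.uIcc_of_le hL
  -- the primitive of the right-hand side of the system
  let J : (ℝ → ℂ × ℂ) → ℝ → ℂ × ℂ := fun W x =>
    (∫ t in (0 : ℝ)..x, (W t).2, ∫ t in (0 : ℝ)..x, ((q t : ℂ) - lam) * (W t).1)
  have hJ : ∀ W, Continuous W → ContinuousOn (J W) (Set.Icc 0 L) := by
    intro W hW
    rw [← hu]
    exact (intervalIntegral.continuousOn_primitive_interval'
      (hW.snd.intervalIntegrable 0 L) Set.left_mem_uIcc).prodMk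
      (intervalIntegral.continuousOn_primitive_interval'
      (iq.mul_continuousOn hW.fst.continuousOn) Set.left_mem_uIcc)
  let ext : C(Set.Icc 0 L, ℂ × ℂ) → ℝ → ℂ × ℂ := fun U t =>
    Real.exp (M * t) • Set.IccExtend hL U t
  have hext : ∀ U, Continuous (ext U) := fun U =>
    (by fun_prop : Continuous fun t => Real.exp (M * t)).smul (U.continuous.Icc_extend' )
  let K : C(Set.Icc 0 L, ℂ × ℂ) → C(Set.Icc 0 L, ℂ × ℂ) := fun U =>
    ⟨fun x => Real.exp (-(M * x)) • (y₀ + J (ext U) x), by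
      have := continuousOn_iff_continuous_domRestrict.1 (hJ _ (hext U))
      exact (by fun_prop : Continuous fun x : Set.Icc 0 L => Real.exp (-(M * x))).smul
        (continuous_const.add this)⟩
  have hK : ContractingWith (1 / 2) K := by
    refine ⟨by
      rw [← NNReal.coe_lt_coe]; norm_num, LipschitzWith.of_dist_le_mul fun U V => ?_⟩
    rw [ContinuousMap.dist_le (by positivity)]
    intro x
    have hd : ∀ t ∈ Set.Icc 0 L, ‖ext U t - ext V t‖ ≤ dist U V * Real.exp (M * t) := by
      intro t ht
      simp only [ext, ← smul_sub, norm_smul, Real.norm_eq_abs, Real.abs_exp,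
        Set.IccExtend_of_mem hL _ ht]
      rw [mul_comm, ← dist_eq_norm]
      gcongr
      exact ContinuousMap.dist_apply_le_dist _
    have h1 := hw (fun t => ext U t - ext V t) (dist U V) dist_nonneg
      ((hext U).sub (hext V)).continuousOn hd x x.2
    have e : J (ext U) x - J (ext V) x = (∫ t in (0 : ℝ)..x, (ext U t - ext V t).2,
        ∫ t in (0 : ℝ)..x, ((q t : ℂ) - lam) * (ext U t - ext V t).1) := by
      have iqx : IntervalIntegrable (fun t => (q t : ℂ) - lam) volume 0 x :=
        iq.mono_set (by
          rw [Set.uIcc_of_le x.2.1, hu]; exact Set.Icc_subset_Icc_right x.2.2)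
      ext1
      · simp only [Prod.fst_sub, Prod.snd_sub, J]
        rw [intervalIntegral.integral_sub ((hext U).snd.intervalIntegrable _ _)
          ((hext V).snd.intervalIntegrable _ _)]
      · simp only [Prod.fst_sub, Prod.snd_sub, J, mul_sub]
        rw [intervalIntegral.integral_sub (iqx.mul_continuousOn (hext U).fst.continuousOn)
          (iqx.mul_continuousOn (hext V).fst.continuousOn)]
    rw [← e] at h1
    have e2 : K U x - K V x = Real.exp (-(M * x)) • (J (ext U) x - J (ext V) x) := by
      simp only [K, ContinuousMap.coe_mk, ← smul_sub, add_sub_add_left_eq_sub]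
    rw [dist_eq_norm, e2, norm_smul, Real.norm_eq_abs, Real.abs_exp]
    calc _ ≤ Real.exp (-(M * x)) * (dist U V * Real.exp (M * x) / 2) := by gcongr
      _ = (Real.exp (-(M * x)) * Real.exp (M * x)) * (dist U V / 2) := by ring
      _ = _ := by rw [← Real.exp_add]; simp; ring
  let U := hK.fixedPoint K
  have hU : ∀ x (hx : x ∈ Set.Icc 0 L), ext U x = y₀ + J (ext U) x := by
    intro x hx
    have h1 : K U ⟨x, hx⟩ = U ⟨x, hx⟩ := by rw [hK.fixedPoint_isFixedPt (f := K)]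
    have h2 : ext U x = Real.exp (M * x) • U ⟨x, hx⟩ := by
      simp only [ext, Set.IccExtend_of_mem hL _ hx]
    rw [h2, ← h1]
    simp only [K, ContinuousMap.coe_mk, smul_smul]
    rw [← Real.exp_add]; simp
  have h0 : ext U 0 = y₀ := by
    rw [hU 0 ⟨le_rfl, hL⟩]; simp [J]
  refine ⟨ext U, ⟨(hext U).continuousOn, fun x hx => ?_, fun x hx => ?_⟩, h0⟩
  · rw [h0]; exact congrArg Prod.fst (hU x hx)
  · rw [h0]; exact congrArg Prod.snd (hU x hx)

theorem initialValueSolution_spec (hL : 0 ≤ L) (hq : MemLp q 2 (volume.restrict (Set.Icc 0 L)))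
    (lam : ℂ) (y₀ : ℂ × ℂ) :
    IsEdgeSolution q L lam (initialValueSolution q L lam y₀) ∧
      initialValueSolution q L lam y₀ 0 = y₀ :=
  Classical.epsilon_spec (exists_isEdgeSolution hL hq lam y₀)

theorem IsEdgeSolution.smul_add_smul (hL : 0 ≤ L)
    (hq : MemLp q 2 (volume.restrict (Set.Icc 0 L))) {Y Z : ℝ → ℂ × ℂ}
    (hY : IsEdgeSolution q L lam Y) (hZ : IsEdgeSolution q L lam Z) (a b : ℂ) :
    IsEdgeSolution q L lam (fun x => a • Y x + b • Z x) := by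
  have iq := MemLp.intervalIntegrable_sub hL hq lam
  have hcx : ∀ x ∈ Set.Icc 0 L, ∀ W : ℝ → ℂ × ℂ, ContinuousOn W (Set.Icc 0 L) →
      ContinuousOn W (Set.uIcc 0 x) := fun x hx W hW => hW.mono (by
    rw [Set.uIcc_of_le hx.1]; exact Set.Icc_subset_Icc_right hx.2)
  have iqx : ∀ x ∈ Set.Icc 0 L, IntervalIntegrable (fun t => (q t : ℂ) - lam) volume 0 x :=
    fun x hx => iq.mono_set (by
      rw [Set.uIcc_of_le hx.1, Set.uIcc_of_le hL]; exact Set.Icc_subset_Icc_right hx.2)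
  refine ⟨(hY.cont.const_smul a).add (hZ.cont.const_smul b), fun x hx => ?_, fun x hx => ?_⟩
  · simp only [Prod.fst_add, Prod.smul_fst, Prod.snd_add, Prod.smul_snd, smul_eq_mul]
    rw [intervalIntegral.integral_add
      ((hcx x hx _ hY.cont).snd.intervalIntegrable.const_mul a)
      ((hcx x hx _ hZ.cont).snd.intervalIntegrable.const_mul b),
      intervalIntegral.integral_const_mul, intervalIntegral.integral_const_mul,
      hY.integral_fst x hx, hZ.integral_fst x hx]
    ring
  · simp only [Prod.fst_add, Prod.smul_fst, Prod.snd_add, Prod.smul_snd, smul_eq_mul, mul_add]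
    simp only [mul_left_comm _ a, mul_left_comm _ b]
    rw [intervalIntegral.integral_add
      (((iqx x hx).mul_continuousOn (hcx x hx _ hY.cont).fst).const_mul a)
      (((iqx x hx).mul_continuousOn (hcx x hx _ hZ.cont).fst).const_mul b),
      intervalIntegral.integral_const_mul, intervalIntegral.integral_const_mul,
      hY.integral_snd x hx, hZ.integral_snd x hx]
    ring

/-- Every solution is a combination of the two fundamental solutions. -/
theorem IsEdgeSolution.eq_combination (hL : 0 ≤ L)
    (hq : MemLp q 2 (volume.restrict (Set.Icc 0 L))) {Y : ℝ → ℂ × ℂ}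
    (hY : IsEdgeSolution q L lam Y) {x : ℝ} (hx : x ∈ Set.Icc 0 L) :
    Y x = (Y 0).1 • initialValueSolution q L lam (1, 0) x
      + (Y 0).2 • initialValueSolution q L lam (0, 1) x := by
  have hc := initialValueSolution_spec hL hq lam (1, 0)
  have hs := initialValueSolution_spec hL hq lam (0, 1)
  refine hY.eqOn hL hq (hc.1.smul_add_smul hL hq hs.1 (Y 0).1 (Y 0).2) ?_ hx
  rw [hc.2, hs.2]; simp

/-- The Wronskian of the two fundamental solutions is `1`. -/
theorem initialValueSolution_wronskian (hL : 0 ≤ L)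
    (hq : MemLp q 2 (volume.restrict (Set.Icc 0 L))) (lam : ℂ) :
    (initialValueSolution q L lam (1, 0) L).1 * (initialValueSolution q L lam (0, 1) L).2
      - (initialValueSolution q L lam (1, 0) L).2 * (initialValueSolution q L lam (0, 1) L).1
      = 1 := by
  obtain ⟨hc, hc0⟩ := initialValueSolution_spec hL hq lam (1, 0)
  obtain ⟨hs, hs0⟩ := initialValueSolution_spec hL hq lam (0, 1)
  set c := initialValueSolution q L lam (1, 0)
  set s := initialValueSolution q L lam (0, 1)
  have iq := MemLp.intervalIntegrable_sub hL hq lam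
  have hu : Set.uIcc 0 L = Set.Icc 0 L := Set.uIcc_of_le hL
  have cc : ContinuousOn c (Set.uIcc 0 L) := hu ▸ hc.cont
  have cs : ContinuousOn s (Set.uIcc 0 L) := hu ▸ hs.cont
  have hL' : L ∈ Set.Icc 0 L := ⟨hL, le_rfl⟩
  have h1 := mul_eq_add_integral hL cc.snd.intervalIntegrable (iq.mul_continuousOn cs.fst)
    (F := fun x => (c x).1) (G := fun x => (s x).2) hc.integral_fst hs.integral_snd L hL'
  have h2 := mul_eq_add_integral hL (iq.mul_continuousOn cc.fst) cs.snd.intervalIntegrable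
    (F := fun x => (c x).2) (G := fun x => (s x).1) hc.integral_snd hs.integral_fst L hL'
  have e : ∀ t, (c t).2 * (s t).2 + (c t).1 * (((q t : ℂ) - lam) * (s t).1)
      = ((q t : ℂ) - lam) * (c t).1 * (s t).1 + (c t).2 * (s t).2 := fun t => by ring
  simp only [e] at h1
  rw [h1, h2, hc0, hs0]
  simp

end

theorem isEdgeSolution_zero {L : ℝ} (τ : ℂ) (a b : ℂ) :
    IsEdgeSolution (fun _ => 0) L (τ ^ 2) (fun x =>
      (a * Complex.cos (τ * x) + b * Complex.sin (τ * x),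
        -τ * a * Complex.sin (τ * x) + τ * b * Complex.cos (τ * x))) := by
  have hlin : ∀ x : ℝ, HasDerivAt (fun x : ℝ => τ * (x : ℂ)) τ x := fun x => by
    simpa using (Complex.ofRealCLM.hasDerivAt (x := x)).const_mul τ
  have hcos : ∀ x : ℝ, HasDerivAt (fun x : ℝ => Complex.cos (τ * x))
      (-Complex.sin (τ * x) * τ) x := fun x => (Complex.hasDerivAt_cos _).comp x (hlin x)
  have hsin : ∀ x : ℝ, HasDerivAt (fun x : ℝ => Complex.sin (τ * x))
      (Complex.cos (τ * x) * τ) x := fun x => (Complex.hasDerivAt_sin _).comp x (hlin x)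
  refine ⟨by fun_prop, fun x _ => ?_, fun x _ => ?_⟩
  · rw [intervalIntegral.integral_eq_sub_of_hasDerivAt
      (f := fun x : ℝ => a * Complex.cos (τ * x) + b * Complex.sin (τ * x))]
    · ring
    · intro t _
      convert! ((hcos t).const_mul a).add ((hsin t).const_mul b) using 1
      ring
    · exact (by fun_prop : Continuous _).intervalIntegrable _ _
  · rw [intervalIntegral.integral_eq_sub_of_hasDerivAt
      (f := fun x : ℝ => -τ * a * Complex.sin (τ * x) + τ * b * Complex.cos (τ * x))]
    · ring
    · intro t _
      convert! ((hsin t).const_mul (-τ * a)).add ((hcos t).const_mul (τ * b)) using 1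
      push_cast
      ring
    · exact (by fun_prop : Continuous _).intervalIntegrable _ _

theorem isEdgeSolution_zero_linear {L : ℝ} (a b : ℂ) :
    IsEdgeSolution (fun _ => 0) L 0 (fun x => (a + b * x, b)) := by
  refine ⟨by fun_prop, fun x _ => ?_, fun x _ => ?_⟩
  · simp [mul_comm]
  · simp

/-- The fundamental solutions for the zero potential at the end of the edge. The value of `s` is
multiplied by `τ`, so that `τ = 0` is included. -/
theorem initialValueSolution_zero {L : ℝ} (hL : 0 ≤ L) (τ : ℂ) :
    initialValueSolution (fun _ => 0) L (τ ^ 2) (1, 0) L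
        = (Complex.cos (τ * L), -τ * Complex.sin (τ * L)) ∧
      τ * (initialValueSolution (fun _ => 0) L (τ ^ 2) (0, 1) L).1 = Complex.sin (τ * L) ∧
      (initialValueSolution (fun _ => 0) L (τ ^ 2) (0, 1) L).2 = Complex.cos (τ * L) := by
  have hq : MemLp (fun _ : ℝ => (0 : ℝ)) 2 (volume.restrict (Set.Icc 0 L)) := MemLp.zero'
  have hc := initialValueSolution_spec hL hq (τ ^ 2) (1, 0)
  have hs := initialValueSolution_spec hL hq (τ ^ 2) (0, 1)
  have hL' : L ∈ Set.Icc 0 L := ⟨hL, le_rfl⟩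
  refine ⟨?_, ?_⟩
  · have := hc.1.eqOn hL hq (isEdgeSolution_zero τ 1 0) (by rw [hc.2]; simp) hL'
    rw [this]; simp
  · rcases eq_or_ne τ 0 with rfl | hτ
    · have h0 : ((0 : ℂ) ^ 2) = 0 := by norm_num
      rw [h0] at hs ⊢
      have := hs.1.eqOn hL hq (isEdgeSolution_zero_linear 0 1) (by rw [hs.2]; simp) hL'
      rw [this]; simp
    · have := hs.1.eqOn hL hq (isEdgeSolution_zero τ 0 τ⁻¹) (by rw [hs.2]; simp [hτ]) hL'
      rw [this]; simp [hτ]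

/-! ### High-energy asymptotics on an edge -/

section
variable {q : ℝ → ℝ} {L : ℝ}

/-- Rotating `(y, y' / τ)` by the angle `τ x` removes the leading part of the equation: what is
left has a right-hand side of order `1 / τ`. -/
theorem IsEdgeSolution.rotation (hL : 0 ≤ L) (hq : MemLp q 2 (volume.restrict (Set.Icc 0 L)))
    {τ : ℝ} (hτ : τ ≠ 0) {Y : ℝ → ℂ × ℂ} (hY : IsEdgeSolution q L ((τ : ℂ) ^ 2) Y)
    {x : ℝ} (hx : x ∈ Set.Icc 0 L) :
    (Y x).1 * Complex.cos (τ * x) - (Y x).2 / τ * Complex.sin (τ * x)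
        = (Y 0).1 - (∫ t in (0 : ℝ)..x, q t * (Y t).1 * Complex.sin (τ * t)) / τ ∧
      (Y x).1 * Complex.sin (τ * x) + (Y x).2 / τ * Complex.cos (τ * x)
        = (Y 0).2 / τ + (∫ t in (0 : ℝ)..x, q t * (Y t).1 * Complex.cos (τ * t)) / τ := by
  have hτ' : (τ : ℂ) ≠ 0 := by exact_mod_cast hτ
  have iq := MemLp.intervalIntegrable_sub hL hq ((τ : ℂ) ^ 2)
  have iq0 := MemLp.intervalIntegrable_sub hL hq 0
  simp only [sub_zero] at iq0
  have hu : Set.uIcc 0 L = Set.Icc 0 L := Set.uIcc_of_le hL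
  have cY : ContinuousOn Y (Set.uIcc 0 L) := hu ▸ hY.cont
  have hlin : ∀ x : ℝ, HasDerivAt (fun x : ℝ => (τ : ℂ) * (x : ℂ)) τ x := fun x => by
    simpa using (Complex.ofRealCLM.hasDerivAt (x := x)).const_mul (τ : ℂ)
  have gcos : ∀ x ∈ Set.Icc 0 L, Complex.cos (τ * x) = Complex.cos (τ * (0 : ℝ))
      + ∫ t in (0 : ℝ)..x, -Complex.sin (τ * t) * τ := by
    intro x _
    rw [intervalIntegral.integral_eq_sub_of_hasDerivAt (f := fun x : ℝ => Complex.cos (τ * x))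
      (fun t _ => (Complex.hasDerivAt_cos _).comp t (hlin t))
      ((by fun_prop : Continuous _).intervalIntegrable _ _)]
    ring
  have gsin : ∀ x ∈ Set.Icc 0 L, Complex.sin (τ * x) = Complex.sin (τ * (0 : ℝ))
      + ∫ t in (0 : ℝ)..x, Complex.cos (τ * t) * τ := by
    intro x _
    rw [intervalIntegral.integral_eq_sub_of_hasDerivAt (f := fun x : ℝ => Complex.sin (τ * x))
      (fun t _ => (Complex.hasDerivAt_sin _).comp t (hlin t))
      ((by fun_prop : Continuous _).intervalIntegrable _ _)]
    ring
  have ic : IntervalIntegrable (fun t : ℝ => -Complex.sin (τ * t) * τ) volume 0 L :=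
    (by fun_prop : Continuous _).intervalIntegrable _ _
  have is : IntervalIntegrable (fun t : ℝ => Complex.cos (τ * t) * τ) volume 0 L :=
    (by fun_prop : Continuous _).intervalIntegrable _ _
  have i1 := cY.snd.intervalIntegrable (μ := volume)
  have i2 := iq.mul_continuousOn cY.fst
  have p1 := mul_eq_add_integral hL i1 ic (F := fun x => (Y x).1)
    (G := fun x : ℝ => Complex.cos (τ * x)) hY.integral_fst gcos x hx
  have p2 := mul_eq_add_integral hL i1 is (F := fun x => (Y x).1)
    (G := fun x : ℝ => Complex.sin (τ * x)) hY.integral_fst gsin x hx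
  have p3 := mul_eq_add_integral hL i2 ic (F := fun x => (Y x).2)
    (G := fun x : ℝ => Complex.cos (τ * x)) hY.integral_snd gcos x hx
  have p4 := mul_eq_add_integral hL i2 is (F := fun x => (Y x).2)
    (G := fun x : ℝ => Complex.sin (τ * x)) hY.integral_snd gsin x hx
  have hsub : Set.uIcc 0 x ⊆ Set.uIcc 0 L := by
    rw [Set.uIcc_of_le hx.1, hu]; exact Set.Icc_subset_Icc_right hx.2
  have ccos : Continuous fun t : ℝ => Complex.cos (τ * t) := by fun_prop
  have csin : Continuous fun t : ℝ => Complex.sin (τ * t) := by fun_prop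
  have j3 := ((i2.mul_continuousOn ccos.continuousOn).add
    (ic.continuousOn_mul cY.snd)).mono_set hsub
  have j4 := ((i2.mul_continuousOn csin.continuousOn).add
    (is.continuousOn_mul cY.snd)).mono_set hsub
  have ks := ((iq0.mul_continuousOn cY.fst).mul_continuousOn csin.continuousOn).mono_set hsub
  have kc := ((iq0.mul_continuousOn cY.fst).mul_continuousOn ccos.continuousOn).mono_set hsub
  have e1 : (∫ t in (0 : ℝ)..x, ((Y t).2 * Complex.cos (τ * t)
        + (Y t).1 * (-Complex.sin (τ * t) * τ))) * τ
      = (∫ t in (0 : ℝ)..x, ((((q t : ℂ) - τ ^ 2) * (Y t).1) * Complex.sin (τ * t)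
        + (Y t).2 * (Complex.cos (τ * t) * τ)))
        - ∫ t in (0 : ℝ)..x, q t * (Y t).1 * Complex.sin (τ * t) := by
    rw [← intervalIntegral.integral_sub j4 ks, ← intervalIntegral.integral_mul_const]
    congr 1; ext t; ring
  have e2 : (∫ t in (0 : ℝ)..x, ((Y t).2 * Complex.sin (τ * t)
        + (Y t).1 * (Complex.cos (τ * t) * τ))) * τ
      = (∫ t in (0 : ℝ)..x, q t * (Y t).1 * Complex.cos (τ * t))
        - ∫ t in (0 : ℝ)..x, ((((q t : ℂ) - τ ^ 2) * (Y t).1) * Complex.cos (τ * t)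
        + (Y t).2 * (-Complex.sin (τ * t) * τ)) := by
    rw [← intervalIntegral.integral_sub kc j3, ← intervalIntegral.integral_mul_const]
    congr 1; ext t; ring
  simp only [Complex.ofReal_zero, mul_zero, Complex.cos_zero, Complex.sin_zero, mul_one,
    zero_add] at p1 p2 p3 p4
  constructor
  · field_simp
    linear_combination (τ : ℂ) * p1 - p4 + e1
  · field_simp
    linear_combination (τ : ℂ) * p2 + p3 + e2

theorem norm_cos_real_mul_le (τ x : ℝ) : ‖Complex.cos (τ * x)‖ ≤ 1 := by
  rw [← Complex.ofReal_mul, ← Complex.ofReal_cos, Complex.norm_real]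
  exact Real.abs_cos_le_one _

theorem norm_sin_real_mul_le (τ x : ℝ) : ‖Complex.sin (τ * x)‖ ≤ 1 := by
  rw [← Complex.ofReal_mul, ← Complex.ofReal_sin, Complex.norm_real]
  exact Real.abs_sin_le_one _

/-- For `τ ≥ 4 ‖q‖₁`, the solution at the end of the edge differs from the one for the zero
potential by `O(1 / τ)`. -/
theorem IsEdgeSolution.norm_sub_le (hL : 0 ≤ L)
    (hq : MemLp q 2 (volume.restrict (Set.Icc 0 L))) {τ : ℝ} (hτ : 0 < τ)
    (hk : 4 * (∫ t in (0 : ℝ)..L, |q t|) ≤ τ) {Y : ℝ → ℂ × ℂ}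
    (hY : IsEdgeSolution q L ((τ : ℂ) ^ 2) Y) :
    ‖(Y L).1 - ((Y 0).1 * Complex.cos (τ * L) + (Y 0).2 / τ * Complex.sin (τ * L))‖
        ≤ 4 * (∫ t in (0 : ℝ)..L, |q t|) * (‖(Y 0).1‖ + ‖(Y 0).2 / τ‖) / τ ∧
      ‖(Y L).2 / τ - (-(Y 0).1 * Complex.sin (τ * L) + (Y 0).2 / τ * Complex.cos (τ * L))‖
        ≤ 4 * (∫ t in (0 : ℝ)..L, |q t|) * (‖(Y 0).1‖ + ‖(Y 0).2 / τ‖) / τ := by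
  set k := ∫ t in (0 : ℝ)..L, |q t| with hkdef
  have hτ' : (τ : ℂ) ≠ 0 := by exact_mod_cast hτ.ne'
  have hint : IntegrableOn (fun t => |q t|) (Set.Icc 0 L) := (hq.integrable (by norm_num)).abs
  have iq : IntervalIntegrable (fun t => |q t|) volume 0 L :=
    (intervalIntegrable_iff_integrableOn_Icc_of_le hL).2 hint
  have hk0 : 0 ≤ k := intervalIntegral.integral_nonneg hL fun t _ => abs_nonneg _
  obtain ⟨z, hz, hmax⟩ := isCompact_Icc.exists_isMaxOn ⟨0, Set.left_mem_Icc.2 hL⟩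
    hY.cont.fst.norm
  set m := ‖(Y z).1‖
  have hm : ∀ t ∈ Set.Icc 0 L, ‖(Y t).1‖ ≤ m := fun t ht => hmax ht
  have hm0 : 0 ≤ m := norm_nonneg _
  have bound : ∀ x ∈ Set.Icc 0 L, ∀ g : ℝ → ℂ, (∀ t, ‖g t‖ ≤ 1) →
      ‖(∫ t in (0 : ℝ)..x, q t * (Y t).1 * g t) / τ‖ ≤ k * m / τ := by
    intro x hx g hg
    have hs : Set.Icc 0 x ⊆ Set.Icc 0 L := Set.Icc_subset_Icc_right hx.2
    have iqx : IntervalIntegrable (fun t => |q t|) volume 0 x :=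
      (intervalIntegrable_iff_integrableOn_Icc_of_le hx.1).2 (hint.mono_set hs)
    rw [norm_div, Complex.norm_real, Real.norm_of_nonneg hτ.le]
    gcongr
    calc _ ≤ ∫ t in (0 : ℝ)..x, |q t| * m := by
          refine intervalIntegral.norm_integral_le_of_norm_le hx.1
            (Eventually.of_forall fun t ht => ?_) (iqx.mul_const m)
          rw [norm_mul, norm_mul, Complex.norm_real, Real.norm_eq_abs]
          calc |q t| * ‖(Y t).1‖ * ‖g t‖ ≤ |q t| * m * 1 := by
                gcongr
                · exact hm t (hs ⟨ht.1.le, ht.2⟩)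
                · exact hg t
            _ = _ := mul_one _
      _ = (∫ t in (0 : ℝ)..x, |q t|) * m := intervalIntegral.integral_mul_const _ _
      _ ≤ k * m := by
          gcongr
          exact intervalIntegral.integral_mono_interval le_rfl hx.1 hx.2
            (Eventually.of_forall fun t => abs_nonneg _) iq
  have hC := fun x : ℝ => norm_cos_real_mul_le τ x
  have hS := fun x : ℝ => norm_sin_real_mul_le τ x
  have cs : ∀ x : ℝ, Complex.sin (τ * x) ^ 2 + Complex.cos (τ * x) ^ 2 = 1 := fun x =>
    Complex.sin_sq_add_cos_sq _
  -- undo the rotation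
  have two : ∀ u v C S : ℂ, ‖C‖ ≤ 1 → ‖S‖ ≤ 1 → ‖u‖ ≤ k * m / τ → ‖v‖ ≤ k * m / τ →
      ‖-u * C + v * S‖ ≤ 2 * (k * m / τ) := by
    intro u v C S hC hS hu hv
    calc _ ≤ ‖-u * C‖ + ‖v * S‖ := norm_add_le _ _
      _ = ‖u‖ * ‖C‖ + ‖v‖ * ‖S‖ := by rw [norm_mul, norm_mul, norm_neg]
      _ ≤ k * m / τ * 1 + k * m / τ * 1 := by gcongr
      _ = _ := by ring
  have main : ∀ x ∈ Set.Icc 0 L,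
      ‖(Y x).1 - ((Y 0).1 * Complex.cos (τ * x) + (Y 0).2 / τ * Complex.sin (τ * x))‖
        ≤ 2 * (k * m / τ) ∧
      ‖(Y x).2 / τ - (-(Y 0).1 * Complex.sin (τ * x) + (Y 0).2 / τ * Complex.cos (τ * x))‖
        ≤ 2 * (k * m / τ) := by
    intro x hx
    obtain ⟨r1, r2⟩ := hY.rotation hL hq hτ.ne' hx
    have b1 := bound x hx _ (fun t => hS t)
    have b2 := bound x hx _ (fun t => hC t)
    set u := (∫ t in (0 : ℝ)..x, q t * (Y t).1 * Complex.sin (τ * t)) / (τ : ℂ)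
    set v := (∫ t in (0 : ℝ)..x, q t * (Y t).1 * Complex.cos (τ * t)) / (τ : ℂ)
    constructor
    · convert! two u v _ _ (hC x) (hS x) b1 b2 using 2
      linear_combination Complex.cos (τ * x) * r1 + Complex.sin (τ * x) * r2
        - (Y x).1 * cs x
    · convert! two v u _ _ (by rw [norm_neg]; exact hC x) (hS x) b2 b1 using 2
      linear_combination -Complex.sin (τ * x) * r1 + Complex.cos (τ * x) * r2
        - (Y x).2 / τ * cs x
  set w := ‖(Y 0).1‖ + ‖(Y 0).2 / τ‖
  -- as `k ≤ τ / 4`, the maximum `m` is bounded by `w` plus one half of itself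
  have hmw : m ≤ 2 * w := by
    have h1 := (main z hz).1
    have h2 : ‖(Y 0).1 * Complex.cos (τ * z) + (Y 0).2 / τ * Complex.sin (τ * z)‖ ≤ w := by
      calc _ ≤ ‖(Y 0).1 * Complex.cos (τ * z)‖ + ‖(Y 0).2 / τ * Complex.sin (τ * z)‖ :=
            norm_add_le _ _
        _ = ‖(Y 0).1‖ * ‖Complex.cos (τ * z)‖ + ‖(Y 0).2 / τ‖ * ‖Complex.sin (τ * z)‖ := by
            rw [norm_mul, norm_mul]
        _ ≤ ‖(Y 0).1‖ * 1 + ‖(Y 0).2 / τ‖ * 1 := by gcongr; exacts [hC z, hS z]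
        _ = w := by rw [mul_one, mul_one]
    have h3 : m ≤ 2 * (k * m / τ) + w := by
      calc m = ‖((Y z).1 - ((Y 0).1 * Complex.cos (τ * z) + (Y 0).2 / τ * Complex.sin (τ * z)))
            + ((Y 0).1 * Complex.cos (τ * z) + (Y 0).2 / τ * Complex.sin (τ * z))‖ := by
              rw [sub_add_cancel]
        _ ≤ _ := (norm_add_le _ _).trans (add_le_add h1 h2)
    have h4 : 2 * (k * m / τ) ≤ m / 2 := by
      rw [mul_div_assoc', div_le_div_iff₀ hτ two_pos]
      nlinarith
    linarith
  have h5 : 2 * (k * m / τ) ≤ 4 * k * w / τ := by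
    rw [mul_div_assoc']
    have : k * m ≤ k * (2 * w) := by gcongr
    exact div_le_div_of_nonneg_right (by linarith) hτ.le
  have hLL : L ∈ Set.Icc 0 L := ⟨hL, le_rfl⟩
  exact ⟨(main L hLL).1.trans h5, (main L hLL).2.trans h5⟩

/-- The fundamental solutions at the end of the edge approach those for the zero potential. -/
theorem initialValueSolution_asymptotics (hL : 0 ≤ L)
    (hq : MemLp q 2 (volume.restrict (Set.Icc 0 L))) :
    Tendsto (fun τ : ℝ => (initialValueSolution q L ((τ : ℂ) ^ 2) (1, 0) L).1
      - Complex.cos (τ * L)) atTop (𝓝 0) ∧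
    Tendsto (fun τ : ℝ => (initialValueSolution q L ((τ : ℂ) ^ 2) (1, 0) L).2 / τ
      + Complex.sin (τ * L)) atTop (𝓝 0) ∧
    Tendsto (fun τ : ℝ => τ * (initialValueSolution q L ((τ : ℂ) ^ 2) (0, 1) L).1
      - Complex.sin (τ * L)) atTop (𝓝 0) ∧
    Tendsto (fun τ : ℝ => (initialValueSolution q L ((τ : ℂ) ^ 2) (0, 1) L).2
      - Complex.cos (τ * L)) atTop (𝓝 0) := by
  set k := ∫ t in (0 : ℝ)..L, |q t|
  have lim : Tendsto (fun τ : ℝ => 4 * k / τ) atTop (𝓝 0) := tendsto_const_nhds.div_atTop tendsto_id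
  have ev : ∀ᶠ τ : ℝ in atTop, 0 < τ ∧ 4 * k ≤ τ :=
    (eventually_gt_atTop 0).and (eventually_ge_atTop _)
  have hc : ∀ τ : ℝ, 0 < τ → 4 * k ≤ τ → _ := fun τ h1 h2 =>
    (initialValueSolution_spec hL hq ((τ : ℂ) ^ 2) (1, 0)).1.norm_sub_le hL hq h1 h2
  have hs : ∀ τ : ℝ, 0 < τ → 4 * k ≤ τ → _ := fun τ h1 h2 =>
    (initialValueSolution_spec hL hq ((τ : ℂ) ^ 2) (0, 1)).1.norm_sub_le hL hq h1 h2
  simp only [(initialValueSolution_spec hL hq _ _).2] at hc hs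
  refine ⟨squeeze_zero_norm' (ev.mono fun τ h => ?_) lim,
    squeeze_zero_norm' (ev.mono fun τ h => ?_) lim,
    squeeze_zero_norm' (ev.mono fun τ h => ?_) lim,
    squeeze_zero_norm' (ev.mono fun τ h => ?_) lim⟩
  · simpa using (hc τ h.1 h.2).1
  · simpa using (hc τ h.1 h.2).2
  all_goals
    have hτ' : (τ : ℂ) ≠ 0 := by exact_mod_cast h.1.ne'
    have hn : ‖(τ : ℂ)‖ = τ := by rw [Complex.norm_real, Real.norm_of_nonneg h.1.le]
  · have := (hs τ h.1 h.2).1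
    calc _ = τ * ‖(initialValueSolution q L ((τ : ℂ) ^ 2) (0, 1) L).1
          - ((0 : ℂ) * Complex.cos (τ * L) + 1 / τ * Complex.sin (τ * L))‖ := by
            rw [← hn, ← norm_mul, hn]; congr 1; field_simp; ring
      _ ≤ τ * (4 * k * (‖(0 : ℂ)‖ + ‖1 / (τ : ℂ)‖) / τ) := by gcongr; exact h.1.le
      _ = 4 * k / τ := by
            rw [norm_zero, norm_div, hn, norm_one]; have := h.1.ne'; field_simp; ring
  · have := (hs τ h.1 h.2).2
    calc _ = τ * ‖(initialValueSolution q L ((τ : ℂ) ^ 2) (0, 1) L).2 / τ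
          - (-(0 : ℂ) * Complex.sin (τ * L) + 1 / τ * Complex.cos (τ * L))‖ := by
            rw [← hn, ← norm_mul, hn]; congr 1; field_simp; ring
      _ ≤ τ * (4 * k * (‖(0 : ℂ)‖ + ‖1 / (τ : ℂ)‖) / τ) := by gcongr; exact h.1.le
      _ = 4 * k / τ := by
            rw [norm_zero, norm_div, hn, norm_one]; have := h.1.ne'; field_simp; ring

end

/-! ### Rooted trees: parents, induction and recursion -/

namespace RootedCombTree

open scoped Classical

variable {V : Type u} [Fintype V] (T : RootedCombTree V)

theorem mem_children {v w : V} : w ∈ T.children v ↔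
    T.graph.Adj v w ∧ T.graph.dist T.root w = T.graph.dist T.root v + 1 := by
  simp [children]

theorem dist_of_mem_children {v w : V} (h : w ∈ T.children v) :
    T.graph.dist T.root w = T.graph.dist T.root v + 1 := (T.mem_children.1 h).2

theorem ne_root_of_mem_children {v w : V} (h : w ∈ T.children v) : w ≠ T.root := by
  rintro rfl
  simpa using T.dist_of_mem_children h

theorem adj_iff {v w : V} : T.graph.Adj v w ↔ w ∈ T.children v ∨ v ∈ T.children w := by
  refine ⟨fun h => ?_, ?_⟩
  · rcases T.isTree.dist_eq_dist_add_one_of_adj T.root h with h' | h'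
    · exact Or.inr (T.mem_children.2 ⟨h.symm, h'⟩)
    · exact Or.inl (T.mem_children.2 ⟨h, h'⟩)
  · rintro (h | h)
    · exact (T.mem_children.1 h).1
    · exact (T.mem_children.1 h).1.symm

theorem eq_of_mem_children {v v' w : V} (h : w ∈ T.children v) (h' : w ∈ T.children v') :
    v = v' := by
  rw [mem_children] at h h'
  obtain ⟨p, -, hp⟩ := T.isTree.connected.exists_path_of_dist T.root v
  obtain ⟨p', -, hp'⟩ := T.isTree.connected.exists_path_of_dist T.root v'
  have h1 : (p.concat h.1).IsPath :=
    (p.concat h.1).isPath_of_length_eq_dist (by rw [SimpleGraph.Walk.length_concat, hp, h.2])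
  have h2 : (p'.concat h'.1).IsPath :=
    (p'.concat h'.1).isPath_of_length_eq_dist (by rw [SimpleGraph.Walk.length_concat, hp', h'.2])
  have e := congrArg Subtype.val 
    ((T.isTree.isAcyclic.subsingleton_path _ _).elim ⟨_, h1⟩ ⟨_, h2⟩)
  have := congrArg SimpleGraph.Walk.penultimate e
  simpa using this

theorem exists_mem_children {w : V} (hw : w ≠ T.root) : ∃ v, w ∈ T.children v := by
  obtain ⟨p, -, hp⟩ := T.isTree.connected.exists_path_of_dist T.root w
  have hn : ¬ p.Nil := SimpleGraph.Walk.not_nil_of_ne hw.symm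
  refine ⟨p.penultimate, T.mem_children.2 ⟨p.adj_penultimate hn, ?_⟩⟩
  rcases T.isTree.dist_eq_dist_add_one_of_adj T.root (p.adj_penultimate hn) with h | h
  · have h1 : T.graph.dist T.root p.penultimate ≤ p.length - 1 := by
      refine (SimpleGraph.dist_le p.dropLast).trans (le_of_eq ?_)
      simp
    omega
  · exact h

theorem dist_lt_card (v : V) : T.graph.dist T.root v < Fintype.card V := by
  obtain ⟨p, hp, hl⟩ := T.isTree.connected.exists_path_of_dist T.root v
  rw [← hl]
  exact hp.length_lt

/-- Induction from the leaves to the root. -/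
theorem leaf_induction {P : V → Prop} (h : ∀ v, (∀ w ∈ T.children v, P w) → P v) (v : V) :
    P v := by
  induction hn : Fintype.card V - T.graph.dist T.root v using Nat.strong_induction_on
    generalizing v with
  | _ n ih =>
    refine h v fun w hw => ih _ ?_ w rfl
    have := T.dist_of_mem_children hw
    have := T.dist_lt_card v
    omega

/-- Induction from the root to the leaves. -/
theorem root_induction {P : V → Prop} (h0 : P T.root)
    (h : ∀ v, P v → ∀ w ∈ T.children v, P w) (v : V) : P v := by
  induction hn : T.graph.dist T.root v generalizing v with
  | zero =>
    have : T.root = v := T.isTree.connected.dist_eq_zero_iff.1 hn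
    exact this ▸ h0
  | succ n ih =>
    have hv : v ≠ T.root := by rintro rfl; simp at hn
    obtain ⟨u, hu⟩ := T.exists_mem_children hv
    exact h u (ih u (by have := T.dist_of_mem_children hu; omega)) v hu

/-- Recursion from the root to the leaves. -/
theorem exists_root_recursion {X : Type*} (r : X) (F : V → V → X → X) :
    ∃ k : V → X, k T.root = r ∧ ∀ v, ∀ w ∈ T.children v, k w = F v w (k v) := by
  have : Nonempty X := ⟨r⟩
  suffices ∀ n, ∃ k : V → X, k T.root = r ∧ ∀ v, T.graph.dist T.root v < n →
      ∀ w ∈ T.children v, k w = F v w (k v) by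
    obtain ⟨k, h0, hk⟩ := this (Fintype.card V)
    exact ⟨k, h0, fun v => hk v (T.dist_lt_card v)⟩
  intro n
  induction n with
  | zero => exact ⟨fun _ => r, rfl, fun v hv => absurd hv (Nat.not_lt_zero _)⟩
  | succ n ih =>
    obtain ⟨k, h0, hk⟩ := ih
    choose! par hpar using fun w (hw : w ≠ T.root) => T.exists_mem_children hw
    have hpc : ∀ v, ∀ w ∈ T.children v, par w = v := fun v w hw =>
      T.eq_of_mem_children (hpar w (T.ne_root_of_mem_children hw)) hw
    refine ⟨fun w => if T.graph.dist T.root w = n + 1 then F (par w) w (k (par w)) else k w,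
      by simp [h0], fun v hv w hw => ?_⟩
    have hd := T.dist_of_mem_children hw
    have hvn : T.graph.dist T.root v ≠ n + 1 := by omega
    simp only [hvn, if_false, hpc v w hw]
    split_ifs with hif
    · rfl
    · exact hk v (by omega) w hw

/-- Recursion from the leaves to the root. -/
theorem exists_leaf_recursion {X : Type*} (F : (v : V) → ({w // w ∈ T.children v} → X) → X) :
    ∃ f : V → X, ∀ v, f v = F v fun w => f w := by
  suffices ∀ n, ∃ f : V → X, ∀ v, Fintype.card V - T.graph.dist T.root v ≤ n →
      f v = F v fun w => f w by
    obtain ⟨f, hf⟩ := this (Fintype.card V)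
    exact ⟨f, fun v => hf v (Nat.sub_le _ _)⟩
  intro n
  induction n with
  | zero =>
    refine ⟨fun v => F v fun w => ?_, fun v hv => ?_⟩
    · -- an arbitrary element of `X`: by induction from the leaves, `X` is not empty
      exact Classical.choice (T.leaf_induction (P := fun _ => Nonempty X)
        (fun v h => ⟨F v fun w => Classical.choice (h w w.2)⟩) T.root)
    · have := T.dist_lt_card v; omega
  | succ n ih =>
    obtain ⟨f, hf⟩ := ih
    refine ⟨fun v => if Fintype.card V - T.graph.dist T.root v = n + 1 then F v fun w => f w
      else f v, fun v hv => ?_⟩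
    have hc : ∀ w ∈ T.children v, Fintype.card V - T.graph.dist T.root w ≠ n + 1 := by
      intro w hw
      have := T.dist_of_mem_children hw
      have := T.dist_lt_card v
      omega
    have e : (fun w : {w // w ∈ T.children v} =>
        if Fintype.card V - T.graph.dist T.root w.1 = n + 1 then F w.1 fun u => f u else f w.1)
        = fun w => f w.1 := by
      ext w; simp [hc w.1 w.2]
    simp only [e]
    split_ifs with hif
    · rfl
    · exact hf v (by omega)

theorem degree_root : T.graph.degree T.root = (T.children T.root).card := by
  rw [← SimpleGraph.card_neighborFinset_eq_degree]
  congr 1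
  ext w
  rw [SimpleGraph.mem_neighborFinset, T.adj_iff, or_iff_left]
  exact fun h => T.ne_root_of_mem_children h rfl

theorem degree_of_ne_root {v : V} (hv : v ≠ T.root) :
    T.graph.degree v = (T.children v).card + 1 := by
  obtain ⟨u, hu⟩ := T.exists_mem_children hv
  have hnot : u ∉ T.children v := fun h => by
    have h1 := T.dist_of_mem_children hu
    have h2 := T.dist_of_mem_children h
    omega
  rw [← SimpleGraph.card_neighborFinset_eq_degree, ← Finset.card_insert_of_notMem hnot]
  congr 1
  ext w
  rw [SimpleGraph.mem_neighborFinset, T.adj_iff, Finset.mem_insert, or_comm]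
  refine or_congr_left ⟨fun h => T.eq_of_mem_children h hu, ?_⟩
  rintro rfl
  exact hu

/-- If the value of `F` at `v` is the product of `f w * F w` over the children `w` of `v`, then
`F` is the product of `f` over the descendants. -/
@[to_additive]
theorem mul_eq_prod_univ {M : Type*} [CommMonoid M] {f F : V → M}
    (h : ∀ v, F v = ∏ w ∈ T.children v, f w * F w) : f T.root * F T.root = ∏ v, f v := by
  -- the vertices at distance `n` from the root
  let lev : ℕ → Finset V := fun n => Finset.univ.filter fun v => T.graph.dist T.root v = n
  have step : ∀ n, ∏ v ∈ lev n, F v = ∏ v ∈ lev (n + 1), f v * F v := by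
    intro n
    rw [Finset.prod_congr rfl fun v _ => h v, ← Finset.prod_biUnion]
    · congr 1
      ext w
      simp only [lev, Finset.mem_biUnion, Finset.mem_filter, Finset.mem_univ, true_and]
      refine ⟨fun ⟨v, hv, hw⟩ => by rw [T.dist_of_mem_children hw, hv], fun hw => ?_⟩
      have hr : w ≠ T.root := by rintro rfl; simp at hw
      obtain ⟨v, hv⟩ := T.exists_mem_children hr
      exact ⟨v, by have := T.dist_of_mem_children hv; omega, hv⟩
    · intro v _ v' _ hne
      rw [Function.onFun, Finset.disjoint_left]
      exact fun w hw hw' => hne (T.eq_of_mem_children hw hw')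
  have main : ∀ n, f T.root * F T.root
      = (∏ v ∈ Finset.univ.filter (fun v => T.graph.dist T.root v < n + 1), f v)
        * ∏ v ∈ lev n, F v := by
    intro n
    induction n with
    | zero =>
      have e : ∀ v, T.graph.dist T.root v = 0 ↔ v = T.root := fun v => by
        rw [T.isTree.connected.dist_eq_zero_iff, eq_comm]
      have e1 : lev 0 = {T.root} := by ext v; simp [lev, e]
      have e2 : (Finset.univ.filter fun v => T.graph.dist T.root v < 0 + 1) = {T.root} := by
        ext v; simp [e]
      rw [e1, e2, Finset.prod_singleton, Finset.prod_singleton]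
    | succ n ih =>
      rw [ih, step, Finset.prod_mul_distrib, ← mul_assoc]
      congr 1
      rw [← Finset.prod_union]
      · congr 1
        ext v
        simp only [lev, Finset.mem_union, Finset.mem_filter, Finset.mem_univ, true_and]
        omega
      · rw [Finset.disjoint_left]
        intro v hv hv'
        simp only [lev, Finset.mem_filter, Finset.mem_univ, true_and] at hv hv'
        omega
  rw [main (Fintype.card V), Finset.prod_eq_one (s := lev _), mul_one]
  · congr 1
    ext v
    simp only [Finset.mem_filter, Finset.mem_univ, true_and, iff_true]
    have := T.dist_lt_card v
    omega
  · intro v hv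
    simp only [lev, Finset.mem_filter, Finset.mem_univ, true_and] at hv
    have := T.dist_lt_card v
    omega

end RootedCombTree

/-! ### Combining the branches at a vertex -/

section combine

open scoped Classical

variable {ι κ R : Type*} [CommRing R]

/-- The pair (value, sum of outgoing derivatives) at a vertex, from the pairs (value, derivative)
at the beginnings of the branches `i ∈ s`: the branches are rescaled to a common value. -/
noncomputable def combine (s : Finset ι) (p : ι → R × R) : R × R :=
  (∏ i ∈ s, (p i).1, ∑ i ∈ s, (p i).2 * ∏ j ∈ s.erase i, (p j).1)

theorem combine_congr {s : Finset ι} {p p' : ι → R × R} (h : ∀ i ∈ s, p i = p' i) :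
    combine s p = combine s p' := by
  refine Prod.ext (Finset.prod_congr rfl fun i hi => by rw [h i hi])
    (Finset.sum_congr rfl fun i hi => ?_)
  rw [h i hi]
  congr 1
  exact Finset.prod_congr rfl fun j hj => by rw [h j (Finset.mem_of_mem_erase hj)]

theorem combine_equiv {s : Finset ι} [Fintype κ] (e : κ ≃ {i // i ∈ s}) (p : ι → R × R) :
    combine Finset.univ (fun k => p (e k)) = combine s p := by
  let f : κ ↪ ι := e.toEmbedding.trans (Function.Embedding.subtype _)
  have hs : s = Finset.univ.map f := by
    ext i
    simp only [Finset.mem_map, Finset.mem_univ, true_and]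
    exact ⟨fun hi => ⟨e.symm ⟨i, hi⟩, by simp [f]⟩, by rintro ⟨k, rfl⟩; exact (e k).2⟩
  have h1 : ∀ k, f k = (e k : ι) := fun k => rfl
  have h2 : combine (Finset.univ.map f) p = combine Finset.univ fun k => p (e k) := by
    have h3 : ∀ k, (Finset.univ.map f).erase (e k : ι) = (Finset.univ.erase k).map f := fun k => by
      rw [Finset.map_erase, h1]
    simp only [combine, Finset.prod_map, Finset.sum_map, h1, h3]
  rw [← h2, ← hs]

theorem map_combine {S : Type*} [CommRing S] (φ : R →+* S) (s : Finset ι) (p : ι → R × R) :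
    (φ (combine s p).1, φ (combine s p).2) = combine s fun i => (φ (p i).1, φ (p i).2) := by
  simp [combine, map_prod, map_sum]

theorem combine_snd_eq {K : Type*} [Field K] {s : Finset ι} {p : ι → K × K}
    (h : ∀ i ∈ s, (p i).1 ≠ 0) :
    (combine s p).2 = (combine s p).1 * ∑ i ∈ s, (p i).2 / (p i).1 := by
  simp only [combine, Finset.mul_sum]
  refine Finset.sum_congr rfl fun i hi => ?_
  rw [← Finset.mul_prod_erase s _ hi]
  field_simp [h i hi]

theorem combine_smul (s : Finset ι) (p : ι → R × R) (c : R) :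
    combine s (fun i => ((p i).1, c * (p i).2)) = ((combine s p).1, c * (combine s p).2) := by
  simp [combine, Finset.mul_sum, mul_assoc]

theorem combine_sign (s : Finset ι) (p : ι → R × R) {ε : ι → R} :
    combine s (fun i => (-ε i * (p i).1, ε i * (p i).2))
      = ((∏ i ∈ s, -ε i) * (combine s p).1, -(∏ i ∈ s, -ε i) * (combine s p).2) := by
  refine Prod.ext (by simp only [combine, Finset.prod_mul_distrib]) ?_
  simp only [combine, Finset.prod_mul_distrib, Finset.mul_sum]
  refine Finset.sum_congr rfl fun i hi => ?_
  rw [← Finset.mul_prod_erase _ (fun i => -ε i) hi]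
  ring

end combine

/-! ### The two polynomials of a branched continued fraction -/

/-- Passage along an edge: `(A, Q)` at its end becomes `(x A - (1 - x²) Q, A + x Q)`. With
`x = cos θ`, this is the rotation of `(A, Q sin θ)` by the angle `θ`. -/
def edgeStep {R : Type*} [CommRing R] (x : R) (P : R × R) : R × R :=
  (x * P.1 - (1 - x ^ 2) * P.2, P.1 + x * P.2)

namespace BranchedCF

/-- The polynomials `(A, Q)` such that, for the zero potential, the value at the root of the tree
described by the fraction is `A (cos θ)` and the sum of the outgoing derivatives is
`τ sin θ Q (cos θ)`, where `θ = τ l`. The coefficients of the fraction are not used. -/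
noncomputable def polyPair : BranchedCF → ℚ[X] × ℚ[X]
  | node _ _ sub => combine Finset.univ fun i => edgeStep X (sub i).polyPair

/-- The number of edges of the tree described by the fraction. -/
def edges : BranchedCF → ℕ
  | node _ _ sub => ∑ i, (1 + (sub i).edges)

theorem polyPair_node (m n : ℕ) (sub : Fin n → BranchedCF) :
    (node m n sub).polyPair = combine Finset.univ fun i => edgeStep X (sub i).polyPair := by
  rw [polyPair]

theorem edges_node (m n : ℕ) (sub : Fin n → BranchedCF) :
    (node m n sub).edges = ∑ i, (1 + (sub i).edges) := by
  rw [edges]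

theorem eval_one_polyPair (B : BranchedCF) :
    B.polyPair.1.eval 1 = 1 ∧ B.polyPair.2.eval 1 = B.edges := by
  induction B with
  | node m n sub ih =>
    have h1 : ∀ i, (edgeStep X (sub i).polyPair).1.eval 1 = 1 := fun i => by
      simp [edgeStep, (ih i).1]
    rw [polyPair_node, edges_node]
    constructor
    · simp [combine, eval_prod, h1]
    · simp only [combine, eval_finsetSum, eval_mul, eval_prod, h1, Finset.prod_const_one, mul_one,
        Nat.cast_sum, Nat.cast_add, Nat.cast_one]
      refine Finset.sum_congr rfl fun i _ => ?_
      simp [edgeStep, (ih i).1, (ih i).2]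

theorem polyPair_fst_ne_zero (B : BranchedCF) : B.polyPair.1 ≠ 0 := fun h => by
  simpa [h] using B.eval_one_polyPair.1

theorem edgeStep_polyPair_ne_zero (B : BranchedCF) : (edgeStep X B.polyPair).1 ≠ 0 := fun h => by
  have : (edgeStep X B.polyPair).1.eval 1 = 1 := by simp [edgeStep, B.eval_one_polyPair.1]
  simp [h] at this

/-- The polynomials `A` and `Q` have opposite parities. -/
theorem polyPair_comp_neg (B : BranchedCF) : ∃ ε : ℚ[X], ε ^ 2 = 1 ∧
    B.polyPair.1.comp (-X) = ε * B.polyPair.1 ∧ B.polyPair.2.comp (-X) = -ε * B.polyPair.2 := by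
  induction B with
  | node m n sub ih =>
    choose ε h1 h2 h3 using ih
    have e1 : ∀ i, (edgeStep X (sub i).polyPair).1.comp (-X)
        = -ε i * (edgeStep X (sub i).polyPair).1 := fun i => by
      simp only [edgeStep, sub_comp, mul_comp, X_comp, one_comp, pow_comp, h2, h3]; ring
    have e2 : ∀ i, (edgeStep X (sub i).polyPair).2.comp (-X)
        = ε i * (edgeStep X (sub i).polyPair).2 := fun i => by
      simp only [edgeStep, add_comp, mul_comp, X_comp, h2, h3]; ring
    have hm := map_combine (compRingHom (-X)) Finset.univ fun i => edgeStep X (sub i).polyPair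
    simp only [coe_compRingHom_apply, e1, e2] at hm
    rw [combine_sign, ← polyPair_node m n sub] at hm
    exact ⟨∏ i, -ε i, by simp [← Finset.prod_pow, h1], congrArg Prod.fst hm,
      congrArg Prod.snd hm⟩

local notation "ρ" => algebraMap ℚ[X] (RatFunc ℚ)

theorem algebraMap_ne_zero_of_ne_zero {p : ℚ[X]} (h : p ≠ 0) : ρ p ≠ 0 := by
  simpa using h

/-- The step along an edge and the combination at a vertex, in terms of the quotients: they
produce the continued fraction. -/
theorem one_sub_sq_mul_combine {ι : Type*} (s : Finset ι) (P : ι → ℚ[X] × ℚ[X])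
    (h : ∀ i ∈ s, (edgeStep X (P i)).1 ≠ 0) :
    (1 - RatFunc.X ^ 2) * ρ (combine s fun i => edgeStep X (P i)).2
      = ρ (combine s fun i => edgeStep X (P i)).1 *
        (∑ i ∈ s, ρ (P i).1 / ρ (edgeStep X (P i)).1 - (s.card : RatFunc ℚ) * RatFunc.X) := by
  have hm := map_combine ρ s fun i => edgeStep X (P i)
  have h1 := congrArg Prod.fst hm
  have h2 := congrArg Prod.snd hm
  simp only at h1 h2
  have h3 := combine_snd_eq (s := s)
    (p := fun i => (ρ (edgeStep X (P i)).1, ρ (edgeStep X (P i)).2))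
    fun i hi => algebraMap_ne_zero_of_ne_zero (h i hi)
  rw [h2, h3, ← h1, mul_left_comm]
  congr 1
  have : (s.card : RatFunc ℚ) * RatFunc.X = ∑ _i ∈ s, RatFunc.X := by simp
  rw [this, ← Finset.sum_sub_distrib, Finset.mul_sum]
  refine Finset.sum_congr rfl fun i hi => ?_
  have hne := algebraMap_ne_zero_of_ne_zero (h i hi)
  field_simp
  simp only [edgeStep, map_add, map_sub, map_mul, map_pow, map_one, RatFunc.algebraMap_X]
  ring

theorem IsTreeTail.tailValue_eq {B : BranchedCF} (h : B.IsTreeTail) :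
    B.tailValue = ρ (edgeStep X B.polyPair).1 / ρ B.polyPair.1 := by
  induction B with
  | node m n sub ih =>
    rw [IsTreeTail] at h
    have hA := algebraMap_ne_zero_of_ne_zero (node m n sub).polyPair_fst_ne_zero
    have key := one_sub_sq_mul_combine Finset.univ (fun i => (sub i).polyPair)
      fun i _ => (sub i).edgeStep_polyPair_ne_zero
    rw [tailValue, eq_div_iff hA]
    rw [← polyPair_node m n sub] at key
    simp only [edgeStep, map_sub, map_mul, map_pow, map_one, RatFunc.algebraMap_X]
    rw [key, Finset.sum_congr rfl fun i _ => by rw [ih i (h.2 i), one_div_div], h.1]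
    simp only [Finset.card_univ, Fintype.card_fin, Nat.cast_add, Nat.cast_one]
    ring

theorem IsTreeForm.value_eq {B : BranchedCF} (h : B.IsTreeForm) :
    B.value = (1 - RatFunc.X ^ 2) * ρ B.polyPair.2 / ρ B.polyPair.1 := by
  cases B with
  | node m n sub =>
    rw [IsTreeForm] at h
    have hA := algebraMap_ne_zero_of_ne_zero (node m n sub).polyPair_fst_ne_zero
    have key := one_sub_sq_mul_combine Finset.univ (fun i => (sub i).polyPair)
      fun i _ => (sub i).edgeStep_polyPair_ne_zero
    rw [← polyPair_node m n sub] at key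
    rw [key, value, eq_div_iff hA,
      Finset.sum_congr rfl fun i _ => by rw [(h.2 i).tailValue_eq, one_div_div], h.1]
    simp only [Finset.card_univ, Fintype.card_fin]
    ring

/-- Fractions of the special form with the same value have proportional pairs `(A, Q)`. -/
theorem IsTreeForm.value_eq_iff {B B' : BranchedCF} (h : B.IsTreeForm) (h' : B'.IsTreeForm) :
    B.value = B'.value ↔ B.polyPair.2 * B'.polyPair.1 = B'.polyPair.2 * B.polyPair.1 := by
  have hX : (1 - RatFunc.X ^ 2 : RatFunc ℚ) ≠ 0 := by
    have : (1 - X ^ 2 : ℚ[X]) ≠ 0 := fun h => by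
      simpa using congrArg (eval 0) h
    simpa using algebraMap_ne_zero_of_ne_zero this
  rw [h.value_eq, h'.value_eq,
    div_eq_div_iff (algebraMap_ne_zero_of_ne_zero B.polyPair_fst_ne_zero)
      (algebraMap_ne_zero_of_ne_zero B'.polyPair_fst_ne_zero), mul_assoc, mul_assoc,
    mul_right_inj' hX, ← map_mul, ← map_mul, (RatFunc.algebraMap_injective ℚ).eq_iff]

/-- The number of edges is determined by the value: it is `Q (1) / A (1)`. -/
theorem IsTreeForm.edges_eq_of_value_eq {B B' : BranchedCF} (h : B.IsTreeForm)
    (h' : B'.IsTreeForm) (hv : B.value = B'.value) : B.edges = B'.edges := by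
  have := congrArg (eval 1) ((h.value_eq_iff h').1 hv)
  simp only [eval_mul, B.eval_one_polyPair, B'.eval_one_polyPair, mul_one] at this
  exact_mod_cast this

end BranchedCF

/-! ### The continued fraction of a rooted tree -/

theorem Finset.card_of_equiv_fin {α : Type*} {n : ℕ} {s : Finset α} (e : Fin n ≃ {w // w ∈ s}) :
    s.card = n := by
  rw [← Fintype.card_coe, ← Fintype.card_congr e, Fintype.card_fin]

namespace RootedCombTree

open scoped Classical

variable {V : Type u} [Fintype V] (T : RootedCombTree V)

theorem exists_readOff : ∃ B : V → BranchedCF, ∀ v, B v =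
    BranchedCF.node (T.graph.degree v) (T.children v).card
      fun i => B ((T.children v).equivFin.symm i) :=
  T.exists_leaf_recursion fun v f =>
    BranchedCF.node (T.graph.degree v) (T.children v).card
      fun i => f ((T.children v).equivFin.symm i)

/-- The continued fraction read off from the part of the tree that hangs at a vertex. -/
noncomputable def readOff : V → BranchedCF := T.exists_readOff.choose

theorem readOff_eq (v : V) : T.readOff v =
    BranchedCF.node (T.graph.degree v) (T.children v).card
      fun i => T.readOff ((T.children v).equivFin.symm i) :=
  T.exists_readOff.choose_spec v

theorem describes_readOff (v : V) : BranchedCF.Describes T (T.readOff v) v := by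
  refine T.leaf_induction (P := fun v => BranchedCF.Describes T (T.readOff v) v) (fun v ih => ?_) v
  rw [readOff_eq, BranchedCF.Describes]
  exact ⟨rfl, (T.children v).equivFin.symm, fun i => ih _ ((T.children v).equivFin.symm i).2⟩

/-- The pair `(A, Q)` at a vertex. -/
noncomputable def polyPair (v : V) : ℚ[X] × ℚ[X] := (T.readOff v).polyPair

theorem polyPair_eq (v : V) :
    T.polyPair v = combine (T.children v) fun w => edgeStep X (T.polyPair w) := by
  rw [polyPair, readOff_eq, BranchedCF.polyPair_node]
  exact combine_equiv (T.children v).equivFin.symm fun w => edgeStep X (T.polyPair w)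

theorem polyPair_of_describes {B : BranchedCF} {v : V} (h : BranchedCF.Describes T B v) :
    B.polyPair = T.polyPair v := by
  induction B generalizing v with
  | node m n sub ih =>
    rw [BranchedCF.Describes] at h
    obtain ⟨-, e, he⟩ := h
    rw [BranchedCF.polyPair_node, polyPair_eq, ← combine_equiv e]
    congr 1
    ext1 i
    rw [ih i (he i)]

theorem isTreeTail_of_describes {B : BranchedCF} {v : V} (h : BranchedCF.Describes T B v)
    (hv : v ≠ T.root) : B.IsTreeTail := by
  induction B generalizing v with
  | node m n sub ih =>
    rw [BranchedCF.Describes] at h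
    obtain ⟨hm, e, he⟩ := h
    rw [BranchedCF.IsTreeTail]
    exact ⟨by rw [hm, T.degree_of_ne_root hv, Finset.card_of_equiv_fin e],
      fun i => ih i (he i) (T.ne_root_of_mem_children (e i).2)⟩

theorem ReadOffFrom.isTreeForm {B : BranchedCF} (h : T.ReadOffFrom B) : B.IsTreeForm := by
  cases B with
  | node m n sub =>
    rw [ReadOffFrom, BranchedCF.Describes] at h
    obtain ⟨hm, e, he⟩ := h
    rw [BranchedCF.IsTreeForm]
    exact ⟨by rw [hm, T.degree_root, Finset.card_of_equiv_fin e],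
      fun i => T.isTreeTail_of_describes (he i) (T.ne_root_of_mem_children (e i).2)⟩

theorem edges_readOff_root : (T.readOff T.root).edges + 1 = Fintype.card V := by
  have h : ∀ v, (T.readOff v).edges = ∑ w ∈ T.children v, (1 + (T.readOff w).edges) := by
    intro v
    rw [T.readOff_eq, BranchedCF.edges_node, ← Finset.sum_coe_sort (T.children v)]
    exact Equiv.sum_comp (T.children v).equivFin.symm fun w => 1 + (T.readOff w).edges
  have := T.add_eq_sum_univ (f := fun _ => 1) h
  rw [add_comm, this]
  simp

/-! ### The determinants -/

local notation "ρ" => algebraMap ℚ[X] (RatFunc ℚ)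

/-- A matrix that is unitriangular with respect to the levels `b` has determinant `1`. -/
theorem det_eq_one_of_level {n R : Type*} [Fintype n] [DecidableEq n] [CommRing R]
    (M : Matrix n n R) (b : n → ℕ) (h : ∀ i j, b j ≤ b i → M i j = if i = j then 1 else 0) :
    M.det = 1 := by
  have ht : M.BlockTriangular b := fun i j hij => by
    rw [h i j (le_of_lt hij), if_neg]
    rintro rfl
    exact lt_irrefl _ hij
  rw [ht.det]
  refine Finset.prod_eq_one fun k _ => ?_
  have : M.toSquareBlock b k = 1 := by
    ext i j
    rw [Matrix.toSquareBlock_def, Matrix.of_apply, h _ _ (by rw [i.2, j.2]), Matrix.one_apply]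
    simp only [Subtype.ext_iff]
  rw [this, Matrix.det_one]

/-- The pivots of the elimination of `-z D + A` from the leaves to the root. -/
noncomputable def pivot (v : V) : RatFunc ℚ :=
  if v = T.root then (1 - RatFunc.X ^ 2) * ρ (T.polyPair v).2 / ρ (T.polyPair v).1
  else -(ρ (edgeStep X (T.polyPair v)).1 / ρ (T.polyPair v).1)

theorem polyPair_fst_ne_zero (v : V) : ρ (T.polyPair v).1 ≠ 0 :=
  BranchedCF.algebraMap_ne_zero_of_ne_zero (T.readOff v).polyPair_fst_ne_zero

theorem edgeStep_polyPair_ne_zero (v : V) : ρ (edgeStep X (T.polyPair v)).1 ≠ 0 :=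
  BranchedCF.algebraMap_ne_zero_of_ne_zero (T.readOff v).edgeStep_polyPair_ne_zero

theorem pivot_of_mem_children {v w : V} (h : w ∈ T.children v) :
    T.pivot w = -(ρ (edgeStep X (T.polyPair w)).1 / ρ (T.polyPair w).1) := by
  rw [pivot, if_neg (T.ne_root_of_mem_children h)]

theorem pivot_ne_zero {v w : V} (h : w ∈ T.children v) : T.pivot w ≠ 0 := by
  rw [T.pivot_of_mem_children h]
  exact neg_ne_zero.2 (div_ne_zero (T.edgeStep_polyPair_ne_zero w) (T.polyPair_fst_ne_zero w))

theorem pivot_eq (v : V) : T.pivot v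
    = -(T.graph.degree v : RatFunc ℚ) * RatFunc.X - ∑ w ∈ T.children v, (T.pivot w)⁻¹ := by
  have key := BranchedCF.one_sub_sq_mul_combine (T.children v) T.polyPair
    fun w _ => (T.readOff w).edgeStep_polyPair_ne_zero
  rw [← T.polyPair_eq] at key
  have hs : ∑ w ∈ T.children v, (T.pivot w)⁻¹
      = -∑ w ∈ T.children v, ρ (T.polyPair w).1 / ρ (edgeStep X (T.polyPair w)).1 := by
    rw [← Finset.sum_neg_distrib]
    refine Finset.sum_congr rfl fun w hw => ?_
    rw [T.pivot_of_mem_children hw, inv_neg, inv_div]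
  have hA := T.polyPair_fst_ne_zero v
  rw [hs]
  set S := ∑ w ∈ T.children v, ρ (T.polyPair w).1 / ρ (edgeStep X (T.polyPair w)).1
  by_cases hv : v = T.root
  · subst hv
    rw [pivot, if_pos rfl, key, T.degree_root, mul_div_cancel_left₀ _ hA]
    ring
  · rw [pivot, if_neg hv, T.degree_of_ne_root hv, ← neg_div, div_eq_iff hA]
    simp only [edgeStep, map_sub, map_mul, map_pow, map_one, RatFunc.algebraMap_X, Nat.cast_add,
      Nat.cast_one]
    linear_combination key

/-- The unitriangular factor of the elimination. -/
noncomputable def elimFactor : Matrix V V (RatFunc ℚ) := fun v w =>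
  (if v = w then 1 else 0) + if w ∈ T.children v then (T.pivot w)⁻¹ else 0

theorem elimFactor_level (v w : V) (h : T.graph.dist T.root w ≤ T.graph.dist T.root v) :
    T.elimFactor v w = if v = w then 1 else 0 := by
  have : w ∉ T.children v := fun hw => by have := T.dist_of_mem_children hw; omega
  simp [elimFactor, this]

theorem pencil_apply (v w : V) : ρ (T.pencil v w) =
    (if v = w then -(T.graph.degree v : RatFunc ℚ) * RatFunc.X else 0)
      + if T.graph.Adj v w then 1 else 0 := by
  have h1 : T.pencil v w = -(X : ℚ[X]) * (if v = w then (T.graph.degree v : ℚ[X]) else 0)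
      + if T.graph.Adj v w then 1 else 0 := by
    simp [pencil, Matrix.diagonal_apply, SimpleGraph.adjMatrix_apply, neg_ite]
  rw [h1]
  split_ifs <;> simp [mul_comm]

/-- Elimination from the leaves to the root: `-z D + A = U P Uᵀ` with the diagonal matrix `P` of the
pivots. -/
theorem pencil_eq (v w : V) : ρ (T.pencil v w)
    = ∑ x, T.elimFactor v x * T.pivot x * T.elimFactor w x := by
  have e : ∀ x, T.elimFactor v x * T.pivot x * T.elimFactor w x
      = (if v = x then (if w = x then T.pivot x else 0) else 0)
        + (if v = x then (if x ∈ T.children w then 1 else 0) else 0)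
        + (if w = x then (if x ∈ T.children v then 1 else 0) else 0)
        + (if x ∈ T.children v then (if x ∈ T.children w then (T.pivot x)⁻¹ else 0) else 0) := by
    intro x
    by_cases h1 : x ∈ T.children v
    · have := T.pivot_ne_zero h1
      simp only [elimFactor, h1, if_true]
      split_ifs <;> field_simp <;> ring
    · by_cases h2 : x ∈ T.children w
      · have := T.pivot_ne_zero h2
        simp only [elimFactor, h1, h2, if_true, if_false]
        split_ifs <;> field_simp <;> ring
      · simp only [elimFactor, h1, h2, if_false]
        split_ifs <;> ring
  simp only [e, Finset.sum_add_distrib, Finset.sum_ite_eq, Finset.mem_univ, if_true, pencil_apply]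
  have hadj : (if T.graph.Adj v w then (1 : RatFunc ℚ) else 0)
      = (if v ∈ T.children w then 1 else 0) + if w ∈ T.children v then 1 else 0 := by
    by_cases h1 : w ∈ T.children v
    · have h2 : v ∉ T.children w := fun h => by
        have := T.dist_of_mem_children h1
        have := T.dist_of_mem_children h
        omega
      simp [T.adj_iff, h1, h2]
    · simp [T.adj_iff, h1]
  rw [hadj]
  by_cases hvw : v = w
  · subst hvw
    have hself : v ∉ T.children v := fun h => by have := T.dist_of_mem_children h; omega
    have : ∑ x, (if x ∈ T.children v then (if x ∈ T.children v then (T.pivot x)⁻¹ else 0) else 0)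
        = ∑ x ∈ T.children v, (T.pivot x)⁻¹ := by
      rw [← Finset.sum_filter]
      exact Finset.sum_congr (by ext; simp) fun x hx => by simp [hx]
    rw [this]
    simp only [hself, if_true, if_false]
    linear_combination -T.pivot_eq v
  · have : ∑ x, (if x ∈ T.children v then (if x ∈ T.children w then (T.pivot x)⁻¹ else 0) else 0)
        = 0 := by
      refine Finset.sum_eq_zero fun x _ => ?_
      split_ifs with h1 h2
      · exact absurd (T.eq_of_mem_children h1 h2) hvw
      · rfl
      · rfl
    rw [this]
    simp [hvw, Ne.symm hvw]

/-- The product of the pivots telescopes, since `A` at a vertex is the product of the first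
components of the steps along the outgoing edges. -/
theorem prod_subtype_pivot : ∏ v : {v // v ≠ T.root}, T.pivot v
    = (-1) ^ (Fintype.card V - 1) * ρ (T.polyPair T.root).1 := by
  have hr := T.edgeStep_polyPair_ne_zero T.root
  set f : V → RatFunc ℚ := fun v => ρ (edgeStep X (T.polyPair v)).1 / ρ (T.polyPair v).1
  have h : ∀ v, ρ (T.polyPair v).1 = ∏ w ∈ T.children v, f w * ρ (T.polyPair w).1 := by
    intro v
    rw [T.polyPair_eq, combine, map_prod]
    exact Finset.prod_congr rfl fun w _ => (div_mul_cancel₀ _ (T.polyPair_fst_ne_zero w)).symm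
  have h1 := T.mul_eq_prod_univ h
  rw [← Finset.mul_prod_erase _ _ (Finset.mem_univ T.root)] at h1
  have h2 := mul_left_cancel₀ (div_ne_zero hr (T.polyPair_fst_ne_zero T.root)) h1
  have h3 : ∏ v : {v // v ≠ T.root}, T.pivot v = ∏ v ∈ Finset.univ.erase T.root, T.pivot v :=
    (Finset.prod_subtype _ (by simp) _).symm
  rw [h3, h2, Finset.prod_congr rfl fun v hv => by
    rw [pivot, if_neg (Finset.ne_of_mem_erase hv)], Finset.prod_neg]
  simp [f, Finset.card_erase_of_mem]

/-- The determinant `ψ̂` is, up to sign, the polynomial `A` at the root. -/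
theorem psiHat_eq : T.psiHat = (-1) ^ (Fintype.card V - 1) * (T.polyPair T.root).1 := by
  apply RatFunc.algebraMap_injective ℚ
  rw [psiHat, RingHom.map_det]
  set U : Matrix {v // v ≠ T.root} {v // v ≠ T.root} (RatFunc ℚ) :=
    T.elimFactor.submatrix Subtype.val Subtype.val
  have hU : U.det = 1 := det_eq_one_of_level U (fun v => T.graph.dist T.root v) fun v w h => by
    change T.elimFactor v w = _
    rw [T.elimFactor_level _ _ h]
    simp only [Subtype.ext_iff]
  have e : (ρ).mapMatrix (T.pencil.submatrix (Subtype.val : {v : V // v ≠ T.root} → V) Subtype.val)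
      = U * Matrix.diagonal (fun v : {v // v ≠ T.root} => T.pivot v) * U.transpose := by
    ext v w
    simp only [RingHom.mapMatrix_apply, Matrix.map_apply, Matrix.submatrix_apply, pencil_eq]
    rw [Matrix.mul_apply]
    simp only [Matrix.mul_diagonal, Matrix.transpose_apply, U, Matrix.submatrix_apply]
    rw [← Finset.add_sum_erase _ _ (Finset.mem_univ T.root),
      ← Finset.sum_subtype (Finset.univ.erase T.root) (p := fun v => v ≠ T.root) (by simp)
        fun x => T.elimFactor v x * T.pivot x * T.elimFactor w x]
    have : T.elimFactor v T.root = 0 := by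
      rw [T.elimFactor_level _ _ (by simp), if_neg v.2]
    rw [this]; ring
  have hd := congrArg Matrix.det e
  rw [Matrix.det_mul, Matrix.det_mul, Matrix.det_transpose, hU, Matrix.det_diagonal, one_mul,
    mul_one, T.prod_subtype_pivot] at hd
  rw [map_mul, map_pow, map_neg, map_one, ← hd]

/-- The determinant `ψ` is, up to sign, `(1 - z²) Q` with the polynomial `Q` at the root. -/
theorem psi_eq :
    T.psi = (-1) ^ (Fintype.card V - 1) * ((1 - X ^ 2) * (T.polyPair T.root).2) := by
  apply RatFunc.algebraMap_injective ℚ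
  rw [psi, RingHom.map_det]
  have hU : T.elimFactor.det = 1 := det_eq_one_of_level _ _ T.elimFactor_level
  have e : (ρ).mapMatrix T.pencil
      = T.elimFactor * Matrix.diagonal T.pivot * T.elimFactor.transpose := by
    ext v w
    simp only [RingHom.mapMatrix_apply, Matrix.map_apply, pencil_eq]
    rw [Matrix.mul_apply]
    simp only [Matrix.mul_diagonal, Matrix.transpose_apply]
  rw [e, Matrix.det_mul, Matrix.det_mul, Matrix.det_transpose, hU, Matrix.det_diagonal, one_mul,
    mul_one, ← Finset.mul_prod_erase _ _ (Finset.mem_univ T.root),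
    Finset.prod_subtype _ (p := fun v => v ≠ T.root) (by simp), T.prod_subtype_pivot, pivot,
    if_pos rfl]
  have hA := T.polyPair_fst_ne_zero T.root
  simp only [map_sub, map_mul, map_pow, map_neg, map_one, RatFunc.algebraMap_X]
  field_simp

theorem ratio_eq : T.ratio
    = (1 - RatFunc.X ^ 2) * ρ (T.polyPair T.root).2 / ρ (T.polyPair T.root).1 := by
  have hA := T.polyPair_fst_ne_zero T.root
  rw [ratio, psi_eq, psiHat_eq]
  simp only [map_sub, map_mul, map_pow, map_neg, map_one, RatFunc.algebraMap_X]
  rw [mul_div_mul_left]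
  exact pow_ne_zero _ (by simp)

theorem ReadOffFrom.value_eq {B : BranchedCF} (h : T.ReadOffFrom B) : B.value = T.ratio := by
  rw [h.isTreeForm.value_eq, T.polyPair_of_describes h, ratio_eq]

theorem ReadOffFrom.isExpansion {B : BranchedCF} (h : T.ReadOffFrom B) : T.IsExpansion B :=
  ⟨h.isTreeForm, h.value_eq⟩

theorem readOffFrom_readOff_root : T.ReadOffFrom (T.readOff T.root) :=
  T.describes_readOff T.root

theorem ratio_eq_iff {W : Type w} [Fintype W] (T' : RootedCombTree W) : T'.ratio = T.ratio ↔
    (T'.polyPair T'.root).2 * (T.polyPair T.root).1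
      = (T.polyPair T.root).2 * (T'.polyPair T'.root).1 := by
  rw [← T.readOffFrom_readOff_root.value_eq, ← T'.readOffFrom_readOff_root.value_eq]
  exact T'.readOffFrom_readOff_root.isTreeForm.value_eq_iff T.readOffFrom_readOff_root.isTreeForm

end RootedCombTree

/-! ### Finitely many expansions -/

namespace BranchedCF

theorem le_edges_node (m n : ℕ) (sub : Fin n → BranchedCF) :
    n ≤ (node m n sub).edges ∧ ∀ i, (sub i).edges < (node m n sub).edges := by
  rw [edges_node]
  constructor
  · calc n = ∑ _i : Fin n, 1 := by simp
      _ ≤ _ := Finset.sum_le_sum fun i _ => Nat.le_add_right _ _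
  · intro i
    have := Finset.single_le_sum (f := fun i => 1 + (sub i).edges) (fun _ _ => Nat.zero_le _)
      (Finset.mem_univ i)
    omega

theorem finite_isTreeTail (N : ℕ) : {B : BranchedCF | B.IsTreeTail ∧ B.edges < N}.Finite := by
  induction N with
  | zero => simp
  | succ N ih =>
    refine ((Set.finite_Iic N).biUnion fun n _ =>
      (Set.Finite.pi' fun _ : Fin n => ih).image (node (n + 1) n)).subset ?_
    rintro ⟨m, n, sub⟩ ⟨h, hN⟩
    rw [IsTreeTail] at h
    have hle := le_edges_node m n sub
    refine Set.mem_biUnion (x := n) (Set.mem_Iic.2 (by omega)) ⟨sub, fun i => ⟨h.2 i, ?_⟩, ?_⟩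
    · have := hle.2 i; omega
    · rw [h.1]

theorem finite_isTreeForm (N : ℕ) : {B : BranchedCF | B.IsTreeForm ∧ B.edges = N}.Finite := by
  refine ((Set.finite_Iic N).biUnion fun n _ =>
    (Set.Finite.pi' fun _ : Fin n => finite_isTreeTail N).image (node n n)).subset ?_
  rintro ⟨m, n, sub⟩ ⟨h, hN⟩
  rw [IsTreeForm] at h
  have hle := le_edges_node m n sub
  refine Set.mem_biUnion (x := n) (Set.mem_Iic.2 (by omega)) ⟨sub, fun i => ⟨h.2 i, ?_⟩, ?_⟩
  · have := hle.2 i; omega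
  · rw [h.1]

end BranchedCF

namespace RootedCombTree

/-- The number of edges of an expansion is determined by its value, and finitely many fractions of
the special form have a given number of edges. -/
theorem finite_isExpansion {V : Type u} [Fintype V] (T : RootedCombTree V) :
    {B | T.IsExpansion B}.Finite := by
  refine (BranchedCF.finite_isTreeForm (T.readOff T.root).edges).subset fun B hB => ⟨hB.1, ?_⟩
  have h := T.readOffFrom_readOff_root
  exact hB.1.edges_eq_of_value_eq h.isTreeForm (hB.2.trans h.value_eq.symm)

/-! ### Rooted trees from continued fractions -/

open scoped Classical in
/-- A rooted tree given by the parent `par v` of every vertex `v ≠ root`; the rank `rk` becomes the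
distance from the root. -/
theorem exists_of_parent {V : Type u} [Fintype V] (root : V) (par : V → V) (rk : V → ℕ)
    (h0 : rk root = 0) (h : ∀ v, v ≠ root → rk v = rk (par v) + 1) :
    ∃ T : RootedCombTree V, T.root = root ∧ ∀ v w, w ∈ T.children v ↔ w ≠ root ∧ par w = v := by
  have hne : ∀ v, v ≠ root → par v ≠ v := fun v hv e => by
    have := h v hv
    rw [e] at this
    omega
  let G : SimpleGraph V := SimpleGraph.fromRel fun v w => w ≠ root ∧ par w = v
  have hG : ∀ v w, G.Adj v w ↔ (w ≠ root ∧ par w = v) ∨ (v ≠ root ∧ par v = w) := by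
    intro v w
    rw [SimpleGraph.fromRel_adj]
    refine ⟨fun h => h.2, fun h' => ⟨?_, h'⟩⟩
    rintro rfl
    rcases h' with h' | h' <;> exact hne _ h'.1 h'.2
  have hrk : ∀ v w, G.Adj v w → rk w ≤ rk v + 1 := by
    intro v w hvw
    rcases (hG v w).1 hvw with ⟨h1, h2⟩ | ⟨h1, h2⟩
    · rw [h w h1, h2]
    · rw [h v h1, h2]; omega
  have hlow : ∀ v w (p : G.Walk v w), rk w ≤ rk v + p.length := by
    intro v w p
    induction p with
    | nil => simp
    | cons hadj p ih =>
      have := hrk _ _ hadj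
      rw [SimpleGraph.Walk.length_cons]
      omega
  have hup : ∀ n v, rk v = n → ∃ p : G.Walk root v, p.length = n := by
    intro n
    induction n with
    | zero =>
      intro v hv
      have : v = root := by
        by_contra hne
        have := h v hne
        omega
      subst this
      exact ⟨SimpleGraph.Walk.nil, rfl⟩
    | succ n ih =>
      intro v hv
      have hr : v ≠ root := by rintro rfl; omega
      obtain ⟨p, hp⟩ := ih (par v) (by have := h v hr; omega)
      have hadj : G.Adj (par v) v := (hG _ _).2 (Or.inl ⟨hr, rfl⟩)
      exact ⟨p.concat hadj, by rw [SimpleGraph.Walk.length_concat, hp]⟩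
  have hconn : G.Connected := by
    have : Nonempty V := ⟨root⟩
    refine SimpleGraph.Connected.mk fun v w => ?_
    obtain ⟨p, -⟩ := hup _ v rfl
    obtain ⟨p', -⟩ := hup _ w rfl
    exact ⟨p.reverse.append p'⟩
  have hdist : ∀ v, G.dist root v = rk v := by
    intro v
    obtain ⟨p, hp⟩ := hup _ v rfl
    obtain ⟨p', hp'⟩ := hconn.exists_walk_length_eq_dist root v
    have h1 := SimpleGraph.dist_le p
    have h2 := hlow _ _ p'
    omega
  have htree : G.IsTree := by
    rw [SimpleGraph.isTree_iff_connected_and_card]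
    refine ⟨hconn, ?_⟩
    -- the edges correspond to the vertices other than the root
    have hr : G.edgeSet = Set.range fun v : {v // v ≠ root} => s(par v, v) := by
      ext e
      induction e with
      | _ v w =>
        rw [SimpleGraph.mem_edgeSet, hG, Set.mem_range]
        constructor
        · rintro (⟨h1, rfl⟩ | ⟨h1, rfl⟩)
          · exact ⟨⟨w, h1⟩, rfl⟩
          · exact ⟨⟨v, h1⟩, Sym2.eq_swap⟩
        · rintro ⟨⟨x, hx⟩, he⟩
          rcases Sym2.eq_iff.1 he with ⟨h1, h2⟩ | ⟨h1, h2⟩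
          · simp only at h1 h2; subst h2; exact Or.inl ⟨hx, h1⟩
          · simp only at h1 h2; subst h2; exact Or.inr ⟨hx, h1⟩
    have hinj : Function.Injective fun v : {v // v ≠ root} => s(par v, (v : V)) := by
      rintro ⟨v, hv⟩ ⟨w, hw⟩ he
      rcases Sym2.eq_iff.1 he with ⟨-, h2⟩ | ⟨h1, h2⟩
      · exact Subtype.ext h2
      · simp only at h1 h2
        have e1 := h v hv
        have e2 := h w hw
        rw [h1] at e1
        rw [← h2] at e2
        omega
    rw [hr, Nat.card_range_of_injective hinj, Nat.card_eq_fintype_card,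
      Nat.card_eq_fintype_card, Fintype.card_subtype_compl, Fintype.card_subtype_eq]
    have : 0 < Fintype.card V := Fintype.card_pos_iff.2 ⟨root⟩
    omega
  refine ⟨⟨G, htree, root⟩, rfl, fun v w => ?_⟩
  rw [mem_children]
  change G.Adj v w ∧ G.dist root w = G.dist root v + 1 ↔ _
  rw [hG, hdist, hdist]
  constructor
  · rintro ⟨h1 | h1, h2⟩
    · exact h1
    · have := h v h1.1
      rw [h1.2] at this
      omega
  · intro h1
    exact ⟨Or.inl h1, by rw [h w h1.1, h1.2]⟩

end RootedCombTree

namespace BranchedCF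

/-- The set `V` of positions in a continued fraction, with the parent `par v`, the depth `rk v` and
the fraction `lab v` at each position `v`. -/
theorem exists_positions (B : BranchedCF) : ∃ (V : Type) (_ : Fintype V) (root : V) (par : V → V)
    (rk : V → ℕ) (lab : V → BranchedCF), rk root = 0 ∧ (∀ v, v ≠ root → rk v = rk (par v) + 1) ∧
      lab root = B ∧ ∀ v m n sub, lab v = node m n sub → ∃ c : Fin n → V, Function.Injective c ∧
        (∀ w, (w ≠ root ∧ par w = v) ↔ ∃ i, c i = w) ∧ ∀ i, lab (c i) = sub i := by
  classical
  induction B with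
  | node m n sub ih =>
    choose V hV root par rk lab h0 h1 h2 h3 using ih
    let par' : Option (Σ i, V i) → Option (Σ i, V i) := fun o => o.elim none fun x =>
      if x.2 = root x.1 then none else some ⟨x.1, par x.1 x.2⟩
    refine ⟨Option (Σ i, V i), inferInstance, none, par',
      fun o => o.elim 0 fun x => rk x.1 x.2 + 1,
      fun o => o.elim (node m n sub) fun x => lab x.1 x.2,
      rfl, ?_, rfl, ?_⟩
    · rintro (_ | ⟨i, v⟩) hv
      · exact absurd rfl hv
      · by_cases hr : v = root i
        · simp [par', hr, h0]
        · simp [par', hr, h1 i v hr]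
    · rintro (_ | ⟨i, v⟩) m' n' sub' hlab
      · simp only [Option.elim, node.injEq] at hlab
        obtain ⟨rfl, rfl, hs⟩ := hlab
        obtain rfl := eq_of_heq hs
        refine ⟨fun i => some ⟨i, root i⟩, fun i j hij => ?_, fun w => ?_, fun i => ?_⟩
        · simpa using congrArg (Option.map Sigma.fst) hij
        · rcases w with _ | ⟨i, v⟩
          · simp
          · simp only [ne_eq, reduceCtorEq, not_false_eq_true, true_and, par', Option.elim]
            constructor
            · intro h
              split_ifs at h with hr
              exact ⟨i, by rw [hr]⟩
            · rintro ⟨j, hj⟩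
              simp only [Option.some.injEq, Sigma.mk.injEq] at hj
              obtain ⟨rfl, hj⟩ := hj
              simp [eq_of_heq hj]
        · exact h2 i
      · obtain ⟨c, c1, c2, c3⟩ := h3 i v m' n' sub' hlab
        refine ⟨fun j => some ⟨i, c j⟩, fun j k hjk => c1 (by simpa using hjk), fun w => ?_, c3⟩
        rcases w with _ | ⟨j, w⟩
        · simp
        · simp only [ne_eq, reduceCtorEq, not_false_eq_true, true_and, par', Option.elim,
            Option.some.injEq, Sigma.mk.injEq]
          constructor
          · intro h
            split_ifs at h with hr
            simp only [Option.some.injEq, Sigma.mk.injEq] at h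
            obtain ⟨rfl, h⟩ := h
            obtain ⟨k, hk⟩ := (c2 w).1 ⟨hr, eq_of_heq h⟩
            exact ⟨k, rfl, heq_of_eq hk⟩
          · rintro ⟨k, rfl, hk⟩
            obtain ⟨hr, hp⟩ := (c2 w).2 ⟨k, eq_of_heq hk⟩
            rw [if_neg hr, hp]

/-- A continued fraction of the special form describes a rooted tree. -/
theorem IsTreeForm.exists_tree {B : BranchedCF} (h : B.IsTreeForm) :
    ∃ (n : ℕ) (T : RootedCombTree (Fin n)), T.ReadOffFrom B := by
  classical
  obtain ⟨V, _, root, par, rk, lab, h0, h1, h2, h3⟩ := B.exists_positions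
  let ε := Fintype.equivFin V
  obtain ⟨T, hr, hc⟩ := RootedCombTree.exists_of_parent (ε root) (fun v => ε (par (ε.symm v)))
    (fun v => rk (ε.symm v)) (by simpa using h0) (fun v hv => by
      simpa using h1 (ε.symm v) (fun e => hv (by rw [← e, Equiv.apply_symm_apply])))
  -- the children of a vertex correspond to the branches
  have hbij : ∀ v m n sub, lab v = node m n sub → ∃ e : Fin n ≃ {w // w ∈ T.children (ε v)},
      ∀ i, lab (ε.symm (e i)) = sub i := by
    intro v m n sub hv
    obtain ⟨c, c1, c2, c3⟩ := h3 v m n sub hv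
    have hmem : ∀ i, ε (c i) ∈ T.children (ε v) := fun i => by
      have := (c2 (c i)).2 ⟨i, rfl⟩
      rw [hc]
      exact ⟨fun e => this.1 (ε.injective e), by rw [Equiv.symm_apply_apply, this.2]⟩
    refine ⟨Equiv.ofBijective (fun i => ⟨ε (c i), hmem i⟩) ⟨fun i j hij => ?_, fun w => ?_⟩,
      fun i => ?_⟩
    · exact c1 (ε.injective (Subtype.ext_iff.1 hij))
    · have := (hc _ _).1 w.2
      obtain ⟨i, hi⟩ := (c2 (ε.symm w)).1
        ⟨fun e => this.1 (by rw [← e, Equiv.apply_symm_apply]), ε.injective this.2⟩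
      exact ⟨i, Subtype.ext (by simp [hi])⟩
    · change lab (ε.symm (ε (c i))) = sub i
      rw [Equiv.symm_apply_apply, c3]
  have key : ∀ (B' : BranchedCF) (v : V), lab v = B' → v ≠ root → B'.IsTreeTail →
      BranchedCF.Describes T B' (ε v) := by
    intro B'
    induction B' with
    | node m n sub ih =>
      intro v hv hvr ht
      rw [IsTreeTail] at ht
      obtain ⟨e, he⟩ := hbij v m n sub hv
      rw [Describes]
      refine ⟨?_, e, fun i => ?_⟩
      · have hvr' : ε v ≠ T.root := by rw [hr]; exact fun e => hvr (ε.injective e)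
        rw [ht.1, T.degree_of_ne_root hvr', Finset.card_of_equiv_fin e]
      · have := ih i (ε.symm (e i)) (he i) (fun e' => ?_) (ht.2 i)
        · rwa [Equiv.apply_symm_apply] at this
        · exact ((hc _ _).1 (e i).2).1 (ε.symm_apply_eq.1 e')
  refine ⟨Fintype.card V, T, ?_⟩
  cases B with
  | node m n sub =>
    rw [IsTreeForm] at h
    obtain ⟨e, he⟩ := hbij root m n sub h2
    rw [RootedCombTree.ReadOffFrom, Describes, hr]
    refine ⟨?_, e, fun i => ?_⟩
    · have := T.degree_root
      rw [hr] at this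
      rw [h.1, this, Finset.card_of_equiv_fin e]
    · have := key (sub i) (ε.symm (e i)) (he i) (fun e' => ?_) (h.2 i)
      · rwa [Equiv.apply_symm_apply] at this
      · exact ((hc _ _).1 (e i).2).1 (ε.symm_apply_eq.1 e')

end BranchedCF

/-! ### Equality up to the order of the branches -/

namespace RootedCombTree

/-- Rooted trees described by fractions that agree up to the order of the branches are isomorphic.
The isomorphism is found from the root to the leaves. -/
theorem sameShape_of_eqUpToOrder {V : Type u} [Fintype V] (T : RootedCombTree V) {W : Type w}
    [Fintype W] (T' : RootedCombTree W) {B B' : BranchedCF} (hB : T.ReadOffFrom B)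
    (hB' : T'.ReadOffFrom B') (h : B.EqUpToOrder B') : T.SameShape T' := by
  classical
  -- the vertices `v` and `v'` carry the same fraction up to the order of the branches
  let R : V → W → Prop := fun v v' => ∃ B B', BranchedCF.Describes T B v ∧
    BranchedCF.Describes T' B' v' ∧ B.EqUpToOrder B'
  have hR : ∀ v v', R v v' → ∃ e : {w // w ∈ T.children v} ≃ {w // w ∈ T'.children v'},
      ∀ w : {w // w ∈ T.children v}, R w.1 (e w).1 := by
    rintro v v' ⟨⟨m, n, sub⟩, ⟨m', n', sub'⟩, h1, h2, h3⟩
    rw [BranchedCF.Describes] at h1 h2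
    rw [BranchedCF.EqUpToOrder] at h3
    obtain ⟨-, e1, he1⟩ := h1
    obtain ⟨-, e2, he2⟩ := h2
    obtain ⟨-, e3, he3⟩ := h3
    refine ⟨e1.symm.trans (e3.trans e2), fun w => ⟨_, _, ?_, he2 (e3 (e1.symm w)),
      he3 (e1.symm w)⟩⟩
    have := he1 (e1.symm w)
    rwa [Equiv.apply_symm_apply] at this
  choose E hE using hR
  obtain ⟨f, f0, hf⟩ := T.exists_root_recursion T'.root
    fun v w x => if hw : R v x ∧ w ∈ T.children v then (E v x hw.1 ⟨w, hw.2⟩ : W) else T'.root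
  have fR : ∀ v, R v (f v) := by
    refine T.root_induction (P := fun v => R v (f v)) ?_ fun v hv w hw => ?_
    · rw [f0]; exact ⟨B, B', hB, hB', h⟩
    · rw [hf v w hw, dif_pos ⟨hv, hw⟩]
      exact hE v (f v) hv ⟨w, hw⟩
  replace hf : ∀ v w (hw : w ∈ T.children v), f w = (E v (f v) (fR v) ⟨w, hw⟩ : W) :=
    fun v w hw => by rw [hf v w hw, dif_pos ⟨fR v, hw⟩]
  have fch : ∀ v w, w ∈ T.children v → f w ∈ T'.children (f v) := by
    intro v w hw
    rw [hf v w hw]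
    exact (E v (f v) (fR v) ⟨w, hw⟩).2
  have fdist : ∀ v, T'.graph.dist T'.root (f v) = T.graph.dist T.root v := by
    refine T.root_induction (P := fun v => T'.graph.dist T'.root (f v) = T.graph.dist T.root v) ?_
      fun v hv w hw => ?_
    · rw [f0]; simp
    · rw [T.dist_of_mem_children hw, T'.dist_of_mem_children (fch v w hw), hv]
  have finj : ∀ v w, f v = f w → v = w := by
    refine T.root_induction (P := fun v => ∀ w, f v = f w → v = w) ?_ fun u hu v hv w hvw => ?_
    · intro w hw
      have := fdist w
      rw [← hw, f0] at this
      simp only [SimpleGraph.dist_self] at this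
      exact T.isTree.connected.dist_eq_zero_iff.1 this.symm
    · have hw : w ≠ T.root := by
        rintro rfl
        have h1 := fdist v
        rw [hvw, fdist, T.dist_of_mem_children hv] at h1
        simp at h1
      obtain ⟨u', hu'⟩ := T.exists_mem_children hw
      have hp : f u = f u' := T'.eq_of_mem_children (fch u v hv) (hvw ▸ fch u' w hu')
      obtain rfl := hu u' hp
      rw [hf u v hv, hf u w hu'] at hvw
      simpa using (E u (f u) (fR u)).injective (Subtype.ext hvw)
  have fsurj : ∀ v', ∃ v, f v = v' := by
    refine T'.root_induction (P := fun v' => ∃ v, f v = v') ⟨T.root, f0⟩ ?_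
    rintro _ ⟨v, rfl⟩ w' hw'
    refine ⟨((E v (f v) (fR v)).symm ⟨w', hw'⟩ : V), ?_⟩
    rw [hf v _ ((E v (f v) (fR v)).symm ⟨w', hw'⟩).2]
    simp
  have fiff : ∀ v w, f w ∈ T'.children (f v) ↔ w ∈ T.children v := by
    refine fun v w => ⟨fun hw => ?_, fch v w⟩
    have hwr : w ≠ T.root := by
      rintro rfl
      have := T'.dist_of_mem_children hw
      rw [fdist] at this
      simp at this
    obtain ⟨u, hu⟩ := T.exists_mem_children hwr
    rwa [finj v u (T'.eq_of_mem_children hw (fch u w hu))]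
  refine ⟨⟨Equiv.ofBijective f ⟨fun v w => finj v w, fsurj⟩, fun {v w} => ?_⟩, f0⟩
  change T'.graph.Adj (f v) (f w) ↔ T.graph.Adj v w
  rw [T'.adj_iff, T.adj_iff, fiff, fiff]

end RootedCombTree

/-! ### Solutions on the tree -/

open scoped Classical in
theorem combine_of_fst_eq_zero {ι R : Type*} [CommRing R] {s : Finset ι} {p : ι → R × R} {i : ι}
    (hi : i ∈ s) (h : (p i).1 = 0) : (combine s p).1 = 0 ∧ ∃ t : R,
      (combine s p).2 = (p i).2 * t ∧ ∀ j ∈ s, j ≠ i → ∃ t', t = (p j).1 * t' := by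
  refine ⟨Finset.prod_eq_zero hi h, ∏ j ∈ s.erase i, (p j).1, ?_, fun j hj hji =>
    ⟨_, (Finset.mul_prod_erase _ _ (Finset.mem_erase.2 ⟨hji, hj⟩)).symm⟩⟩
  simp only [combine]
  refine Finset.sum_eq_single_of_mem i hi ?_
  · intro j _ hji
    rw [Finset.prod_eq_zero (Finset.mem_erase.2 ⟨hji.symm, hi⟩) h, mul_zero]

namespace QuantumTree

section edges

variable {V : Type u} {T : QuantumTree V} {lam : ℂ} {w : V}

theorem wronskian (hw : w ≠ T.root) :
    (initialValueSolution (T.q w) T.l lam (1, 0) T.l).1 *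
        (initialValueSolution (T.q w) T.l lam (0, 1) T.l).2
      - (initialValueSolution (T.q w) T.l lam (1, 0) T.l).2 *
        (initialValueSolution (T.q w) T.l lam (0, 1) T.l).1 = 1 :=
  initialValueSolution_wronskian T.l_pos.le (T.q_memLp w hw) lam

/-- `branchPair` inverts the passage from the beginning to the end of the edge. -/
theorem branchPair_transfer (hw : w ≠ T.root) (P : ℂ × ℂ) :
    (T.branchPair lam w P).1 • initialValueSolution (T.q w) T.l lam (1, 0) T.l
      + (T.branchPair lam w P).2 • initialValueSolution (T.q w) T.l lam (0, 1) T.l = P := by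
  have h := wronskian (lam := lam) hw
  ext1
  · simp only [branchPair, Prod.fst_add, Prod.smul_fst, smul_eq_mul]
    linear_combination P.1 * h
  · simp only [branchPair, Prod.snd_add, Prod.smul_snd, smul_eq_mul]
    linear_combination P.2 * h

/-- The Wronskian of a solution and the solution given by `branchPair` is the same at both ends of
the edge. -/
theorem cross_branchPair (hw : w ≠ T.root) {Y : ℝ → ℂ × ℂ}
    (hY : IsEdgeSolution (T.q w) T.l lam Y) (P : ℂ × ℂ) :
    (Y 0).1 * (T.branchPair lam w P).2 - (Y 0).2 * (T.branchPair lam w P).1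
      = (Y T.l).1 * P.2 - (Y T.l).2 * P.1 := by
  rw [hY.eq_combination T.l_pos.le (T.q_memLp w hw) ⟨T.l_pos.le, le_rfl⟩]
  simp only [branchPair, Prod.fst_add, Prod.smul_fst, smul_eq_mul, Prod.snd_add, Prod.smul_snd]
  ring

theorem branchPair_eq_zero_iff (hw : w ≠ T.root) {P : ℂ × ℂ} :
    T.branchPair lam w P = 0 ↔ P = 0 := by
  constructor
  · intro h
    have := branchPair_transfer (lam := lam) hw P
    rw [h] at this
    simpa using this.symm
  · rintro rfl
    simp [branchPair]

end edges

open scoped Classical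

variable {V : Type u} [Fintype V] (T : QuantumTree V) (lam : ℂ)

/-- The characteristic functions of the part of the tree above a vertex, with the depth of the
recursion fixed. -/
noncomputable def vertexPair (v : V) : ℂ × ℂ :=
  T.charPair lam (Fintype.card V - T.graph.dist T.root v) v

theorem vertexPair_eq (v : V) : T.vertexPair lam v =
    combine (T.children v) fun w => T.branchPair lam w (T.vertexPair lam w) := by
  have h1 : Fintype.card V - T.graph.dist T.root v
      = (Fintype.card V - T.graph.dist T.root v - 1) + 1 := by
    have := T.dist_lt_card v
    omega
  have h2 : ∀ w ∈ T.children v, T.vertexPair lam w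
      = T.charPair lam (Fintype.card V - T.graph.dist T.root v - 1) w := fun w hw => by
    rw [vertexPair, T.dist_of_mem_children hw, Nat.sub_add_eq]
  rw [combine_congr fun w hw => by rw [h2 w hw], vertexPair, h1, charPair]
  rfl

theorem phiD_eq : T.phiD lam = (T.vertexPair lam T.root).1 := by
  simp [phiD, vertexPair]

theorem phiN_eq : T.phiN lam = -(T.vertexPair lam T.root).2 := by
  simp [phiN, vertexPair]

/-- A solution on the tree, from rescalings `k w` of the branches that match at all vertices. -/
theorem isSolution_of_scaling {k : V → ℂ}
    (h1 : ∀ v, ∀ w ∈ T.children v,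
      k w * (T.branchPair lam w (T.vertexPair lam w)).1 = k v * (T.vertexPair lam v).1)
    (h2 : ∀ v, ∑ w ∈ T.children v, k w * (T.branchPair lam w (T.vertexPair lam w)).2
      = k v * (T.vertexPair lam v).2)
    {Y₀ : ℝ → ℂ × ℂ} (hY₀ : ∀ L, 0 < L → IsEdgeSolution (fun _ => 0) L lam Y₀)
    (h0 : Y₀ 0 = (k T.root * T.phiD lam, k T.root * T.phiN lam)) :
    ∃ Y, T.IsSolution lam Y Y₀ ∧ ∀ w, w ≠ T.root →
      Y w 0 = k w • T.branchPair lam w (T.vertexPair lam w) := by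
  let b : V → ℂ × ℂ := fun w => T.branchPair lam w (T.vertexPair lam w)
  let Y : V → ℝ → ℂ × ℂ := fun w x =>
    (k w * (b w).1) • initialValueSolution (T.q w) T.l lam (1, 0) x
      + (k w * (b w).2) • initialValueSolution (T.q w) T.l lam (0, 1) x
  have hc := fun w (hw : w ≠ T.root) =>
    initialValueSolution_spec T.l_pos.le (T.q_memLp w hw) lam (1, 0)
  have hs := fun w (hw : w ≠ T.root) =>
    initialValueSolution_spec T.l_pos.le (T.q_memLp w hw) lam (0, 1)
  have hstart : ∀ w, w ≠ T.root → Y w 0 = k w • b w := fun w hw => by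
    ext1 <;> simp [Y, (hc w hw).2, (hs w hw).2]
  have hend : ∀ w, w ≠ T.root → Y w T.l = k w • T.vertexPair lam w := fun w hw => by
    rw [← branchPair_transfer (lam := lam) hw (T.vertexPair lam w), smul_add, smul_smul, smul_smul]
  have hch : ∀ v w, w ∈ T.children v → w ≠ T.root := fun v w hw => T.ne_root_of_mem_children hw
  refine ⟨Y, ⟨fun w hw => (hc w hw).1.smul_add_smul T.l_pos.le (T.q_memLp w hw) (hs w hw).1 _ _,
    hY₀, fun v hv w hw => ?_, fun v hv => ?_, fun w hw => ?_, ?_⟩, hstart⟩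
  · rw [hstart w (hch v w hw), hend v hv]
    exact h1 v w hw
  · rw [hend v hv, Finset.sum_congr rfl fun w hw => by rw [hstart w (hch v w hw)]]
    exact (h2 v).symm
  · rw [hstart w (hch _ w hw), h0, phiD_eq]
    exact h1 _ w hw
  · rw [Finset.sum_congr rfl fun w hw => by rw [hstart w (hch _ w hw)], h0, phiN_eq]
    have := h2 T.root
    simp only [Prod.smul_snd, smul_eq_mul, b]
    rw [this]
    ring

/-- The solution that has the value `φ_D` and the derivative `φ_N` at the beginning of the lead. -/
theorem exists_isSolution {Y₀ : ℝ → ℂ × ℂ}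
    (hY₀ : ∀ L, 0 < L → IsEdgeSolution (fun _ => 0) L lam Y₀)
    (h0 : Y₀ 0 = (T.phiD lam, T.phiN lam)) : ∃ Y, T.IsSolution lam Y Y₀ := by
  obtain ⟨k, k0, hk⟩ := T.exists_root_recursion (1 : ℂ) fun v w x =>
    x * ∏ w' ∈ (T.children v).erase w, (T.branchPair lam w' (T.vertexPair lam w')).1
  suffices _ ∧ _ by
    obtain ⟨Y, hY, -⟩ := T.isSolution_of_scaling lam (k := k) this.1 this.2 hY₀
      (by rw [h0, k0, one_mul, one_mul])
    exact ⟨Y, hY⟩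
  refine ⟨fun v w hw => ?_, fun v => ?_⟩
  · rw [hk v w hw, T.vertexPair_eq lam v, combine, mul_assoc, mul_comm (∏ _ ∈ _, _),
      Finset.mul_prod_erase _ (fun w => (T.branchPair lam w (T.vertexPair lam w)).1) hw]
  · rw [T.vertexPair_eq lam v, combine, Finset.mul_sum]
    exact Finset.sum_congr rfl fun w hw => by rw [hk v w hw]; ring

variable {T lam} in
/-- The data of a solution at a vertex: the value, and the sum of the outgoing derivatives. -/
theorem IsSolution.exists_vertexData {Y : V → ℝ → ℂ × ℂ} {Y₀ : ℝ → ℂ × ℂ}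
    (h : T.IsSolution lam Y Y₀) : ∃ e : V → ℂ × ℂ, (∀ v, v ≠ T.root → e v = Y v T.l) ∧
      e T.root = ((Y₀ 0).1, -(Y₀ 0).2) ∧
      (∀ v, ∀ w ∈ T.children v, (Y w 0).1 = (e v).1) ∧
      ∀ v, ∑ w ∈ T.children v, (Y w 0).2 = (e v).2 := by
  refine ⟨fun v => if v = T.root then ((Y₀ 0).1, -(Y₀ 0).2) else Y v T.l,
    fun v hv => if_neg hv, if_pos rfl, fun v w hw => ?_, fun v => ?_⟩
  · by_cases hv : v = T.root
    · subst hv; simpa using h.root_continuity w hw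
    · simpa [hv] using h.continuity v hv w hw
  · by_cases hv : v = T.root
    · subst hv
      simp only [if_true]
      linear_combination h.root_kirchhoff
    · simpa [hv] using (h.kirchhoff v hv).symm

variable {T lam} in
/-- The pair of data `(value, sum of the outgoing derivatives)` of a solution is proportional to the
pair of characteristic functions at every vertex. -/
theorem cross_vertexPair {Y : V → ℝ → ℂ × ℂ} {e : V → ℂ × ℂ}
    (hY : ∀ v, v ≠ T.root → IsEdgeSolution (T.q v) T.l lam (Y v))
    (he : ∀ v, v ≠ T.root → e v = Y v T.l)
    (e1 : ∀ v, ∀ w ∈ T.children v, (Y w 0).1 = (e v).1)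
    (e2 : ∀ v, ∑ w ∈ T.children v, (Y w 0).2 = (e v).2) (v : V) :
    (e v).1 * (T.vertexPair lam v).2 = (e v).2 * (T.vertexPair lam v).1 := by
  refine T.leaf_induction (P := fun v =>
    (e v).1 * (T.vertexPair lam v).2 = (e v).2 * (T.vertexPair lam v).1) (fun v ih => ?_) v
  rw [T.vertexPair_eq lam v, ← e2, combine, Finset.mul_sum, Finset.sum_mul]
  refine Finset.sum_congr rfl fun w hw => ?_
  have hwr := T.ne_root_of_mem_children hw
  have hc := cross_branchPair hwr (hY w hwr) (T.vertexPair lam w)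
  have hi := ih w hw
  rw [he w hwr] at hi
  rw [← Finset.mul_prod_erase _ _ hw, ← e1 v w hw]
  linear_combination
    (∏ w' ∈ (T.children v).erase w, (T.branchPair lam w' (T.vertexPair lam w')).1) * (hc + hi)

variable {T lam} in
/-- The restriction of a solution to the lead is proportional to `(φ_D, φ_N)`. -/
theorem IsSolution.cross_phi {Y : V → ℝ → ℂ × ℂ} {Y₀ : ℝ → ℂ × ℂ} (h : T.IsSolution lam Y Y₀) :
    (Y₀ 0).1 * T.phiN lam = (Y₀ 0).2 * T.phiD lam := by
  obtain ⟨e, he, e0, e1, e2⟩ := h.exists_vertexData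
  have := cross_vertexPair h.edge he e1 e2 T.root
  rw [e0] at this
  rw [phiN_eq, phiD_eq]
  linear_combination -this

variable {T lam} in
/-- If `φ_D` and `φ_N` are not both zero, a solution that vanishes on the lead vanishes on the
tree: at every vertex at most one of the branches has a Dirichlet eigenvalue at `lam`, and it is
controlled by the Kirchhoff condition. -/
theorem IsSolution.eq_zero {Y : V → ℝ → ℂ × ℂ} {Y₀ : ℝ → ℂ × ℂ} (h : T.IsSolution lam Y Y₀)
    (h0 : Y₀ 0 = 0) (hne : T.vertexPair lam T.root ≠ 0) :
    ∀ v, v ≠ T.root → ∀ x ∈ Set.Icc 0 T.l, Y v x = 0 := by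
  obtain ⟨e, he, e0, e1, e2⟩ := h.exists_vertexData
  have hcross := cross_vertexPair h.edge he e1 e2
  have hzero : ∀ v, v ≠ T.root → Y v 0 = 0 → ∀ x ∈ Set.Icc 0 T.l, Y v x = 0 := by
    intro v hv hv0 x hx
    rw [(h.edge v hv).eq_combination T.l_pos.le (T.q_memLp v hv) hx, hv0]
    simp
  have key : ∀ v, e v = 0 ∧ T.vertexPair lam v ≠ 0 ∧ (v ≠ T.root → Y v 0 = 0) := by
    refine T.root_induction (P := fun v =>
      e v = 0 ∧ T.vertexPair lam v ≠ 0 ∧ (v ≠ T.root → Y v 0 = 0)) ?_ ?_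
    · refine ⟨by rw [e0, h0]; simp, hne, fun hr => absurd rfl hr⟩
    · rintro v ⟨hev, hv, -⟩ w hw
      have hb : ∀ w ∈ T.children v, T.branchPair lam w (T.vertexPair lam w) ≠ 0 := by
        intro w hw hb
        obtain ⟨c1, t, c2, -⟩ := combine_of_fst_eq_zero
          (p := fun w => T.branchPair lam w (T.vertexPair lam w)) hw (by rw [hb]; rfl)
        rw [hb, Prod.snd_zero, zero_mul] at c2
        exact hv (by rw [T.vertexPair_eq lam v]; exact Prod.ext c1 c2)
      have hfst : ∀ w ∈ T.children v, (Y w 0).1 = 0 := fun w hw => by rw [e1 v w hw, hev]; rfl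
      have hsnd : ∀ w ∈ T.children v, (T.branchPair lam w (T.vertexPair lam w)).1 ≠ 0 →
          (Y w 0).2 = 0 := by
        intro w hw hb1
        have hwr := T.ne_root_of_mem_children hw
        have hc := cross_branchPair hwr (h.edge w hwr) (T.vertexPair lam w)
        have hi := hcross w
        rw [he w hwr] at hi
        rw [hfst w hw] at hc
        have : (Y w 0).2 * (T.branchPair lam w (T.vertexPair lam w)).1 = 0 := by
          linear_combination -hc - hi
        exact (mul_eq_zero.1 this).resolve_right hb1
      -- if the branch `w` has a Dirichlet eigenvalue at `lam`, the other branches have not, and the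
      -- derivatives at `v` along them vanish
      have hY0 : Y w 0 = 0 := by
        refine Prod.ext (hfst w hw) ?_
        by_cases hb1 : (T.branchPair lam w (T.vertexPair lam w)).1 = 0
        · obtain ⟨c1, t, c2, c3⟩ := combine_of_fst_eq_zero
            (p := fun w => T.branchPair lam w (T.vertexPair lam w)) hw hb1
          have hs : ∑ w' ∈ T.children v, (Y w' 0).2 = 0 := by rw [e2, hev]; rfl
          rwa [Finset.sum_eq_single_of_mem w hw] at hs
          intro w' hw' hne'
          refine hsnd w' hw' fun hz => hv ?_
          obtain ⟨t', ht'⟩ := c3 w' hw' hne'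
          rw [T.vertexPair_eq lam v]
          refine Prod.ext c1 ?_
          rw [c2, ht', hz]
          simp
        · exact hsnd w hw hb1
      have hwr := T.ne_root_of_mem_children hw
      refine ⟨?_, fun hz => hb w hw ((branchPair_eq_zero_iff hwr).2 hz), fun _ => hY0⟩
      rw [he w hwr]
      exact hzero w hwr hY0 _ ⟨T.l_pos.le, le_rfl⟩
  exact fun v hv => hzero v hv ((key v).2.2 hv)

/-- If `φ_D` and `φ_N` both vanish, there is a solution that vanishes on the lead but not on the
tree. It lives on two branches at a vertex whose branches have a common Dirichlet eigenvalue. -/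
theorem exists_isSolution_of_vertexPair_eq_zero (h : T.vertexPair lam T.root = 0) :
    ∃ Y, T.IsSolution lam Y (fun _ => 0) ∧ ∃ w, w ≠ T.root ∧ (Y w 0).1 = 0 ∧ (Y w 0).2 ≠ 0 := by
  -- a vertex with this property, at the largest distance from the root
  obtain ⟨v, hv, hmax⟩ := Finset.exists_max_image
    (Finset.univ.filter fun v => T.vertexPair lam v = 0) (fun v => T.graph.dist T.root v)
    ⟨T.root, by simpa using h⟩
  simp only [Finset.mem_filter, Finset.mem_univ, true_and] at hv hmax
  set b : V → ℂ × ℂ := fun w => T.branchPair lam w (T.vertexPair lam w) with hbdef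
  have hb : ∀ w ∈ T.children v, b w ≠ 0 := fun w hw hz => by
    have h1 := hmax w ((branchPair_eq_zero_iff (T.ne_root_of_mem_children hw)).1 hz)
    have h2 := T.dist_of_mem_children hw
    omega
  have hcomb : combine (T.children v) b = 0 := by rw [hbdef, ← T.vertexPair_eq, hv]
  obtain ⟨w, hw, hw1⟩ := Finset.prod_eq_zero_iff.1 (congrArg Prod.fst hcomb)
  have hw2 : (b w).2 ≠ 0 := fun hz => hb w hw (Prod.ext hw1 hz)
  have hsum := congrArg Prod.snd hcomb
  simp only [combine] at hsum
  rw [Finset.sum_eq_single_of_mem w hw fun j _ hj => by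
    rw [Finset.prod_eq_zero (Finset.mem_erase.2 ⟨Ne.symm hj, hw⟩) hw1, mul_zero]] at hsum
  obtain ⟨w', hw', hw1'⟩ := Finset.prod_eq_zero_iff.1 ((mul_eq_zero.1 hsum).resolve_left hw2)
  have hne : w' ≠ w := (Finset.mem_erase.1 hw').1
  replace hw' := Finset.mem_of_mem_erase hw'
  have hw2' : (b w').2 ≠ 0 := fun hz => hb w' hw' (Prod.ext hw1' hz)
  obtain ⟨k, k0, hk⟩ := T.exists_root_recursion (1 : ℂ) fun u z x =>
    if u = v then (if z = w then (b w').2 else if z = w' then -(b w).2 else 0)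
    else x * ∏ z' ∈ (T.children u).erase z, (b z').1
  have hkv : ∀ z ∈ T.children v, k z = if z = w then (b w').2 else if z = w' then -(b w).2 else 0 :=
    fun z hz => by rw [hk v z hz, if_pos rfl]
  have hkw : k w = (b w').2 := by rw [hkv w hw, if_pos rfl]
  have hkw' : k w' = -(b w).2 := by rw [hkv w' hw', if_neg hne, if_pos rfl]
  have hkz : ∀ z ∈ T.children v, z ≠ w ∧ z ≠ w' → k z = 0 := fun z hz hzz => by
    rw [hkv z hz, if_neg hzz.1, if_neg hzz.2]
  have hwr := T.ne_root_of_mem_children hw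
  suffices _ ∧ _ by
    obtain ⟨Y, hY, hY0⟩ := T.isSolution_of_scaling lam (k := k) this.1 this.2 (Y₀ := fun _ => 0)
      (fun L _ => ⟨continuousOn_const, fun x _ => by simp, fun x _ => by simp⟩)
      (by rw [phiD_eq, phiN_eq, h]; simp [Prod.ext_iff])
    refine ⟨Y, hY, w, hwr, ?_, ?_⟩
    · rw [hY0 w hwr]
      simp only [Prod.smul_fst, smul_eq_mul]
      rw [show (T.branchPair lam w (T.vertexPair lam w)).1 = 0 from hw1, mul_zero]
    · rw [hY0 w hwr, hkw]
      exact mul_ne_zero hw2' hw2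
  refine ⟨fun u z hz => ?_, fun u => ?_⟩
  · by_cases hu : u = v
    · subst hu
      rw [hv, Prod.fst_zero, mul_zero]
      change k z * (b z).1 = 0
      by_cases hzw : z = w
      · rw [hzw, hw1, mul_zero]
      · by_cases hzw' : z = w'
        · rw [hzw', hw1', mul_zero]
        · rw [hkz z hz ⟨hzw, hzw'⟩, zero_mul]
    · rw [hk u z hz, if_neg hu, T.vertexPair_eq lam u, combine, mul_assoc,
        mul_comm (∏ _ ∈ _, _), Finset.mul_prod_erase _ (fun z => (b z).1) hz]
  · by_cases hu : u = v
    · subst hu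
      rw [hv, Prod.snd_zero, mul_zero]
      change ∑ z ∈ T.children u, k z * (b z).2 = 0
      rw [← Finset.add_sum_erase _ _ hw,
        Finset.sum_eq_single_of_mem w' (Finset.mem_erase.2 ⟨hne, hw'⟩), hkw, hkw']
      · ring
      · intro z hz hzw'
        rw [hkz z (Finset.mem_of_mem_erase hz) ⟨(Finset.mem_erase.1 hz).1, hzw'⟩, zero_mul]
    · rw [T.vertexPair_eq lam u, combine, Finset.mul_sum]
      exact Finset.sum_congr rfl fun z hz => by rw [hk u z hz, if_neg hu]; ring

end QuantumTree

/-! ### The zero potential -/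

namespace RootedCombTree

variable {V : Type u} [Fintype V] (T : RootedCombTree V)

/-- The value at the root, for the zero potential, as a function of `θ = τ l`. -/
noncomputable def rootValue (θ : ℂ) : ℂ := aeval (Complex.cos θ) (T.polyPair T.root).1

/-- The sum of the outgoing derivatives at the root divided by `τ`, for the zero potential, as a
function of `θ = τ l`. -/
noncomputable def rootDeriv (θ : ℂ) : ℂ :=
  Complex.sin θ * aeval (Complex.cos θ) (T.polyPair T.root).2

theorem aeval_psiHat (θ : ℂ) :
    aeval (Complex.cos θ) T.psiHat = (-1) ^ (Fintype.card V - 1) * T.rootValue θ := by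
  rw [psiHat_eq, rootValue]
  simp

theorem aeval_psi (θ : ℂ) : aeval (Complex.cos θ) T.psi
    = (-1) ^ (Fintype.card V - 1) * (Complex.sin θ * T.rootDeriv θ) := by
  rw [psi_eq, rootDeriv]
  simp only [map_mul, map_pow, map_neg, map_one, map_sub, aeval_X]
  linear_combination -(-1) ^ (Fintype.card V - 1) * aeval (Complex.cos θ) (T.polyPair T.root).2
    * Complex.sin_sq_add_cos_sq θ

theorem exists_real_rootValue (θ : ℝ) : ∃ r : ℝ, T.rootValue θ = r := by
  refine ⟨aeval (Real.cos θ) (T.polyPair T.root).1, ?_⟩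
  rw [rootValue, ← Complex.ofReal_cos]
  exact aeval_algebraMap_apply ℂ (Real.cos θ) (T.polyPair T.root).1

theorem exists_real_rootDeriv (θ : ℝ) : ∃ r : ℝ, T.rootDeriv θ = r := by
  refine ⟨Real.sin θ * aeval (Real.cos θ) (T.polyPair T.root).2, ?_⟩
  rw [rootDeriv, ← Complex.ofReal_cos, ← Complex.ofReal_sin, Complex.ofReal_mul]
  congr 1
  exact aeval_algebraMap_apply ℂ (Real.cos θ) (T.polyPair T.root).2

theorem one_le_card (T : RootedCombTree V) : 1 ≤ Fintype.card V := Fintype.card_pos_iff.2 ⟨T.root⟩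

end RootedCombTree

namespace QuantumTree

open scoped Classical

variable {V : Type u} (T : QuantumTree V)

theorem branchPair_zeroPotential (τ : ℂ) (w : V) (a b : ℂ) :
    T.zeroPotential.branchPair (τ ^ 2) w (a, τ * b)
      = (a * Complex.cos (τ * T.l) - b * Complex.sin (τ * T.l),
        τ * (a * Complex.sin (τ * T.l) + b * Complex.cos (τ * T.l))) := by
  obtain ⟨h1, h2, h3⟩ := initialValueSolution_zero T.l_pos.le τ
  have e : T.zeroPotential.branchPair (τ ^ 2) w (a, τ * b)
      = (a * (initialValueSolution (fun _ => 0) T.l (τ ^ 2) (0, 1) T.l).2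
          - τ * b * (initialValueSolution (fun _ => 0) T.l (τ ^ 2) (0, 1) T.l).1,
        -a * (initialValueSolution (fun _ => 0) T.l (τ ^ 2) (1, 0) T.l).2
          + τ * b * (initialValueSolution (fun _ => 0) T.l (τ ^ 2) (1, 0) T.l).1) := rfl
  rw [e, h1, h3]
  ext1
  · simp only
    linear_combination -b * h2
  · simp only
    ring

variable [Fintype V]

theorem vertexPair_zeroPotential (τ : ℂ) (v : V) : T.zeroPotential.vertexPair (τ ^ 2) v
    = (aeval (Complex.cos (τ * T.l)) (T.polyPair v).1,
      τ * (Complex.sin (τ * T.l) * aeval (Complex.cos (τ * T.l)) (T.polyPair v).2)) := by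
  refine T.leaf_induction (P := fun v => T.zeroPotential.vertexPair (τ ^ 2) v
    = (aeval (Complex.cos (τ * T.l)) (T.polyPair v).1,
      τ * (Complex.sin (τ * T.l) * aeval (Complex.cos (τ * T.l)) (T.polyPair v).2)))
    (fun v ih => ?_) v
  have hm := map_combine (aeval (R := ℚ) (Complex.cos (τ * T.l))).toRingHom (T.children v)
    fun w => edgeStep X (T.polyPair w)
  rw [← T.polyPair_eq] at hm
  have h1 := congrArg Prod.fst hm
  have h2 := congrArg Prod.snd hm
  simp only [AlgHom.toRingHom_eq_coe, RingHom.coe_coe] at h1 h2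
  rw [vertexPair_eq, h1, h2, ← mul_assoc]
  refine Eq.trans (combine_congr fun w hw => ?_) (combine_smul (T.children v) _ _)
  rw [ih w hw, branchPair_zeroPotential]
  have hcs := Complex.sin_sq_add_cos_sq (τ * T.l)
  ext1
  · simp only [edgeStep, map_sub, map_mul, map_pow, map_one, aeval_X]
    linear_combination -aeval (Complex.cos (τ * T.l)) (T.polyPair w).2 * hcs
  · simp only [edgeStep, map_add, map_mul, aeval_X]
    ring

theorem phiD_zeroPotential (τ : ℂ) :
    T.zeroPotential.phiD (τ ^ 2) = T.rootValue (τ * T.l) := by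
  rw [phiD_eq]
  exact congrArg Prod.fst (T.vertexPair_zeroPotential τ T.root)

theorem phiN_zeroPotential (τ : ℂ) :
    T.zeroPotential.phiN (τ ^ 2) = -(τ * T.rootDeriv (τ * T.l)) := by
  rw [phiN_eq]
  exact congrArg Neg.neg (congrArg Prod.snd (T.vertexPair_zeroPotential τ T.root))

theorem jost_neg (τ : ℂ) :
    T.jost (-τ) = T.phiN (τ ^ 2) - Complex.I * τ * T.phiD (τ ^ 2) := by
  rw [jost, neg_sq]; ring

theorem jost_zeroPotential (τ : ℂ) : T.zeroPotential.jost τ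
    = -τ * (T.rootDeriv (τ * T.l) - Complex.I * T.rootValue (τ * T.l)) := by
  rw [jost, phiD_zeroPotential, phiN_zeroPotential]; ring

theorem jost_neg_zeroPotential (τ : ℂ) : T.zeroPotential.jost (-τ)
    = -τ * (T.rootDeriv (τ * T.l) + Complex.I * T.rootValue (τ * T.l)) := by
  rw [jost_neg, phiD_zeroPotential, phiN_zeroPotential]; ring

theorem zeroPotential_phi_eq_det (τ : ℂ) :
    T.zeroPotential.phiD (τ ^ 2) =
        (-1) ^ (Fintype.card V - 1) * aeval (Complex.cos (τ * T.l)) T.psiHat ∧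
      Complex.sin (τ * T.l) * T.zeroPotential.phiN (τ ^ 2) =
        (-1) ^ Fintype.card V * τ * aeval (Complex.cos (τ * T.l)) T.psi := by
  have h1 : ((-1 : ℂ) ^ (Fintype.card V - 1)) * (-1) ^ (Fintype.card V - 1) = 1 := by
    rw [← mul_pow]; simp
  have h2 : (-1 : ℂ) ^ Fintype.card V = -(-1) ^ (Fintype.card V - 1) := by
    conv_lhs => rw [← Nat.sub_add_cancel T.one_le_card, pow_succ]
    ring
  rw [phiD_zeroPotential, phiN_zeroPotential, T.aeval_psiHat, T.aeval_psi, h2]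
  constructor
  · linear_combination -T.rootValue (τ * T.l) * h1
  · linear_combination τ * Complex.sin (τ * T.l) * T.rootDeriv (τ * T.l) * h1

theorem zeroPotential_phi_periodic (τ : ℂ) :
    T.zeroPotential.phiD ((τ + 2 * Real.pi / T.l) ^ 2) = T.zeroPotential.phiD (τ ^ 2) ∧
      τ * T.zeroPotential.phiN ((τ + 2 * Real.pi / T.l) ^ 2) =
        (τ + 2 * Real.pi / T.l) * T.zeroPotential.phiN (τ ^ 2) := by
  have hl : (T.l : ℂ) ≠ 0 := by exact_mod_cast T.l_pos.ne'
  have e : (τ + 2 * Real.pi / T.l) * T.l = τ * T.l + 2 * Real.pi := by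
    field_simp
  rw [phiD_zeroPotential, phiD_zeroPotential, phiN_zeroPotential, phiN_zeroPotential, e]
  simp only [RootedCombTree.rootValue, RootedCombTree.rootDeriv, Complex.cos_add_two_pi,
    Complex.sin_add_two_pi, true_and]
  ring

theorem ratio_eq_of_mem_Ioo {z : ℝ} (hz : z ∈ Set.Ioo (-1 : ℝ) 1)
    (hne : aeval (z : ℂ) T.psiHat ≠ 0) :
    T.zeroPotential.phiD (((Real.arccos z / T.l : ℝ) : ℂ) ^ 2) ≠ 0 ∧
      aeval (z : ℂ) T.psi / aeval (z : ℂ) T.psiHat =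
        -((T.l / Real.arccos z * √(1 - z ^ 2) : ℝ) : ℂ) *
          (T.zeroPotential.phiN (((Real.arccos z / T.l : ℝ) : ℂ) ^ 2) /
            T.zeroPotential.phiD (((Real.arccos z / T.l : ℝ) : ℂ) ^ 2)) ∧
      T.zeroPotential.jost (-((Real.arccos z / T.l : ℝ) : ℂ)) ≠ 0 ∧
      T.zeroPotential.sFunction ((Real.arccos z / T.l : ℝ) : ℂ) ≠ 1 ∧
      aeval (z : ℂ) T.psi / aeval (z : ℂ) T.psiHat =
        -(Complex.I * (√(1 - z ^ 2) : ℝ)) *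
          ((T.zeroPotential.sFunction ((Real.arccos z / T.l : ℝ) : ℂ) + 1) /
            (T.zeroPotential.sFunction ((Real.arccos z / T.l : ℝ) : ℂ) - 1)) := by
  have hl : T.l ≠ 0 := T.l_pos.ne'
  set α := Real.arccos z with hα
  have hα0 : 0 < α := Real.arccos_pos.2 hz.2
  have hcos : Real.cos α = z := Real.cos_arccos hz.1.le hz.2.le
  have hsin : Real.sin α = √(1 - z ^ 2) := Real.sin_arccos z
  have hθ : ((α / T.l : ℝ) : ℂ) * T.l = (α : ℝ) := by
    rw [← Complex.ofReal_mul, div_mul_cancel₀ _ hl]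
  have hτ0 : ((α / T.l : ℝ) : ℂ) ≠ 0 := by
    exact_mod_cast (div_pos hα0 T.l_pos).ne'
  have hccos : Complex.cos (α : ℝ) = (z : ℂ) := by rw [← Complex.ofReal_cos, hcos]
  have hcsin : Complex.sin (α : ℝ) = ((√(1 - z ^ 2) : ℝ) : ℂ) := by
    rw [← Complex.ofReal_sin, hsin]
  set τ : ℂ := ((α / T.l : ℝ) : ℂ) with hτ
  obtain ⟨d, hd⟩ := T.exists_real_rootValue α
  obtain ⟨n, hn⟩ := T.exists_real_rootDeriv α
  have hψ := T.aeval_psi (α : ℝ)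
  have hψh := T.aeval_psiHat (α : ℝ)
  rw [hccos, hn, hcsin] at hψ
  rw [hccos, hd] at hψh
  have hd0 : (d : ℂ) ≠ 0 := fun h => hne (by rw [hψh, h, mul_zero])
  have hd0' : d ≠ 0 := by exact_mod_cast hd0
  have hs : ((-1 : ℂ) ^ (Fintype.card V - 1)) ≠ 0 := pow_ne_zero _ (by norm_num)
  have hJ : T.zeroPotential.jost (-τ) = -τ * (n + Complex.I * d) := by
    rw [jost_neg_zeroPotential, hθ, hd, hn]
  have hJ' : T.zeroPotential.jost τ = -τ * (n - Complex.I * d) := by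
    rw [jost_zeroPotential, hθ, hd, hn]
  have hnd : (n : ℂ) + Complex.I * d ≠ 0 := fun h => hd0' (by
    simpa using congrArg Complex.im h)
  have hS : T.zeroPotential.sFunction τ = (n - Complex.I * d) / (n + Complex.I * d) := by
    rw [sFunction, hJ, hJ', mul_div_mul_left _ _ (neg_ne_zero.2 hτ0)]
  have hS1 : T.zeroPotential.sFunction τ - 1 = -2 * Complex.I * d / (n + Complex.I * d) := by
    rw [hS]; field_simp; ring
  have hS2 : T.zeroPotential.sFunction τ + 1 = 2 * n / (n + Complex.I * d) := by
    rw [hS]; field_simp; ring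
  have hS10 : T.zeroPotential.sFunction τ - 1 ≠ 0 := by
    rw [hS1]
    exact div_ne_zero (mul_ne_zero (mul_ne_zero (by norm_num) Complex.I_ne_zero) hd0) hnd
  rw [hψ, hψh, phiD_zeroPotential, phiN_zeroPotential, hθ, hd, hn, hJ, hS1, hS2]
  have hαl : τ = (α : ℂ) / (T.l : ℂ) := by rw [hτ]; push_cast; ring
  have hαc : (α : ℂ) ≠ 0 := by exact_mod_cast hα0.ne'
  have hlc : (T.l : ℂ) ≠ 0 := by exact_mod_cast hl
  refine ⟨hd0, ?_, mul_ne_zero (neg_ne_zero.2 hτ0) hnd, sub_ne_zero.1 hS10, ?_⟩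
  · rw [hαl]
    push_cast
    field_simp
  · rw [div_div_div_cancel_right₀ hnd]
    have hI := Complex.I_ne_zero
    field_simp

/-! ### The lead -/

variable {T} in
theorem lead_eq {τ : ℂ} (hτ : τ ≠ 0) {Y₀ : ℝ → ℂ × ℂ}
    (h : ∀ L, 0 < L → IsEdgeSolution (fun _ => 0) L (τ ^ 2) Y₀) {x : ℝ} (hx : 0 ≤ x) :
    Y₀ x = ((Y₀ 0).1 * Complex.cos (τ * x) + (Y₀ 0).2 / τ * Complex.sin (τ * x),
      -τ * (Y₀ 0).1 * Complex.sin (τ * x) + τ * ((Y₀ 0).2 / τ) * Complex.cos (τ * x)) := by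
  have hL : 0 < x + 1 := by linarith
  refine (h (x + 1) hL).eqOn hL.le MemLp.zero'
    (isEdgeSolution_zero τ (Y₀ 0).1 ((Y₀ 0).2 / τ)) ?_ ⟨hx, by linarith⟩
  ext1
  · simp
  · simp only [Complex.ofReal_zero, mul_zero, Complex.sin_zero, Complex.cos_zero, mul_one, zero_add]
    field_simp

theorem jost_exp_eq (τ : ℂ) (x : ℝ) :
    Complex.exp (Complex.I * τ * x) * T.jost τ - Complex.exp (-(Complex.I * τ * x)) * T.jost (-τ)
      = 2 * Complex.I * (T.phiN (τ ^ 2) * Complex.sin (τ * x)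
        + τ * T.phiD (τ ^ 2) * Complex.cos (τ * x)) := by
  have e1 : Complex.I * τ * x = (τ * x) * Complex.I := by ring
  have e2 : -((τ * x) * Complex.I) = (-(τ * x)) * Complex.I := by ring
  rw [e1, e2, Complex.exp_mul_I, Complex.exp_mul_I, Complex.cos_neg, Complex.sin_neg, jost_neg,
    jost]
  ring

theorem exists_scattering_solution {τ : ℂ} (hτ : τ ≠ 0) :
    ∃ Y Y₀, T.IsSolution (τ ^ 2) Y Y₀ ∧ ∀ x : ℝ, 0 ≤ x →
      (Y₀ x).1 = 1 / (2 * Complex.I * τ) *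
        (Complex.exp (Complex.I * τ * x) * T.jost τ
          - Complex.exp (-(Complex.I * τ * x)) * T.jost (-τ)) := by
  obtain ⟨Y, hY⟩ := T.exists_isSolution (τ ^ 2)
    (fun L _ => isEdgeSolution_zero (L := L) τ (T.phiD (τ ^ 2)) (T.phiN (τ ^ 2) / τ)) (by
      ext1
      · simp
      · simp only [Complex.ofReal_zero, mul_zero, Complex.sin_zero, Complex.cos_zero, mul_one,
          zero_add]
        field_simp)
  refine ⟨Y, _, hY, fun x _ => ?_⟩
  rw [jost_exp_eq]
  have := Complex.I_ne_zero
  field_simp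
  ring

theorem solution_on_lead {τ : ℂ} (hτ : τ ≠ 0) (hne : T.jost τ ≠ 0 ∨ T.jost (-τ) ≠ 0)
    {Y : V → ℝ → ℂ × ℂ} {Y₀ : ℝ → ℂ × ℂ} (hY : T.IsSolution (τ ^ 2) Y Y₀) :
    ∃ a : ℂ, ∀ x : ℝ, 0 ≤ x → (Y₀ x).1 = a *
      (Complex.exp (Complex.I * τ * x) * T.jost τ
        - Complex.exp (-(Complex.I * τ * x)) * T.jost (-τ)) := by
  have hc := hY.cross_phi
  obtain ⟨a, h1, h2⟩ : ∃ a, (Y₀ 0).1 = a * T.phiD (τ ^ 2) ∧ (Y₀ 0).2 = a * T.phiN (τ ^ 2) := by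
    by_cases hD : T.phiD (τ ^ 2) = 0
    · have hN : T.phiN (τ ^ 2) ≠ 0 := fun hN => by
        rw [jost_neg, jost, hD, hN] at hne
        simp at hne
      refine ⟨(Y₀ 0).2 / T.phiN (τ ^ 2), ?_, by field_simp⟩
      rw [hD, mul_zero] at hc ⊢
      exact (mul_eq_zero.1 hc).resolve_right hN
    · refine ⟨(Y₀ 0).1 / T.phiD (τ ^ 2), by field_simp, ?_⟩
      field_simp
      linear_combination -hc
  refine ⟨a / (2 * Complex.I * τ), fun x hx => ?_⟩
  rw [lead_eq hτ hY.lead hx, h1, h2, jost_exp_eq]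
  have := Complex.I_ne_zero
  field_simp
  ring

/-- A nonzero solution on the lead is not square integrable: with `f (x) = a cos τx + b sin τx`, the
sum `|f (x)|² + |f (x + π / (2 τ))|²` is constant. -/
theorem lead_eq_zero_of_memLp {τ : ℝ} (hτ : 0 < τ) {f : ℝ → ℂ} {a b : ℂ}
    (hf : ∀ x : ℝ, 0 ≤ x → f x = a * Complex.cos (τ * x) + b * Complex.sin (τ * x))
    (hm : MemLp f 2 (volume.restrict (Set.Ici (0 : ℝ)))) : a = 0 ∧ b = 0 := by
  have i1 : IntegrableOn (fun x => ‖f x‖ ^ 2) (Set.Ici (0 : ℝ)) := hm.norm.integrable_sq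
  set s := Real.pi / (2 * τ) with hs
  have hs0 : 0 < s := by positivity
  have i2 : IntegrableOn (fun x => ‖f (x + s)‖ ^ 2) (Set.Ici (0 : ℝ)) := by
    have := (measurePreserving_add_right (volume : Measure ℝ) s).integrableOn_comp_preimage
      (measurableEmbedding_addRight s) (f := fun x => ‖f x‖ ^ 2) (s := Set.Ici s)
    have hpre : (fun x => x + s) ⁻¹' Set.Ici s = Set.Ici (0 : ℝ) := by
      ext x; simp
    rw [hpre] at this
    exact this.2 (i1.mono_set (Set.Ici_subset_Ici.2 hs0.le))
  have i3 : IntegrableOn (fun _ : ℝ => ‖a‖ ^ 2 + ‖b‖ ^ 2) (Set.Ici (0 : ℝ)) := by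
    refine (i1.add i2).congr_fun (fun x hx => ?_) measurableSet_Ici
    have hx0 : 0 ≤ x := hx
    have hτs : τ * (x + s) = τ * x + Real.pi / 2 := by rw [hs]; field_simp
    simp only [Pi.add_apply]
    rw [hf x hx0, hf (x + s) (by linarith), ← Complex.ofReal_mul, ← Complex.ofReal_mul, hτs,
      ← Complex.ofReal_cos, ← Complex.ofReal_cos, ← Complex.ofReal_sin, ← Complex.ofReal_sin,
      Real.cos_add_pi_div_two, Real.sin_add_pi_div_two]
    have hcs := Real.sin_sq_add_cos_sq (τ * x)
    simp only [Complex.sq_norm, Complex.normSq_apply, Complex.add_re, Complex.add_im,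
      Complex.mul_re, Complex.mul_im, Complex.ofReal_re, Complex.ofReal_im]
    linear_combination (a.re ^ 2 + a.im ^ 2 + b.re ^ 2 + b.im ^ 2) * hcs
  rw [integrableOn_const_iff] at i3
  have h0 : ‖a‖ ^ 2 + ‖b‖ ^ 2 = 0 := by simpa using i3
  constructor
  · have : ‖a‖ ^ 2 = 0 := by nlinarith [sq_nonneg ‖a‖, sq_nonneg ‖b‖]
    simpa using this
  · have : ‖b‖ ^ 2 = 0 := by nlinarith [sq_nonneg ‖a‖, sq_nonneg ‖b‖]
    simpa using this

/-- A square integrable solution vanishes on the lead, and nonzero solutions of this kind exist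
exactly if both characteristic functions vanish. -/
theorem isEigenvalue_zeroPotential_iff {τ : ℝ} (hτ : 0 < τ) :
    T.zeroPotential.IsEigenvalue ((τ : ℂ) ^ 2) ↔
      T.zeroPotential.vertexPair ((τ : ℂ) ^ 2) T.root = 0 := by
  have hτ' : (τ : ℂ) ≠ 0 := by exact_mod_cast hτ.ne'
  constructor
  · rintro ⟨Y, Y₀, hY, hm, hne⟩
    by_contra hv
    have h00 := lead_eq_zero_of_memLp hτ (fun x hx => congrArg Prod.fst (lead_eq hτ' hY.lead hx)) hm
    have h0 : Y₀ 0 = 0 := Prod.ext h00.1 (by simpa [hτ'] using h00.2)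
    rcases hne with ⟨v, hvr, x, hx, hx0⟩ | ⟨x, hx, hx0⟩
    · exact hx0 (by rw [hY.eq_zero h0 hv v hvr x hx]; rfl)
    · exact hx0 (by rw [lead_eq hτ' hY.lead hx, h0]; simp)
  · intro hv
    obtain ⟨Y, hY, w, hw, h1, h2⟩ := T.zeroPotential.exists_isSolution_of_vertexPair_eq_zero _ hv
    refine ⟨Y, _, hY, MemLp.zero', Or.inl ⟨w, hw, ?_⟩⟩
    -- the solution on the edge `w` is a nonzero multiple of `sin τx`
    refine ⟨min T.l τ⁻¹, ⟨le_min T.l_pos.le (inv_pos.2 hτ).le, min_le_left _ _⟩, ?_⟩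
    have hx0 : 0 < min T.l τ⁻¹ := lt_min T.l_pos (inv_pos.2 hτ)
    have hx1 : τ * min T.l τ⁻¹ ≤ 1 := by
      calc τ * min T.l τ⁻¹ ≤ τ * τ⁻¹ := by gcongr; exact min_le_right _ _
        _ = 1 := mul_inv_cancel₀ hτ.ne'
    rw [(hY.edge w hw).eqOn T.l_pos.le MemLp.zero'
      (isEdgeSolution_zero (τ : ℂ) 0 ((Y w 0).2 / τ)) (by
        ext1
        · simp [h1]
        · simp only [Complex.ofReal_zero, mul_zero, Complex.sin_zero, Complex.cos_zero, mul_one,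
            zero_add]
          field_simp) ⟨hx0.le, min_le_left _ _⟩]
    simp only [zero_mul, zero_add]
    refine mul_ne_zero (div_ne_zero h2 hτ') ?_
    rw [← Complex.ofReal_mul, ← Complex.ofReal_sin]
    have : 0 < Real.sin (τ * min T.l τ⁻¹) :=
      Real.sin_pos_of_pos_of_lt_pi (mul_pos hτ hx0) (by linarith [Real.pi_gt_three])
    exact_mod_cast this.ne'

theorem isEigenvalue_zeroPotential_iff_det {τ : ℝ} (hτ : 0 < τ) :
    T.zeroPotential.IsEigenvalue ((τ : ℂ) ^ 2) ↔
      aeval (Real.cos (τ * T.l)) T.psi = 0 ∧ aeval (Real.cos (τ * T.l)) T.psiHat = 0 := by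
  have hτ' : (τ : ℂ) ≠ 0 := by exact_mod_cast hτ.ne'
  have hcast : ∀ p : ℚ[X], aeval (Real.cos (τ * T.l)) p = 0 ↔
      aeval (Complex.cos (τ * T.l)) p = 0 := fun p => by
    have := aeval_algebraMap_apply ℂ (Real.cos (τ * T.l)) p
    rw [Complex.coe_algebraMap, Complex.ofReal_cos, Complex.ofReal_mul] at this
    rw [this, Complex.ofReal_eq_zero]
  have hs : ((-1 : ℂ) ^ (Fintype.card V - 1)) ≠ 0 := pow_ne_zero _ (by norm_num)
  rw [T.isEigenvalue_zeroPotential_iff hτ, vertexPair_zeroPotential, hcast, hcast,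
    T.aeval_psi, T.aeval_psiHat, Prod.mk_eq_zero, mul_eq_zero_iff_left hs, mul_eq_zero_iff_left hs,
    mul_eq_zero_iff_left hτ', and_comm]
  refine and_congr ?_ Iff.rfl
  -- `sin θ Q = 0` is equivalent to `sin² θ Q = 0`
  change T.rootDeriv _ = 0 ↔ _
  rw [mul_eq_zero]
  refine ⟨Or.inr, fun h => h.elim (fun h => ?_) id⟩
  rw [RootedCombTree.rootDeriv, h, zero_mul]

end QuantumTree

/-! ### Asymptotics for large real `τ` -/

section BoundedApprox

variable {α : Type*} {F : Filter α} {f f₁ f₂ g g₁ g₂ : α → ℂ}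

/-- `f` is bounded and differs from `g` by `o(1)`. -/
def BoundedApprox (F : Filter α) (f g : α → ℂ) : Prop :=
  (f =O[F] fun _ => (1 : ℝ)) ∧ Tendsto (fun x => f x - g x) F (𝓝 0)

namespace BoundedApprox

theorem refl (h : f =O[F] fun _ => (1 : ℝ)) : BoundedApprox F f f :=
  ⟨h, by simpa using tendsto_const_nhds⟩

theorem isBigO_right (h : BoundedApprox F f g) : g =O[F] fun _ => (1 : ℝ) := by
  have := h.1.sub (h.2.isBigO_one ℝ)
  simpa using this

theorem symm (h : BoundedApprox F f g) : BoundedApprox F g f :=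
  ⟨h.isBigO_right, by simpa using h.2.neg⟩

theorem trans (h₁ : BoundedApprox F f f₁) (h₂ : BoundedApprox F f₁ g) : BoundedApprox F f g :=
  ⟨h₁.1, by simpa using h₁.2.add h₂.2⟩

theorem add (h₁ : BoundedApprox F f₁ g₁) (h₂ : BoundedApprox F f₂ g₂) :
    BoundedApprox F (fun x => f₁ x + f₂ x) fun x => g₁ x + g₂ x :=
  ⟨h₁.1.add h₂.1, by simpa [add_sub_add_comm] using h₁.2.add h₂.2⟩

theorem neg (h : BoundedApprox F f g) : BoundedApprox F (fun x => -f x) fun x => -g x :=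
  ⟨h.1.neg_left, by simpa [neg_add_eq_sub, sub_eq_add_neg] using h.2.neg⟩

theorem sub (h₁ : BoundedApprox F f₁ g₁) (h₂ : BoundedApprox F f₂ g₂) :
    BoundedApprox F (fun x => f₁ x - f₂ x) fun x => g₁ x - g₂ x := by
  simpa only [sub_eq_add_neg] using h₁.add h₂.neg

theorem mul (h₁ : BoundedApprox F f₁ g₁) (h₂ : BoundedApprox F f₂ g₂) :
    BoundedApprox F (fun x => f₁ x * f₂ x) fun x => g₁ x * g₂ x := by
  refine ⟨by simpa using h₁.1.mul h₂.1, ?_⟩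
  have t1 : Tendsto (fun x => f₁ x * (f₂ x - g₂ x)) F (𝓝 0) :=
    (Asymptotics.isLittleO_one_iff ℝ).1
      (by simpa using h₁.1.mul_isLittleO ((Asymptotics.isLittleO_one_iff ℝ).2 h₂.2))
  have t2 : Tendsto (fun x => (f₁ x - g₁ x) * g₂ x) F (𝓝 0) :=
    (Asymptotics.isLittleO_one_iff ℝ).1
      (by simpa using ((Asymptotics.isLittleO_one_iff ℝ).2 h₁.2).mul_isBigO h₂.isBigO_right)
  have := t1.add t2
  rw [add_zero] at this
  exact this.congr fun x => by ring

theorem const (c : ℂ) : BoundedApprox F (fun _ => c) fun _ => c :=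
  refl (Asymptotics.isBigO_const_const _ one_ne_zero _)

theorem prod {ι : Type*} (s : Finset ι) {f g : ι → α → ℂ}
    (h : ∀ i ∈ s, BoundedApprox F (f i) (g i)) :
    BoundedApprox F (fun x => ∏ i ∈ s, f i x) fun x => ∏ i ∈ s, g i x := by
  classical
  induction s using Finset.induction_on with
  | empty => simpa using const 1
  | insert i s hi ih =>
    simp only [Finset.prod_insert hi]
    exact (h i (Finset.mem_insert_self i s)).mul
      (ih fun j hj => h j (Finset.mem_insert_of_mem hj))

theorem sum {ι : Type*} (s : Finset ι) {f g : ι → α → ℂ}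
    (h : ∀ i ∈ s, BoundedApprox F (f i) (g i)) :
    BoundedApprox F (fun x => ∑ i ∈ s, f i x) fun x => ∑ i ∈ s, g i x := by
  classical
  induction s using Finset.induction_on with
  | empty => simpa using const 0
  | insert i s hi ih =>
    simp only [Finset.sum_insert hi]
    exact (h i (Finset.mem_insert_self i s)).add
      (ih fun j hj => h j (Finset.mem_insert_of_mem hj))

open scoped Classical in
theorem combine {ι : Type*} (s : Finset ι) {f g : ι → α → ℂ × ℂ}
    (h1 : ∀ i ∈ s, BoundedApprox F (fun x => (f i x).1) fun x => (g i x).1)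
    (h2 : ∀ i ∈ s, BoundedApprox F (fun x => (f i x).2) fun x => (g i x).2) :
    (BoundedApprox F (fun x => (_root_.combine s fun i => f i x).1)
      fun x => (_root_.combine s fun i => g i x).1) ∧
    BoundedApprox F (fun x => (_root_.combine s fun i => f i x).2)
      fun x => (_root_.combine s fun i => g i x).2 :=
  ⟨prod s h1, sum s fun i hi => (h2 i hi).mul
    (prod _ fun j hj => h1 j (Finset.mem_of_mem_erase hj))⟩

theorem congr' (h : BoundedApprox F f g) (hf : f =ᶠ[F] f₁) (hg : g =ᶠ[F] g₁) :
    BoundedApprox F f₁ g₁ :=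
  ⟨h.1.congr' hf EventuallyEq.rfl, h.2.congr' (hf.sub hg)⟩

end BoundedApprox

end BoundedApprox

theorem Filter.Tendsto.div_tendsto_one {α : Type*} {F : Filter α} {f g : α → ℂ} {ε : ℝ}
    (hε : 0 < ε) (h : Tendsto (fun x => f x - g x) F (𝓝 0)) (hg : ∀ᶠ x in F, ε ≤ ‖g x‖) :
    Tendsto (fun x => f x / g x) F (𝓝 1) := by
  rw [← tendsto_sub_nhds_zero_iff]
  refine squeeze_zero_norm' (a := fun x => ε⁻¹ * ‖f x - g x‖) ?_
    (by simpa using h.norm.const_mul ε⁻¹)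
  filter_upwards [hg] with x hx
  have h0 : g x ≠ 0 := norm_pos_iff.1 (hε.trans_le hx)
  rw [div_sub_one h0, norm_div, div_eq_inv_mul]
  gcongr

/-- The values at `L` of the two fundamental solutions, scaled by powers of `τ`, are asymptotically
those for the zero potential. -/
theorem initialValueSolution_boundedApprox {q : ℝ → ℝ} {L : ℝ} (hL : 0 ≤ L)
    (hq : MemLp q 2 (volume.restrict (Set.Icc 0 L))) :
    BoundedApprox atTop (fun τ : ℝ => (initialValueSolution q L ((τ : ℂ) ^ 2) (1, 0) L).1)
      (fun τ : ℝ => (initialValueSolution (fun _ => 0) L ((τ : ℂ) ^ 2) (1, 0) L).1) ∧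
    BoundedApprox atTop (fun τ : ℝ => (initialValueSolution q L ((τ : ℂ) ^ 2) (1, 0) L).2 / τ)
      (fun τ : ℝ => (initialValueSolution (fun _ => 0) L ((τ : ℂ) ^ 2) (1, 0) L).2 / τ) ∧
    BoundedApprox atTop (fun τ : ℝ => τ * (initialValueSolution q L ((τ : ℂ) ^ 2) (0, 1) L).1)
      (fun τ : ℝ => τ * (initialValueSolution (fun _ => 0) L ((τ : ℂ) ^ 2) (0, 1) L).1) ∧
    BoundedApprox atTop (fun τ : ℝ => (initialValueSolution q L ((τ : ℂ) ^ 2) (0, 1) L).2)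
      (fun τ : ℝ => (initialValueSolution (fun _ => 0) L ((τ : ℂ) ^ 2) (0, 1) L).2) := by
  have hc : (fun τ : ℝ => Complex.cos (τ * L)) =O[atTop] fun _ => (1 : ℝ) :=
    Asymptotics.IsBigO.of_bound 1 (.of_forall fun τ => by
      rw [← Complex.ofReal_mul, ← Complex.ofReal_cos, Complex.norm_real]
      simpa using Real.abs_cos_le_one _)
  have hs : (fun τ : ℝ => -Complex.sin (τ * L)) =O[atTop] fun _ => (1 : ℝ) :=
    Asymptotics.IsBigO.of_bound 1 (.of_forall fun τ => by
      rw [← Complex.ofReal_mul, ← Complex.ofReal_sin, norm_neg, Complex.norm_real]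
      simpa using Real.abs_sin_le_one _)
  have of_tendsto {f g : ℝ → ℂ} (hg : g =O[atTop] fun _ => (1 : ℝ))
      (h : Tendsto (fun τ => f τ - g τ) atTop (𝓝 0)) : BoundedApprox atTop f g :=
    ⟨by simpa using (h.isBigO_one ℝ).add hg, h⟩
  have key {q : ℝ → ℝ} (hq : MemLp q 2 (volume.restrict (Set.Icc 0 L))) :=
    initialValueSolution_asymptotics hL hq
  obtain ⟨a1, a2, a3, a4⟩ := key hq
  obtain ⟨b1, b2, b3, b4⟩ := key (q := fun _ => 0) MemLp.zero'
  refine ⟨(of_tendsto hc a1).trans (of_tendsto hc b1).symm, ?_, ?_,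
    (of_tendsto hc a4).trans (of_tendsto hc b4).symm⟩
  · exact (of_tendsto hs (by simpa using a2)).trans (of_tendsto hs (by simpa using b2)).symm
  · have hs' : (fun τ : ℝ => Complex.sin (τ * L)) =O[atTop] fun _ => (1 : ℝ) := by
      simpa using hs.neg_left
    exact (of_tendsto hs' a3).trans (of_tendsto hs' b3).symm

namespace QuantumTree

open scoped Classical

variable {V : Type u} [Fintype V] (T : QuantumTree V)

/-- The pairs `(value, derivatives divided by τ)` are asymptotically those for the zero potential,
by induction from the leaves. -/
theorem vertexPair_boundedApprox (v : V) :
    BoundedApprox atTop (fun τ : ℝ => (T.vertexPair ((τ : ℂ) ^ 2) v).1)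
      (fun τ : ℝ => (T.zeroPotential.vertexPair ((τ : ℂ) ^ 2) v).1) ∧
    BoundedApprox atTop (fun τ : ℝ => (τ : ℂ)⁻¹ * (T.vertexPair ((τ : ℂ) ^ 2) v).2)
      (fun τ : ℝ => (τ : ℂ)⁻¹ * (T.zeroPotential.vertexPair ((τ : ℂ) ^ 2) v).2) := by
  refine T.leaf_induction (P := fun v =>
    BoundedApprox atTop (fun τ : ℝ => (T.vertexPair ((τ : ℂ) ^ 2) v).1)
      (fun τ : ℝ => (T.zeroPotential.vertexPair ((τ : ℂ) ^ 2) v).1) ∧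
    BoundedApprox atTop (fun τ : ℝ => (τ : ℂ)⁻¹ * (T.vertexPair ((τ : ℂ) ^ 2) v).2)
      (fun τ : ℝ => (τ : ℂ)⁻¹ * (T.zeroPotential.vertexPair ((τ : ℂ) ^ 2) v).2))
    (fun v ih => ?_) v
  have step (T' : QuantumTree V) (τ : ℝ) (w : V) (P : ℂ × ℂ) (hτ : τ ≠ 0) :
      T'.branchPair ((τ : ℂ) ^ 2) w P
        = (P.1 * (initialValueSolution (T'.q w) T'.l ((τ : ℂ) ^ 2) (0, 1) T'.l).2
            - (τ : ℂ)⁻¹ * P.2 *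
              (τ * (initialValueSolution (T'.q w) T'.l ((τ : ℂ) ^ 2) (0, 1) T'.l).1),
          τ * (-P.1 * ((initialValueSolution (T'.q w) T'.l ((τ : ℂ) ^ 2) (1, 0) T'.l).2 / τ)
            + (τ : ℂ)⁻¹ * P.2 *
              (initialValueSolution (T'.q w) T'.l ((τ : ℂ) ^ 2) (1, 0) T'.l).1)) := by
    have hτ' : (τ : ℂ) ≠ 0 := by exact_mod_cast hτ
    ext1 <;> simp only [branchPair] <;> field_simp
  have unfold_pair (T' : QuantumTree V) (τ : ℝ) (v : V) :
      ((T'.vertexPair ((τ : ℂ) ^ 2) v).1, (τ : ℂ)⁻¹ * (T'.vertexPair ((τ : ℂ) ^ 2) v).2)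
        = combine (T'.children v) fun w =>
          ((T'.branchPair ((τ : ℂ) ^ 2) w (T'.vertexPair ((τ : ℂ) ^ 2) w)).1,
            (τ : ℂ)⁻¹ * (T'.branchPair ((τ : ℂ) ^ 2) w (T'.vertexPair ((τ : ℂ) ^ 2) w)).2) := by
    rw [combine_smul, ← vertexPair_eq]
  have hne : ∀ᶠ τ : ℝ in atTop, τ ≠ 0 := eventually_ne_atTop 0
  have main := BoundedApprox.combine (F := (atTop : Filter ℝ)) (T.children v)
    (f := fun w τ => ((T.branchPair ((τ : ℂ) ^ 2) w (T.vertexPair ((τ : ℂ) ^ 2) w)).1,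
      (τ : ℂ)⁻¹ * (T.branchPair ((τ : ℂ) ^ 2) w (T.vertexPair ((τ : ℂ) ^ 2) w)).2))
    (g := fun w τ => ((T.zeroPotential.branchPair ((τ : ℂ) ^ 2) w
        (T.zeroPotential.vertexPair ((τ : ℂ) ^ 2) w)).1,
      (τ : ℂ)⁻¹ * (T.zeroPotential.branchPair ((τ : ℂ) ^ 2) w
        (T.zeroPotential.vertexPair ((τ : ℂ) ^ 2) w)).2))
    (fun w hw => by
      obtain ⟨_, _, h3, h4⟩ := initialValueSolution_boundedApprox T.l_pos.le
        (T.q_memLp w (T.ne_root_of_mem_children hw))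
      refine (((ih w hw).1.mul h4).sub ((ih w hw).2.mul h3)).congr' ?_ ?_
      · filter_upwards [hne] with τ hτ
        rw [step T τ w _ hτ]
      · filter_upwards [hne] with τ hτ
        rw [step T.zeroPotential τ w _ hτ]
        rfl)
    (fun w hw => by
      obtain ⟨h1, h2, _, _⟩ := initialValueSolution_boundedApprox T.l_pos.le
        (T.q_memLp w (T.ne_root_of_mem_children hw))
      refine (((ih w hw).1.neg.mul h2).add ((ih w hw).2.mul h1)).congr' ?_ ?_
      · filter_upwards [hne] with τ hτ
        rw [step T τ w _ hτ, inv_mul_cancel_left₀ (by exact_mod_cast hτ)]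
      · filter_upwards [hne] with τ hτ
        rw [step T.zeroPotential τ w _ hτ, inv_mul_cancel_left₀ (by exact_mod_cast hτ)]
        rfl)
  refine ⟨main.1.congr' ?_ ?_, main.2.congr' ?_ ?_⟩ <;> filter_upwards [hne] with τ hτ
  · exact (congrArg Prod.fst (unfold_pair T τ v)).symm
  · exact (congrArg Prod.fst (unfold_pair T.zeroPotential τ v)).symm
  · exact (congrArg Prod.snd (unfold_pair T τ v)).symm
  · exact (congrArg Prod.snd (unfold_pair T.zeroPotential τ v)).symm

theorem jost_boundedApprox :
    BoundedApprox atTop (fun τ : ℝ => T.jost τ / τ) (fun τ : ℝ => T.zeroPotential.jost τ / τ) ∧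
    BoundedApprox atTop (fun τ : ℝ => T.jost (-τ) / τ)
      (fun τ : ℝ => T.zeroPotential.jost (-τ) / τ) := by
  obtain ⟨h1, h2⟩ := T.vertexPair_boundedApprox T.root
  have hne : ∀ᶠ τ : ℝ in atTop, τ ≠ 0 := eventually_ne_atTop 0
  have e1 (T' : QuantumTree V) : (fun τ : ℝ =>
      -((τ : ℂ)⁻¹ * (T'.vertexPair ((τ : ℂ) ^ 2) T'.root).2)
        + Complex.I * (T'.vertexPair ((τ : ℂ) ^ 2) T'.root).1) =ᶠ[atTop]
      fun τ : ℝ => T'.jost τ / τ := by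
    filter_upwards [hne] with τ hτ
    have hτ' : (τ : ℂ) ≠ 0 := by exact_mod_cast hτ
    rw [jost, phiN_eq, phiD_eq]
    field_simp
  have e2 (T' : QuantumTree V) : (fun τ : ℝ =>
      -((τ : ℂ)⁻¹ * (T'.vertexPair ((τ : ℂ) ^ 2) T'.root).2)
        - Complex.I * (T'.vertexPair ((τ : ℂ) ^ 2) T'.root).1) =ᶠ[atTop]
      fun τ : ℝ => T'.jost (-τ) / τ := by
    filter_upwards [hne] with τ hτ
    have hτ' : (τ : ℂ) ≠ 0 := by exact_mod_cast hτ
    rw [jost_neg, phiN_eq, phiD_eq]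
    field_simp
  have hI := (BoundedApprox.const (F := (atTop : Filter ℝ)) Complex.I).mul h1
  exact ⟨(h2.neg.add hI).congr' (e1 T) (e1 T.zeroPotential),
    (h2.neg.sub hI).congr' (e2 T) (e2 T.zeroPotential)⟩

end QuantumTree

/-! ### Entire functions and the real axis -/

theorem Differentiable.eq_zero_of_eventually_ofReal {f : ℂ → ℂ} (hf : Differentiable ℂ f) {x : ℝ}
    (h : ∀ᶠ t : ℝ in 𝓝 x, f t = 0) (z : ℂ) : f z = 0 := by
  have hmap : Tendsto (fun t : ℝ => (t : ℂ)) (𝓝[≠] x) (𝓝[≠] (x : ℂ)) :=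
    tendsto_nhdsWithin_iff.2 ⟨Complex.continuous_ofReal.continuousAt.tendsto.mono_left
      nhdsWithin_le_nhds, by
        filter_upwards [self_mem_nhdsWithin] with t ht
        simpa using ht⟩
  have hfreq : ∃ᶠ z in 𝓝[≠] (x : ℂ), f z = 0 :=
    hmap.frequently (h.filter_mono nhdsWithin_le_nhds).frequently
  exact congrFun (AnalyticOnNhd.eq_of_frequently_eq (g := fun _ => (0 : ℂ))
    (fun z _ => hf.analyticAt z) analyticOnNhd_const hfreq) z

theorem Differentiable.eq_zero_of_mul_eq_zero {f g : ℂ → ℂ} (hf : Differentiable ℂ f)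
    (hg : Differentiable ℂ g) {x : ℂ} (hx : f x ≠ 0) (h : ∀ t : ℝ, f t * g t = 0) (z : ℂ) :
    g z = 0 := by
  have h0 : ∀ t : ℝ, g t = 0 := fun t => by
    by_contra ht
    have hev : ∀ᶠ s : ℝ in 𝓝 t, g s ≠ 0 :=
      (hg.continuous.comp Complex.continuous_ofReal).continuousAt.eventually_ne ht
    refine hx (hf.eq_zero_of_eventually_ofReal (x := t) ?_ x)
    filter_upwards [hev] with s hs using (mul_eq_zero.1 (h s)).resolve_right hs
  exact hg.eq_zero_of_eventually_ofReal (x := 0) (.of_forall h0) z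

/-! ### The zero potential as a function of `τ` -/

namespace RootedCombTree

variable {V : Type u} [Fintype V] (T : RootedCombTree V)

theorem differentiable_rootValue : Differentiable ℂ T.rootValue := fun θ =>
  ((T.polyPair T.root).1.differentiable_aeval (𝕜 := ℂ) _).comp θ
      Complex.differentiable_cos.differentiableAt

theorem differentiable_rootDeriv : Differentiable ℂ T.rootDeriv :=
  Complex.differentiable_sin.mul fun θ =>
    ((T.polyPair T.root).2.differentiable_aeval (𝕜 := ℂ) _).comp θ
      Complex.differentiable_cos.differentiableAt

theorem rootValue_zero : T.rootValue 0 = 1 := by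
  rw [rootValue, Complex.cos_zero, ← map_one (algebraMap ℚ ℂ), aeval_algebraMap_apply,
    coe_aeval_eq_eval, polyPair, (BranchedCF.eval_one_polyPair _).1]

theorem rootDeriv_zero : T.rootDeriv 0 = 0 := by simp [rootDeriv]

theorem hasDerivAt_rootDeriv_zero :
    HasDerivAt T.rootDeriv ((Fintype.card V : ℂ) - 1) 0 := by
  have h1 : aeval (Complex.cos 0) (T.polyPair T.root).2 = (Fintype.card V : ℂ) - 1 := by
    rw [Complex.cos_zero, ← map_one (algebraMap ℚ ℂ), aeval_algebraMap_apply,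
      coe_aeval_eq_eval, polyPair, (BranchedCF.eval_one_polyPair _).2, ← T.edges_readOff_root]
    simp
  have hd : DifferentiableAt ℂ (fun θ => aeval (Complex.cos θ) (T.polyPair T.root).2) 0 :=
    ((T.polyPair T.root).2.differentiable_aeval (𝕜 := ℂ) _).comp _
      Complex.differentiable_cos.differentiableAt
  have := (Complex.hasDerivAt_sin 0).mul hd.hasDerivAt
  rw [h1, Complex.cos_zero, Complex.sin_zero, one_mul, zero_mul, add_zero] at this
  exact this

theorem rootValue_add_two_pi (θ : ℂ) : T.rootValue (θ + 2 * Real.pi) = T.rootValue θ := by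
  rw [rootValue, Complex.cos_add_two_pi, rootValue]

theorem rootDeriv_add_two_pi (θ : ℂ) : T.rootDeriv (θ + 2 * Real.pi) = T.rootDeriv θ := by
  rw [rootDeriv, Complex.cos_add_two_pi, Complex.sin_add_two_pi, rootDeriv]

/-- Since the polynomials of the value and of the derivative have opposite parities, the shift by
`π` multiplies both functions by the same sign. -/
theorem root_add_pi (θ : ℂ) : ∃ ε : ℂ, T.rootValue (θ + Real.pi) = ε * T.rootValue θ ∧
    T.rootDeriv (θ + Real.pi) = ε * T.rootDeriv θ := by
  obtain ⟨ε, _, h1, h2⟩ := (T.readOff T.root).polyPair_comp_neg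
  have key (p : ℚ[X]) : aeval (-Complex.cos θ) p = aeval (Complex.cos θ) (p.comp (-X)) := by
    rw [aeval_comp]; simp
  refine ⟨aeval (Complex.cos θ) ε, ?_, ?_⟩
  · rw [rootValue, Complex.cos_add_pi, key, polyPair, h1, map_mul, rootValue, polyPair]
  · rw [rootDeriv, Complex.cos_add_pi, Complex.sin_add_pi, key, polyPair, h2, rootDeriv, polyPair]
    simp only [map_mul, map_neg]
    ring

end RootedCombTree

namespace QuantumTree

variable {V : Type u} [Fintype V] (T : QuantumTree V)

/-- `φ_D (τ²)` for the zero potential. -/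
noncomputable def freeValue (τ : ℂ) : ℂ := T.rootValue (τ * T.l)

/-- `-φ_N (τ²) / τ` for the zero potential. -/
noncomputable def freeDeriv (τ : ℂ) : ℂ := T.rootDeriv (τ * T.l)

theorem differentiable_freeValue : Differentiable ℂ T.freeValue := fun τ =>
  (T.differentiable_rootValue _).comp τ (differentiableAt_id.mul_const _)

theorem differentiable_freeDeriv : Differentiable ℂ T.freeDeriv := fun τ =>
  (T.differentiable_rootDeriv _).comp τ (differentiableAt_id.mul_const _)

theorem freeValue_zero : T.freeValue 0 = 1 := by
  rw [freeValue, zero_mul, T.rootValue_zero]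

theorem freeDeriv_zero : T.freeDeriv 0 = 0 := by
  rw [freeDeriv, zero_mul, T.rootDeriv_zero]

/-- The derivative at `0` is the total length of the tree. -/
theorem hasDerivAt_freeDeriv_zero :
    HasDerivAt T.freeDeriv (((Fintype.card V : ℂ) - 1) * T.l) 0 := by
  have h := T.hasDerivAt_rootDeriv_zero
  rw [← zero_mul (T.l : ℂ)] at h
  have := h.comp 0 ((hasDerivAt_id (0 : ℂ)).mul_const (T.l : ℂ))
  rw [one_mul] at this
  exact this

theorem exists_real_free (τ : ℝ) :
    ∃ a b : ℝ, T.freeValue τ = a ∧ T.freeDeriv τ = b := by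
  obtain ⟨a, ha⟩ := T.exists_real_rootValue (τ * T.l)
  obtain ⟨b, hb⟩ := T.exists_real_rootDeriv (τ * T.l)
  exact ⟨a, b, by rw [freeValue, ← ha, Complex.ofReal_mul], by
    rw [freeDeriv, ← hb, Complex.ofReal_mul]⟩

theorem free_add_pi_div (τ : ℂ) : ∃ ε : ℂ,
    T.freeValue (τ + (Real.pi / T.l : ℝ)) = ε * T.freeValue τ ∧
    T.freeDeriv (τ + (Real.pi / T.l : ℝ)) = ε * T.freeDeriv τ := by
  have e : (τ + (Real.pi / T.l : ℝ)) * T.l = τ * T.l + Real.pi := by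
    have hl : (T.l : ℂ) ≠ 0 := by exact_mod_cast T.l_pos.ne'
    push_cast
    field_simp
  rw [freeValue, freeDeriv, e]
  exact T.root_add_pi (τ * T.l)

theorem zeroPotential_jost_eq (τ : ℂ) : T.zeroPotential.jost τ
    = -τ * (T.freeDeriv τ - Complex.I * T.freeValue τ) := T.jost_zeroPotential τ

theorem zeroPotential_jost_neg_eq (τ : ℂ) : T.zeroPotential.jost (-τ)
    = -τ * (T.freeDeriv τ + Complex.I * T.freeValue τ) := T.jost_neg_zeroPotential τ

theorem free_eq_zero_of_jost {τ : ℝ} (h : T.freeDeriv τ + Complex.I * T.freeValue τ = 0) :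
    T.freeValue τ = 0 ∧ T.freeDeriv τ = 0 := by
  obtain ⟨a, b, ha, hb⟩ := T.exists_real_free τ
  rw [ha, hb] at h ⊢
  have h1 : b = 0 := by simpa using congrArg Complex.re h
  have h2 : a = 0 := by simpa using congrArg Complex.im h
  simp [h1, h2]

/-- Both functions are real on the real axis. -/
theorem norm_free_sub (τ : ℝ) : ‖T.freeDeriv τ - Complex.I * T.freeValue τ‖
    = ‖T.freeDeriv τ + Complex.I * T.freeValue τ‖ := by
  obtain ⟨a, b, ha, hb⟩ := T.exists_real_free τ
  rw [ha, hb, ← Complex.norm_conj]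
  congr 1
  simp

/-! ### The S-function away from the zeros of the Jost function -/

theorem continuous_norm_free : Continuous fun τ : ℝ =>
    ‖T.freeDeriv τ + Complex.I * T.freeValue τ‖ :=
  ((T.differentiable_freeDeriv.continuous.comp Complex.continuous_ofReal).add
    (continuous_const.mul (T.differentiable_freeValue.continuous.comp
      Complex.continuous_ofReal))).norm

theorem freeValue_periodic :
    Function.Periodic (fun τ : ℝ => T.freeValue τ) (2 * Real.pi / T.l) := fun τ => by
  have e : ((τ + 2 * Real.pi / T.l : ℝ) : ℂ) * T.l = τ * T.l + 2 * Real.pi := by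
    have hl : (T.l : ℂ) ≠ 0 := by exact_mod_cast T.l_pos.ne'
    push_cast
    field_simp
  simp only [freeValue, e, T.rootValue_add_two_pi]

theorem freeDeriv_periodic :
    Function.Periodic (fun τ : ℝ => T.freeDeriv τ) (2 * Real.pi / T.l) := fun τ => by
  have e : ((τ + 2 * Real.pi / T.l : ℝ) : ℂ) * T.l = τ * T.l + 2 * Real.pi := by
    have hl : (T.l : ℂ) ≠ 0 := by exact_mod_cast T.l_pos.ne'
    push_cast
    field_simp
  simp only [freeDeriv, e, T.rootDeriv_add_two_pi]

theorem free_periodic : Function.Periodic (fun τ : ℝ =>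
    T.freeDeriv τ + Complex.I * T.freeValue τ) (2 * Real.pi / T.l) := fun τ => by
  have h1 := T.freeValue_periodic τ
  have h2 := T.freeDeriv_periodic τ
  simp only at h1 h2 ⊢
  rw [h1, h2]

theorem mem_realZeros_of_free {τ : ℝ} (h : T.freeDeriv τ + Complex.I * T.freeValue τ = 0) :
    τ ∈ T.zeroPotential.realZeros := by
  obtain ⟨h1, h2⟩ := T.free_eq_zero_of_jost h
  change T.zeroPotential.jost τ = 0
  rw [zeroPotential_jost_eq, h1, h2]
  simp

/-- By periodicity and compactness, the zero-potential Jost function divided by `τ` is bounded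
below in absolute value away from its real zeros. -/
theorem exists_le_norm_free {δ : ℝ} (hδ : 0 < δ) : ∃ ε > 0, ∀ τ : ℝ,
    (∀ t ∈ T.zeroPotential.realZeros, δ ≤ |τ - t|) →
      ε ≤ ‖T.freeDeriv τ + Complex.I * T.freeValue τ‖ := by
  set G : ℝ → ℂ := fun τ => T.freeDeriv τ + Complex.I * T.freeValue τ with hG
  set c := 2 * Real.pi / T.l with hc
  have hc0 : 0 < c := div_pos Real.two_pi_pos T.l_pos
  have hK : IsCompact (Set.Icc 0 c ∩ {τ : ℝ | ∀ t, G t = 0 → δ ≤ |τ - t|}) := by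
    refine isCompact_Icc.inter_right ?_
    simp only [Set.ofPred_forall]
    exact isClosed_iInter fun t => isClosed_iInter fun _ =>
      isClosed_le continuous_const (continuous_id.sub continuous_const).abs
  obtain ⟨ε, hε, hεK⟩ := hK.exists_forall_le' T.continuous_norm_free.continuousOn (a := 0)
    (fun τ hτ => norm_pos_iff.2 fun h0 => by
      have := hτ.2 τ h0
      simp at this
      linarith)
  refine ⟨ε, hε, fun τ hτ => ?_⟩
  obtain ⟨n, hn, -⟩ := existsUnique_sub_zsmul_mem_Ico hc0 τ 0
  have hper := T.free_periodic.sub_zsmul_eq (x := τ) n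
  rw [← hper]
  refine hεK _ ⟨⟨hn.1, by simpa using hn.2.le⟩, fun t ht => ?_⟩
  have := hτ (t + n • c) (T.mem_realZeros_of_free ?_)
  · convert this using 2
    ring
  · rw [← ht]
    exact T.free_periodic.zsmul n t

theorem eventually_jost_ne_zero {δ : ℝ} (hδ : 0 < δ) :
    ∀ᶠ τ : ℝ in atTop, (∀ t ∈ T.zeroPotential.realZeros, δ ≤ |τ - t|) →
      T.zeroPotential.jost (-τ) ≠ 0 ∧ T.jost (-τ) ≠ 0 := by
  obtain ⟨ε, hε, hεle⟩ := T.exists_le_norm_free hδ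
  have h := T.jost_boundedApprox.2.2
  rw [tendsto_zero_iff_norm_tendsto_zero] at h
  filter_upwards [eventually_gt_atTop 0, h.eventually_lt_const hε] with τ hτ hlt hdist
  have hτ' : (τ : ℂ) ≠ 0 := by exact_mod_cast hτ.ne'
  have hle := hεle τ hdist
  have hne := norm_pos_iff.1 (hε.trans_le hle)
  have hJ : T.zeroPotential.jost (-τ) / τ = -(T.freeDeriv τ + Complex.I * T.freeValue τ) := by
    rw [zeroPotential_jost_neg_eq]
    field_simp
  refine ⟨?_, fun h0 => ?_⟩
  · rw [zeroPotential_jost_neg_eq]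
    exact mul_ne_zero (neg_ne_zero.2 hτ') hne
  · rw [h0, hJ, zero_div, zero_sub, neg_neg] at hlt
    linarith

theorem tendsto_sFunction_div {δ : ℝ} (hδ : 0 < δ) :
    Tendsto (fun τ : ℝ => T.sFunction τ / T.zeroPotential.sFunction τ)
      (atTop ⊓ 𝓟 {τ : ℝ | ∀ t ∈ T.zeroPotential.realZeros, δ ≤ |τ - t|}) (𝓝 1) := by
  obtain ⟨ε, hε, hεle⟩ := T.exists_le_norm_free hδ
  set F := (atTop ⊓ 𝓟 {τ : ℝ | ∀ t ∈ T.zeroPotential.realZeros, δ ≤ |τ - t|}) with hF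
  have hpos : ∀ᶠ τ in F, (0 : ℝ) < τ := (eventually_gt_atTop 0).filter_mono inf_le_left
  have hdist : ∀ᶠ τ in F, ∀ t ∈ T.zeroPotential.realZeros, δ ≤ |τ - t| :=
    mem_inf_of_right (mem_principal_self _)
  obtain ⟨⟨_, h1⟩, _, h2⟩ := T.jost_boundedApprox
  have l1 := Filter.Tendsto.div_tendsto_one hε (h1.mono_left (inf_le_left : F ≤ atTop)) (by
    filter_upwards [hpos, hdist] with τ hτ hd
    have hτ' : (τ : ℂ) ≠ 0 := by exact_mod_cast hτ.ne'
    rw [zeroPotential_jost_eq, neg_mul, neg_div, mul_div_cancel_left₀ _ hτ', norm_neg,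
      T.norm_free_sub]
    exact hεle τ hd)
  have l2 := Filter.Tendsto.div_tendsto_one hε (h2.mono_left (inf_le_left : F ≤ atTop)) (by
    filter_upwards [hpos, hdist] with τ hτ hd
    have hτ' : (τ : ℂ) ≠ 0 := by exact_mod_cast hτ.ne'
    rw [zeroPotential_jost_neg_eq, neg_mul, neg_div, mul_div_cancel_left₀ _ hτ', norm_neg]
    exact hεle τ hd)
  have l3 := l1.div l2 one_ne_zero
  rw [div_one] at l3
  refine l3.congr' ?_
  filter_upwards [hpos] with τ hτ
  have hτ' : (τ : ℂ) ≠ 0 := by exact_mod_cast hτ.ne'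
  simp only [Pi.div_apply]
  rw [div_div_div_cancel_right₀ hτ', div_div_div_cancel_right₀ hτ', div_div_div_comm, sFunction,
    sFunction]

/-- Along a sequence on which the zero-potential functions converge, the Jost functions divided by
`τ` converge to the corresponding combinations, whatever the potentials are. -/
theorem tendsto_jost_div {σ : ℕ → ℝ} (hσ : Tendsto σ atTop atTop) {a b : ℂ}
    (hb : Tendsto (fun n => T.freeDeriv (σ n)) atTop (𝓝 b))
    (ha : Tendsto (fun n => T.freeValue (σ n)) atTop (𝓝 a)) :
    Tendsto (fun n => T.jost (σ n) / σ n) atTop (𝓝 (-(b - Complex.I * a))) ∧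
    Tendsto (fun n => T.jost (-(σ n)) / σ n) atTop (𝓝 (-(b + Complex.I * a))) := by
  obtain ⟨⟨_, h1⟩, _, h2⟩ := T.jost_boundedApprox
  have e1 := (h1.comp hσ).add (hb.sub (ha.const_mul Complex.I)).neg
  have e2 := (h2.comp hσ).add (hb.add (ha.const_mul Complex.I)).neg
  rw [zero_add] at e1 e2
  refine ⟨e1.congr' ?_, e2.congr' ?_⟩ <;>
    filter_upwards [hσ.eventually (eventually_ne_atTop 0)] with n hn <;>
    have hn' : (σ n : ℂ) ≠ 0 := by exact_mod_cast hn
  · simp only [Function.comp_apply, zeroPotential_jost_eq]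
    field_simp
    ring
  · simp only [Function.comp_apply, zeroPotential_jost_neg_eq]
    field_simp
    ring

end QuantumTree

/-! ### Equality of S-functions -/

/-- Simultaneous recurrence: there are arbitrarily large multiples of `x` that are close to integer
multiples of `y`. -/
theorem exists_tendsto_recurrence {x y : ℝ} (hx : 0 < x) (hy : 0 < y) :
    ∃ (m : ℕ → ℕ) (k : ℕ → ℤ), Tendsto (fun n => m n * x) atTop atTop ∧
      Tendsto (fun n => m n * x - k n * y) atTop (𝓝 0) := by
  have h (n : ℕ) := Real.exists_nat_abs_mul_sub_round_le (x / y) (n := (n + 1) ^ 2) (by positivity)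
  choose d hd0 _ hd using h
  -- the denominator `d n` need not tend to infinity, but `(n + 1) d n` does; the error of order
  -- `1 / (n + 1)²` allows this factor
  refine ⟨fun n => (n + 1) * d n, fun n => (n + 1) * round (d n * (x / y)), ?_, ?_⟩
  · refine tendsto_atTop_mono (fun n => ?_)
      ((tendsto_natCast_atTop_atTop (R := ℝ)).atTop_mul_const hx)
    have : (1 : ℝ) ≤ d n := by exact_mod_cast hd0 n
    push_cast
    gcongr
    nlinarith [(n.cast_nonneg : (0 : ℝ) ≤ n)]
  · have ht : Tendsto (fun n : ℕ => y * (1 / ((n : ℝ) + 1))) atTop (𝓝 0) := by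
      simpa using tendsto_one_div_add_atTop_nhds_zero_nat.const_mul y
    refine squeeze_zero_norm (fun n => ?_) ht
    have hn : (0 : ℝ) < (n : ℝ) + 1 := by positivity
    have e : (((n + 1) * d n : ℕ) : ℝ) * x - (((n + 1) * round (d n * (x / y)) : ℤ) : ℝ) * y
        = y * (((n : ℝ) + 1) * (d n * (x / y) - round (d n * (x / y)))) := by
      push_cast
      field_simp
    rw [e, Real.norm_eq_abs, abs_mul, abs_of_pos hy, abs_mul, abs_of_pos hn]
    gcongr
    calc ((n : ℝ) + 1) * |(d n * (x / y) - round (d n * (x / y)))|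
        ≤ ((n : ℝ) + 1) * (1 / ((((n + 1) ^ 2 : ℕ) : ℝ) + 1)) := by gcongr; exact hd n
      _ ≤ ((n : ℝ) + 1) * (1 / (((n : ℝ) + 1) ^ 2)) := by
        push_cast
        gcongr
        linarith
      _ = 1 / ((n : ℝ) + 1) := by field_simp

namespace QuantumTree

variable {V : Type u} [Fintype V] {W : Type w} [Fintype W] (T : QuantumTree V) (T' : QuantumTree W)

/-- The zero-potential functions `φ_N / φ_D` of the two trees coincide, in a form without
denominators. -/
def SameFree : Prop :=
  ∀ τ : ℂ, T.freeDeriv τ * T'.freeValue τ = T'.freeDeriv τ * T.freeValue τ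

variable {T T'}

theorem sameFree_of_real
    (h : ∀ τ : ℝ, T.freeDeriv τ * T'.freeValue τ = T'.freeDeriv τ * T.freeValue τ) :
    T.SameFree T' := fun τ => sub_eq_zero.1 <|
  ((T.differentiable_freeDeriv.mul T'.differentiable_freeValue).sub
    (T'.differentiable_freeDeriv.mul T.differentiable_freeValue)).eq_zero_of_eventually_ofReal
      (x := 0) (.of_forall fun t => sub_eq_zero.2 (h t)) τ

/-- The shift of the argument by multiples of `2π / l` that are almost multiples of `2π / l'` turns
the asymptotic equality of the Jost functions into an exact equality for zero potentials. -/
theorem SameS.sameFree (h : T.SameS T') : T.SameFree T' := by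
  refine sameFree_of_real fun τ => ?_
  by_cases h0 : T.freeDeriv τ + Complex.I * T.freeValue τ = 0
  · obtain ⟨h1, h2⟩ := T.free_eq_zero_of_jost h0
    rw [h1, h2]; ring
  by_cases h0' : T'.freeDeriv τ + Complex.I * T'.freeValue τ = 0
  · obtain ⟨h1, h2⟩ := T'.free_eq_zero_of_jost h0'
    rw [h1, h2]; ring
  obtain ⟨m, k, hm, hk⟩ := exists_tendsto_recurrence
    (div_pos Real.two_pi_pos T.l_pos) (div_pos Real.two_pi_pos T'.l_pos)
  set x := 2 * Real.pi / T.l with hx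
  set y := 2 * Real.pi / T'.l with hy
  have hσ : Tendsto (fun n => τ + m n * x) atTop atTop := tendsto_atTop_add_const_left _ _ hm
  have hρ : Tendsto (fun n => τ + (m n * x - k n * y)) atTop (𝓝 τ) := by
    simpa using hk.const_add τ
  -- the shift does not change the functions of `T`; for `T'` it is a small shift
  have c1 : ∀ n, T.freeDeriv ((τ + m n * x : ℝ) : ℂ) = T.freeDeriv τ ∧
      T.freeValue ((τ + m n * x : ℝ) : ℂ) = T.freeValue τ := fun n =>
    ⟨T.freeDeriv_periodic.nat_mul (m n) τ,
      T.freeValue_periodic.nat_mul (m n) τ⟩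
  have c2 : ∀ n, T'.freeDeriv ((τ + m n * x : ℝ) : ℂ)
        = T'.freeDeriv ((τ + (m n * x - k n * y) : ℝ) : ℂ) ∧
      T'.freeValue ((τ + m n * x : ℝ) : ℂ)
        = T'.freeValue ((τ + (m n * x - k n * y) : ℝ) : ℂ) := fun n => by
    have e : (τ + m n * x : ℝ) = (τ + (m n * x - k n * y)) + k n * y := by ring
    rw [e]
    exact ⟨T'.freeDeriv_periodic.int_mul (k n) _, T'.freeValue_periodic.int_mul (k n) _⟩
  have d1 : Tendsto (fun n => T'.freeDeriv ((τ + m n * x : ℝ) : ℂ)) atTop (𝓝 (T'.freeDeriv τ)) := by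
    simp only [c2]
    exact ((T'.differentiable_freeDeriv.continuous.comp
      Complex.continuous_ofReal).tendsto τ).comp hρ
  have d2 : Tendsto (fun n => T'.freeValue ((τ + m n * x : ℝ) : ℂ)) atTop (𝓝 (T'.freeValue τ)) := by
    simp only [c2]
    exact ((T'.differentiable_freeValue.continuous.comp
      Complex.continuous_ofReal).tendsto τ).comp hρ
  have d1' : Tendsto (fun n => T.freeDeriv ((τ + m n * x : ℝ) : ℂ)) atTop (𝓝 (T.freeDeriv τ)) := by
    simp only [c1, tendsto_const_nhds]
  have d2' : Tendsto (fun n => T.freeValue ((τ + m n * x : ℝ) : ℂ)) atTop (𝓝 (T.freeValue τ)) := by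
    simp only [c1, tendsto_const_nhds]
  have lim := T.tendsto_jost_div hσ d1' d2'
  have lim' := T'.tendsto_jost_div hσ d1 d2
  have key := tendsto_nhds_unique_of_eventuallyEq (lim.1.mul lim'.2) (lim'.1.mul lim.2) (by
    filter_upwards [lim.2.eventually_ne (neg_ne_zero.2 h0),
      lim'.2.eventually_ne (neg_ne_zero.2 h0'), hσ.eventually h] with n h1 h2 h3
    have n1 : T.jost (-((τ + m n * x : ℝ) : ℂ)) ≠ 0 := fun h => h1 (by rw [h, zero_div])
    have n2 : T'.jost (-((τ + m n * x : ℝ) : ℂ)) ≠ 0 := fun h => h2 (by rw [h, zero_div])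
    have h4 := h3 n1 n2
    rw [sFunction, sFunction, div_eq_div_iff n1 n2] at h4
    rw [div_mul_div_comm, div_mul_div_comm, h4])
  have hI : (2 * Complex.I) ≠ 0 := mul_ne_zero two_ne_zero Complex.I_ne_zero
  refine mul_left_cancel₀ hI ?_
  linear_combination key

theorem eqS_zeroPotential_iff : T.zeroPotential.EqS T'.zeroPotential ↔ T.SameFree T' := by
  constructor
  · intro h
    refine sameFree_of_real fun τ => ?_
    by_cases h0 : T.freeDeriv τ + Complex.I * T.freeValue τ = 0
    · obtain ⟨h1, h2⟩ := T.free_eq_zero_of_jost h0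
      rw [h1, h2]; ring
    by_cases h0' : T'.freeDeriv τ + Complex.I * T'.freeValue τ = 0
    · obtain ⟨h1, h2⟩ := T'.free_eq_zero_of_jost h0'
      rw [h1, h2]; ring
    by_cases hτ : τ = 0
    · rw [hτ, Complex.ofReal_zero, T.freeDeriv_zero, T'.freeDeriv_zero]; ring
    have hτ' : -(τ : ℂ) ≠ 0 := neg_ne_zero.2 (by exact_mod_cast hτ)
    have key := h τ (by rw [zeroPotential_jost_neg_eq]; exact mul_ne_zero hτ' h0)
      (by rw [zeroPotential_jost_neg_eq]; exact mul_ne_zero hτ' h0')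
    rw [sFunction, sFunction, zeroPotential_jost_neg_eq, zeroPotential_jost_neg_eq,
      zeroPotential_jost_eq, zeroPotential_jost_eq, mul_div_mul_left _ _ hτ',
      mul_div_mul_left _ _ hτ', div_eq_div_iff h0 h0'] at key
    have hI : (2 * Complex.I) ≠ 0 := mul_ne_zero two_ne_zero Complex.I_ne_zero
    refine mul_left_cancel₀ hI ?_
    linear_combination key
  · intro h τ h0 h0'
    rw [sFunction, sFunction, div_eq_div_iff h0 h0']
    rw [zeroPotential_jost_neg_eq, zeroPotential_jost_neg_eq, zeroPotential_jost_eq,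
      zeroPotential_jost_eq]
    linear_combination 2 * Complex.I * τ ^ 2 * h τ

/-- For equal edge lengths, the polynomials are determined by the values at `cos θ`. -/
theorem sameFree_iff_ratio_eq (hl : T'.l = T.l) : T.SameFree T' ↔ T'.ratio = T.ratio := by
  rw [T.ratio_eq_iff]
  set A := (T.polyPair T.root).1
  set Q := (T.polyPair T.root).2
  set A' := (T'.polyPair T'.root).1
  set Q' := (T'.polyPair T'.root).2
  have hl0 : (T.l : ℂ) ≠ 0 := by exact_mod_cast T.l_pos.ne'
  constructor
  · intro h
    refine (map_injective (algebraMap ℚ ℂ) (algebraMap ℚ ℂ).injective)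
      (eq_of_infinite_eval_eq _ _ ?_)
    have hinf : (((↑) : ℝ → ℂ) '' Set.Ioo (-1 : ℝ) 1).Infinite :=
      (Set.Ioo_infinite (by norm_num)).image Complex.ofReal_injective.injOn
    refine hinf.mono ?_
    rintro _ ⟨z, hz, rfl⟩
    have hc : Complex.cos (Real.arccos z) = z := by
      rw [← Complex.ofReal_cos, Real.cos_arccos hz.1.le hz.2.le]
    have hs : Complex.sin (Real.arccos z) ≠ 0 := by
      rw [← Complex.ofReal_sin]
      exact_mod_cast (Real.sin_pos_of_pos_of_lt_pi (Real.arccos_pos.2 hz.2)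
        (Real.arccos_lt_pi.2 hz.1)).ne'
    have := h (Real.arccos z / T.l)
    simp only [freeDeriv, freeValue, hl, div_mul_cancel₀ _ hl0, RootedCombTree.rootDeriv,
      RootedCombTree.rootValue, hc] at this
    simp only [Set.mem_ofPred_eq, eval_map_algebraMap, map_mul]
    refine mul_left_cancel₀ hs ?_
    linear_combination -this
  · intro h τ
    have := congrArg (aeval (Complex.cos (τ * T.l))) h
    simp only [map_mul] at this
    simp only [freeDeriv, freeValue, hl, RootedCombTree.rootDeriv, RootedCombTree.rootValue]
    linear_combination -Complex.sin (τ * T.l) * this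

variable (T T') in
theorem hasDerivAt_freeDeriv_mul_freeValue : HasDerivAt (fun τ => T.freeDeriv τ * T'.freeValue τ)
    (((Fintype.card V : ℂ) - 1) * T.l) 0 := by
  have := T.hasDerivAt_freeDeriv_zero.mul (T'.differentiable_freeValue 0).hasDerivAt
  rw [T'.freeValue_zero, T.freeDeriv_zero, mul_one, zero_mul, add_zero] at this
  exact this

/-- The total length is the derivative of the quotient `freeDeriv / freeValue` at `0`. -/
theorem SameFree.length_eq (h : T.SameFree T') :
    ((Fintype.card V : ℝ) - 1) * T.l = ((Fintype.card W : ℝ) - 1) * T'.l := by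
  have h2 := T'.hasDerivAt_freeDeriv_mul_freeValue T
  rw [← funext h] at h2
  exact_mod_cast (T.hasDerivAt_freeDeriv_mul_freeValue T').unique h2

/-! ### The periods of the S-function -/

variable (T) in
/-- The periods of the quotient `freeDeriv / freeValue`, in a form without denominators. -/
def freePeriods : AddSubgroup ℝ where
  carrier := {p | ∀ τ : ℂ, T.freeValue (τ + p) * T.freeDeriv τ
    = T.freeDeriv (τ + p) * T.freeValue τ}
  zero_mem' τ := by simp [mul_comm]
  neg_mem' {p} hp τ := by
    have := hp (τ + (-p : ℝ))
    rw [add_assoc, ← Complex.ofReal_add, neg_add_cancel, Complex.ofReal_zero, add_zero] at this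
    linear_combination -this
  add_mem' {p q} hp hq τ := by
    rw [Complex.ofReal_add, ← add_assoc]
    refine sub_eq_zero.1 ?_
    -- the equations for `p` and `q` give the one for `p + q` after multiplication by
    -- `freeValue (τ + p)`, which is not identically zero
    have d1 : Differentiable ℂ fun τ : ℂ => τ + p := differentiable_id.add_const _
    have d2 : Differentiable ℂ fun τ : ℂ => τ + p + q := d1.add_const _
    refine Differentiable.eq_zero_of_mul_eq_zero (x := -(p : ℂ))
      (f := fun τ : ℂ => T.freeValue (τ + p))
      (g := fun τ : ℂ => T.freeValue (τ + p + q) * T.freeDeriv τ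
        - T.freeDeriv (τ + p + q) * T.freeValue τ)
      (T.differentiable_freeValue.comp d1)
      (((T.differentiable_freeValue.comp d2).mul T.differentiable_freeDeriv).sub
        ((T.differentiable_freeDeriv.comp d2).mul T.differentiable_freeValue))
      (by simp [T.freeValue_zero]) (fun t => ?_) τ
    linear_combination T.freeValue (t + p + q) * hp t + T.freeValue t * hq (t + p)

theorem mem_freePeriods {p : ℝ} : p ∈ T.freePeriods ↔ ∀ τ : ℂ,
    T.freeValue (τ + p) * T.freeDeriv τ = T.freeDeriv (τ + p) * T.freeValue τ := Iff.rfl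

theorem isPeriodOfS_zeroPotential_iff (p : ℝ) :
    T.zeroPotential.IsPeriodOfS p ↔ p ∈ T.freePeriods := by
  rw [mem_freePeriods]
  constructor
  · intro h τ
    refine sub_eq_zero.1 ?_
    have d1 : Differentiable ℂ fun τ : ℂ => τ + p := differentiable_id.add_const _
    -- the equation may fail at first only where `τ (τ + p) = 0`
    refine Differentiable.eq_zero_of_mul_eq_zero (x := ((|p| + 1 : ℝ) : ℂ))
      (f := fun τ : ℂ => τ * (τ + p))
      (g := fun τ : ℂ => T.freeValue (τ + p) * T.freeDeriv τ - T.freeDeriv (τ + p) * T.freeValue τ)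
      (differentiable_id.mul d1)
      (((T.differentiable_freeValue.comp d1).mul T.differentiable_freeDeriv).sub
        ((T.differentiable_freeDeriv.comp d1).mul T.differentiable_freeValue))
      ?_ (fun t => ?_) τ
    · have h1 : 0 < |p| + 1 := by positivity
      have h2 : 0 < |p| + 1 + p := by linarith [neg_abs_le p]
      rw [← Complex.ofReal_add]
      exact mul_ne_zero (by exact_mod_cast h1.ne') (by exact_mod_cast h2.ne')
    · by_cases ht : (t : ℂ) = 0
      · simp [ht]
      by_cases htp : (t : ℂ) + p = 0
      · simp [htp]
      rw [← Complex.ofReal_add] at htp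
      rw [← Complex.ofReal_add]
      by_cases h0 : T.freeDeriv t + Complex.I * T.freeValue t = 0
      · obtain ⟨h1, h2⟩ := T.free_eq_zero_of_jost h0
        rw [h1, h2]; ring
      by_cases h0' : T.freeDeriv (t + p : ℝ) + Complex.I * T.freeValue (t + p : ℝ) = 0
      · obtain ⟨h1, h2⟩ := T.free_eq_zero_of_jost h0'
        rw [h1, h2]; ring
      have ht' := neg_ne_zero.2 ht
      have htp' := neg_ne_zero.2 htp
      have key := h t (by rw [zeroPotential_jost_neg_eq]; exact mul_ne_zero ht' h0)
        (by rw [← Complex.ofReal_add, zeroPotential_jost_neg_eq]; exact mul_ne_zero htp' h0')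
      rw [← Complex.ofReal_add, sFunction, sFunction, zeroPotential_jost_neg_eq,
        zeroPotential_jost_neg_eq, zeroPotential_jost_eq, zeroPotential_jost_eq,
        mul_div_mul_left _ _ htp', mul_div_mul_left _ _ ht', div_eq_div_iff h0' h0] at key
      have hI : (2 * Complex.I) ≠ 0 := mul_ne_zero two_ne_zero Complex.I_ne_zero
      refine mul_eq_zero_of_right _ (mul_left_cancel₀ hI ?_)
      linear_combination -key
  · intro h τ h0 h0'
    rw [sFunction, sFunction, div_eq_div_iff h0' h0]
    rw [zeroPotential_jost_neg_eq, zeroPotential_jost_neg_eq, zeroPotential_jost_eq,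
      zeroPotential_jost_eq]
    linear_combination -2 * Complex.I * τ * (τ + p) * h τ

variable (T) in
theorem pos_periods_eq : {p : ℝ | 0 < p ∧ T.zeroPotential.IsPeriodOfS p}
    = {p | p ∈ T.freePeriods ∧ 0 < p} := by
  ext p
  rw [Set.mem_ofPred_eq, Set.mem_ofPred_eq, isPeriodOfS_zeroPotential_iff, and_comm]

theorem SameFree.freePeriods_le (h : T.SameFree T') : T.freePeriods ≤ T'.freePeriods := by
  intro p hp τ
  have d1 : Differentiable ℂ fun τ : ℂ => τ + p := differentiable_id.add_const _
  refine sub_eq_zero.1 ?_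
  have hg := ((T'.differentiable_freeValue.comp d1).mul T'.differentiable_freeDeriv).sub
    ((T'.differentiable_freeDeriv.comp d1).mul T'.differentiable_freeValue)
  -- the equation holds after multiplication by `freeValue τ * freeValue (τ + p)`
  refine Differentiable.eq_zero_of_mul_eq_zero (x := 0) T.differentiable_freeValue hg
    (by simp [T.freeValue_zero]) (fun t => ?_) τ
  refine Differentiable.eq_zero_of_mul_eq_zero (x := -(p : ℂ))
    (T.differentiable_freeValue.comp d1) (T.differentiable_freeValue.mul hg)
    (by simp [T.freeValue_zero]) (fun t => ?_) t
  simp only [Function.comp_apply, Pi.mul_apply, Pi.sub_apply]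
  linear_combination -T.freeValue (t + p) * T'.freeValue (t + p) * h t
    + T'.freeValue t * T'.freeValue (t + p) * hp t + T.freeValue t * T'.freeValue t * h (t + p)

theorem SameFree.symm (h : T.SameFree T') : T'.SameFree T := fun τ => (h τ).symm

theorem SameFree.freePeriods_eq (h : T.SameFree T') : T.freePeriods = T'.freePeriods :=
  le_antisymm h.freePeriods_le h.symm.freePeriods_le

variable (T) in
theorem pi_div_mem_freePeriods : Real.pi / T.l ∈ T.freePeriods := fun τ => by
  obtain ⟨ε, h1, h2⟩ := T.free_add_pi_div τ
  rw [h1, h2]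
  ring

variable (T) in
/-- A period `p` satisfies `freeDeriv p = 0`, because this holds for `p = 0`; and `0` is an isolated
zero of this function. -/
theorem exists_isLeast_period [Nontrivial V] :
    ∃ P, IsLeast {p | p ∈ T.freePeriods ∧ 0 < p} P := by
  have hpi : 0 < Real.pi / T.l := div_pos Real.pi_pos T.l_pos
  have hne : (((Fintype.card V : ℂ) - 1) * T.l) ≠ 0 := by
    have h1 : (Fintype.card V : ℂ) ≠ 1 := by exact_mod_cast (Fintype.one_lt_card (α := V)).ne'
    exact mul_ne_zero (sub_ne_zero.2 h1) (by exact_mod_cast T.l_pos.ne')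
  have hev := T.hasDerivAt_freeDeriv_zero.eventually_ne hne (c := 0)
  obtain ⟨ε, hε, hball⟩ := Metric.eventually_nhds_iff.1 (eventually_nhdsWithin_iff.1 hev)
  refine AddSubgroup.exists_isLeast_pos (fun h => hpi.ne' ?_) hε
    (Set.disjoint_left.2 fun p hp hpε => ?_)
  · have := T.pi_div_mem_freePeriods
    rw [h] at this
    simpa using this
  · have h0 := hp 0
    rw [zero_add, T.freeDeriv_zero, T.freeValue_zero, mul_zero, mul_one] at h0
    refine hball ?_ ?_ h0.symm
    · rw [dist_zero_right, Complex.norm_real, Real.norm_of_nonneg hpε.1.le]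
      exact hpε.2
    · simpa using hpε.1.ne'

theorem exists_pi_div_eq_mul {P : ℝ} (hP : IsLeast {p | p ∈ T.freePeriods ∧ 0 < p} P) :
    ∃ k : ℕ, 0 < k ∧ Real.pi / T.l = k * P := by
  have hpi : 0 < Real.pi / T.l := div_pos Real.pi_pos T.l_pos
  have hmem := T.pi_div_mem_freePeriods
  rw [AddSubgroup.cyclic_of_min hP, AddSubgroup.mem_closure_singleton] at hmem
  obtain ⟨k, hk⟩ := hmem
  have hk0 : 0 < k := by
    by_contra! hle
    have : (k : ℝ) ≤ 0 := by exact_mod_cast hle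
    rw [zsmul_eq_mul] at hk
    have := hP.1.2
    nlinarith
  lift k to ℕ using hk0.le
  exact ⟨k, by exact_mod_cast hk0, by rw [← hk]; simp⟩

end QuantumTree

theorem mainTheorem1 {V : Type u} [Fintype V] [Nontrivial V] (T : QuantumTree V) :
    -- the S-function is the one of the scattering problem on the tree with the lead
    (∀ τ : ℂ, τ ≠ 0 →
      (∃ Y Y₀, T.IsSolution (τ ^ 2) Y Y₀ ∧ ∀ x : ℝ, 0 ≤ x →
        (Y₀ x).1 = 1 / (2 * Complex.I * τ) *
          (Complex.exp (Complex.I * τ * x) * T.jost τ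
            - Complex.exp (-(Complex.I * τ * x)) * T.jost (-τ))) ∧
      (T.jost τ ≠ 0 ∨ T.jost (-τ) ≠ 0 → ∀ Y Y₀, T.IsSolution (τ ^ 2) Y Y₀ →
        ∃ a : ℂ, ∀ x : ℝ, 0 ≤ x →
          (Y₀ x).1 = a *
            (Complex.exp (Complex.I * τ * x) * T.jost τ
              - Complex.exp (-(Complex.I * τ * x)) * T.jost (-τ)))) ∧
    -- asymptotics of S, away from the zeros of the zero-potential Jost function
    (∀ δ : ℝ, 0 < δ →
      (∀ᶠ τ : ℝ in atTop, (∀ t ∈ T.zeroPotential.realZeros, δ ≤ |τ - t|) →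
        T.zeroPotential.jost (-τ) ≠ 0 ∧ T.jost (-τ) ≠ 0) ∧
      Tendsto (fun τ : ℝ => T.sFunction τ / T.zeroPotential.sFunction τ)
        (atTop ⊓ 𝓟 {τ : ℝ | ∀ t ∈ T.zeroPotential.realZeros, δ ≤ |τ - t|}) (𝓝 1)) ∧
    -- the zero-potential characteristic functions and the two determinants
    (∀ τ : ℂ,
      T.zeroPotential.phiD (τ ^ 2) =
        (-1) ^ (Fintype.card V - 1) * aeval (Complex.cos (τ * T.l)) T.psiHat ∧
      Complex.sin (τ * T.l) * T.zeroPotential.phiN (τ ^ 2) =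
        (-1) ^ Fintype.card V * τ * aeval (Complex.cos (τ * T.l)) T.psi) ∧
    -- the ratio in terms of the characteristic functions and of the zero-potential S-function
    (∀ z ∈ Set.Ioo (-1 : ℝ) 1, aeval (z : ℂ) T.psiHat ≠ 0 →
      T.zeroPotential.phiD (((Real.arccos z / T.l : ℝ) : ℂ) ^ 2) ≠ 0 ∧
      aeval (z : ℂ) T.psi / aeval (z : ℂ) T.psiHat =
        -((T.l / Real.arccos z * √(1 - z ^ 2) : ℝ) : ℂ) *
          (T.zeroPotential.phiN (((Real.arccos z / T.l : ℝ) : ℂ) ^ 2) /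
            T.zeroPotential.phiD (((Real.arccos z / T.l : ℝ) : ℂ) ^ 2)) ∧
      T.zeroPotential.jost (-((Real.arccos z / T.l : ℝ) : ℂ)) ≠ 0 ∧
      T.zeroPotential.sFunction ((Real.arccos z / T.l : ℝ) : ℂ) ≠ 1 ∧
      aeval (z : ℂ) T.psi / aeval (z : ℂ) T.psiHat =
        -(Complex.I * (√(1 - z ^ 2) : ℝ)) *
          ((T.zeroPotential.sFunction ((Real.arccos z / T.l : ℝ) : ℂ) + 1) /
            (T.zeroPotential.sFunction ((Real.arccos z / T.l : ℝ) : ℂ) - 1))) ∧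
    -- common zeros are embedded eigenvalues of the zero-potential operator
    (∀ τ : ℝ, 0 < τ →
      (T.zeroPotential.IsEigenvalue ((τ : ℂ) ^ 2) ↔
        aeval (Real.cos (τ * T.l)) T.psi = 0 ∧ aeval (Real.cos (τ * T.l)) T.psiHat = 0)) ∧
    -- expansion into a branched continued fraction and the shape
    (∃ B, T.IsExpansion B ∧ T.ReadOffFrom B) ∧
    {B | T.IsExpansion B}.Finite ∧
    (∀ B, T.IsExpansion B → ∃ (n : ℕ) (T' : RootedCombTree (Fin n)), T'.ReadOffFrom B) ∧
    (∀ (W : Type w) [Fintype W] (T' : RootedCombTree W) (B B' : BranchedCF),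
      T.ReadOffFrom B → T'.ReadOffFrom B' → B.EqUpToOrder B' →
        T.toRootedCombTree.SameShape T') ∧
    -- periodicity
    (∀ τ : ℂ,
      T.zeroPotential.phiD ((τ + 2 * Real.pi / T.l) ^ 2) = T.zeroPotential.phiD (τ ^ 2) ∧
      τ * T.zeroPotential.phiN ((τ + 2 * Real.pi / T.l) ^ 2) =
        (τ + 2 * Real.pi / T.l) * T.zeroPotential.phiN (τ ^ 2)) ∧
    (∃ P : ℝ, IsLeast {p : ℝ | 0 < p ∧ T.zeroPotential.IsPeriodOfS p} P ∧
      (∃ k : ℕ, 0 < k ∧ Real.pi / T.l = k * P) ∧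
      ∀ (W : Type w) [Fintype W] [Nontrivial W] (T' : QuantumTree W), T.SameS T' →
        IsLeast {p : ℝ | 0 < p ∧ T'.zeroPotential.IsPeriodOfS p} P ∧
        ∃ k : ℕ, 0 < k ∧ Real.pi / T'.l = k * P) ∧
    -- what the S-function determines
    (∀ (W : Type w) [Fintype W] [Nontrivial W] (T' : QuantumTree W),
      (T.SameS T' → T.zeroPotential.EqS T'.zeroPotential) ∧
      (T.SameS T' → ((Fintype.card V : ℝ) - 1) * T.l = ((Fintype.card W : ℝ) - 1) * T'.l) ∧
      (T'.l = T.l →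
        (T.SameS T' → T'.ratio = T.ratio) ∧
        (T.zeroPotential.EqS T'.zeroPotential ↔ ∃ B, T.IsExpansion B ∧ T'.ReadOffFrom B) ∧
        (T.SameS T' →
          (∀ B B', T.IsExpansion B → T.IsExpansion B' → B.EqUpToOrder B') →
          T.toRootedCombTree.SameShape T'.toRootedCombTree))) := by
  refine ⟨fun τ hτ => ⟨T.exists_scattering_solution hτ,
      fun hne _ _ hY => T.solution_on_lead hτ hne hY⟩,
    fun δ hδ => ⟨T.eventually_jost_ne_zero hδ, T.tendsto_sFunction_div hδ⟩,
    T.zeroPotential_phi_eq_det, fun z hz hne => T.ratio_eq_of_mem_Ioo hz hne,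
    fun τ hτ => T.isEigenvalue_zeroPotential_iff_det hτ,
    ⟨_, T.readOffFrom_readOff_root.isExpansion, T.readOffFrom_readOff_root⟩,
    T.finite_isExpansion, fun B hB => hB.1.exists_tree,
    fun W _ T' B B' hB hB' h => T.sameShape_of_eqUpToOrder T' hB hB' h,
    T.zeroPotential_phi_periodic, ?_, fun W _ _ T' => ⟨fun h => ?_, fun h => ?_, fun hl =>
      ⟨fun h => ?_, ?_, fun h huniq => ?_⟩⟩⟩
  · obtain ⟨P, hP⟩ := T.exists_isLeast_period
    refine ⟨P, T.pos_periods_eq ▸ hP, QuantumTree.exists_pi_div_eq_mul hP, fun W _ _ T' h => ?_⟩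
    rw [h.sameFree.freePeriods_eq] at hP
    exact ⟨T'.pos_periods_eq ▸ hP, QuantumTree.exists_pi_div_eq_mul hP⟩
  · exact QuantumTree.eqS_zeroPotential_iff.2 h.sameFree
  · exact h.sameFree.length_eq
  · exact (QuantumTree.sameFree_iff_ratio_eq hl).1 h.sameFree
  · rw [QuantumTree.eqS_zeroPotential_iff, QuantumTree.sameFree_iff_ratio_eq hl]
    constructor
    · intro h
      have hB := T'.readOffFrom_readOff_root
      exact ⟨_, ⟨hB.isTreeForm, hB.value_eq.trans h⟩, hB⟩
    · rintro ⟨B, hB, hB'⟩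
      exact hB'.value_eq.symm.trans hB.2
  · have hB := T.readOffFrom_readOff_root
    have hB' := T'.readOffFrom_readOff_root
    have hr := (QuantumTree.sameFree_iff_ratio_eq hl).1 h.sameFree
    exact T.sameShape_of_eqUpToOrder T'.toRootedCombTree hB hB'
      (huniq _ _ hB.isExpansion ⟨hB'.isTreeForm, hB'.value_eq.trans hr⟩)
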